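/- Let $d\ge 0$ be an integer, $B>0$, $\lambda\ge 0$, $\mathcal W=\{w\in\mathbb R^d:\|w\|_1\le B\}$, let $z$ be a random variable with law $\mathbb P$, and let $f(w,z)$ be a real random function with $f(w,\cdot)$ integrable for every $w\in\mathcal W$. Put $F(w)=\mathbb E_z[f(w,z)]$, $P(w)=F(w)+\lambda\|w\|_1$, $P_*=\min_{w\in\mathcal W}P(w)$ and $\mathcal W_*=\arg\min_{w\in\mathcal W}P(w)$. Assume that $P$ is convex on $\mathcal W$ and that on $\mathcal W$ the function $F$ is either quadratic, $F(w)=w^\top Aw+w^\top b+c$, or piecewise linear (affine on each of finitely many polyhedra covering $\mathcal W$). For $\alpha>0$, the problem satisfies EBC$(1,\alpha)$ if $\|w-w^*\|_2^2\le\alpha\,(P(w)-P(w^*))$ for all $w\in\mathcal W$, where $w^*$ is the point of $\mathcal W_*$ closest to $w$. (1) There is $\alpha>0$ such that the problem satisfies EBC$(1,\alpha)$. Now let $\alpha>0$ be such that EBC$(1,\alpha)$ holds, assume that $f(\cdot,z)$ is $G$-Lipschitz on $\mathcal W$ in the Euclidean norm for every $z$ (with $G>0$), and let $z_1,z_2,\dots$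 be i.i.d. with law $\mathbb P$. Then the following hold. (2) ERM. There is a constant $C_1$ depending only on $\alpha,B,G$ such that for all $n\ge 2$ and $\delta\in(0,1)$, with probability at least $1-\delta$, every minimizer $\hat w$ over $\mathcal W$ of $P_n(w)=\frac1n\sum_{i=1}^n f(w,z_i)+\lambda\|w\|_1$ satisfies $$P(\hat w)-P_*\le C_1\,\frac{d\log n+\log(1/\delta)}{n}.$$ (3) ASA. Let $g(w,z)$ be a jointly measurable stochastic subgradient of $P$ on $\mathcal W$, i.e. $\mathbb E_z[g(w,z)]\in\partial P(w)$ (relative to $\mathcal W$) for $w\in\mathcal W$, with $\|g(w,z)\|_2\le\Gamma$ for $w\in\mathcal W$ and all $z$ ($\Gamma>0$); for instance, bounded measurable subgradients of $f(\cdot,z)+\lambda\|\cdot\|_1$ when these functions are convex. Let $w_1\in\mathcal W$ be at Euclidean distance at most $R_0$ from $\mathcal W_*$. Given $n\ge 100$, let $m=\lfloor\frac12\log_2\frac{2n}{\log_2 n}\rfloor-1$, $n_0=\lfloor n/m\rfloor$, $\hat w_0=w_1$. For $k=1,\dots,m$ let $R_{k-1}=R_0/2^{k-1}$, let $\mathcal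 W_k$ be the intersection of $\mathcal W$ with the closed Euclidean ball of center $\hat w_{k-1}$ and radius $R_{k-1}$, run $n_0$ steps $v_{t+1}=\Pi_{\mathcal W_k}(v_t-\gamma_k\, g(v_t,z_{(k-1)n_0+t}))$, $t=1,\dots,n_0$, from $v_1=\hat w_{k-1}$, with $\gamma_k=R_{k-1}/(\Gamma\sqrt{n_0+1})$, and let $\hat w_k=\frac1{n_0+1}\sum_{t=1}^{n_0+1}v_t$. There is an absolute constant $C_2$ such that for all $n\ge100$ and $\delta\in(0,1)$, with probability at least $1-\delta$, $$P(\hat w_m)-P_*\le C_2\max(\alpha\Gamma^2,R_0\Gamma)\,\frac{\log n\,\log(\log(n)/\delta)}{n}.$$ (4) ERM, non-negative smooth convex losses. Suppose in addition that there are $L\ge0$ and $\rho>0$ such that for every $z$ the function $f(\cdot,z)$ is non-negative, convex, differentiable and $L$-smooth on the set $U$ of points at Euclidean distance less than $\rho$ from $\mathcal W$, that is, $f(\cdot,z)\ge0$ on $U$ and $0\le f(w,z)-f(u,z)-\nabla f(u,z)^\top(w-u)\le\frac L2\|w-u\|_2^2$ for $w,u\in U$. There are constants $\kappa,C_3$ depending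 only on $\alpha,B,G,L,\rho$ such that for all $n\ge2$ with $n\ge\kappa\, d\log n$ and all $\delta\in(0,1)$, with probability at least $1-\delta$, every minimizer $\hat w$ of $P_n$ over $\mathcal W$ satisfies $$P(\hat w)-P_*\le C_3\left(\Big(\frac{d\log n+\log(1/\delta)}{n}\Big)^2+\frac{(d\log n+\log(1/\delta))\,P_*}{n}\right).$$ -/

import Mathlib

open MeasureTheory ProbabilityTheory

universe u v

noncomputable section

namespace L1Risk

/-- `ℝ^d` with the Euclidean norm. -/
abbrev Vec (d : ℕ) := EuclideanSpace ℝ (Fin d)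

variable {d : ℕ}

/-! ### Piecewise linear and quadratic functions -/

/-- A (closed, convex) polyhedron: the solution set of finitely many linear inequalities. -/
def IsPolyhedron (Q : Set (Vec d)) : Prop :=
  ∃ (m : ℕ) (a : Fin m → Vec d) (b : Fin m → ℝ), Q = {w | ∀ i, inner ℝ (a i) w ≤ b i}

/-- `h` is piecewise linear on `K`: finitely many polyhedra cover `K`, and `h` is affine on the part
of `K` in each of them. (As the pieces are closed, such an `h` is continuous on `K`.) -/
def IsPiecewiseLinearOn (K : Set (Vec d)) (h : Vec d → ℝ) : Prop :=
  ∃ (m : ℕ) (Q : Fin m → Set (Vec d)) (a : Fin m → Vec d) (c : Fin m → ℝ),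
    (∀ i, IsPolyhedron (Q i)) ∧ K ⊆ ⋃ i, Q i ∧
      ∀ i, ∀ w ∈ K ∩ Q i, h w = inner ℝ (a i) w + c i

/-- `h` is given on `K` by a quadratic polynomial `wᵀ A w + wᵀ b + c`. -/
def IsQuadraticOn (K : Set (Vec d)) (h : Vec d → ℝ) : Prop :=
  ∃ (A : Matrix (Fin d) (Fin d) ℝ) (b : Fin d → ℝ) (c : ℝ),
    ∀ w ∈ K, h w = w.ofLp ⬝ᵥ A.mulVec w.ofLp + w.ofLp ⬝ᵥ b + c

/-! ### The `ℓ₁`-regularized, `ℓ₁`-constrained risk minimization problem -/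

/-- The `ℓ₁` norm on `ℝ^d`. -/
def l1Norm (w : Vec d) : ℝ := ∑ i, |w i|

/-- The feasible set `{w : ‖w‖₁ ≤ B}`. -/
def l1Ball (d : ℕ) (B : ℝ) : Set (Vec d) := {w | l1Norm w ≤ B}

variable {Z : Type*} [MeasurableSpace Z]

/-- The expected loss `F(w) = E f(w, z)`, `z ∼ μ`. -/
def expectedLoss (μ : Measure Z) (f : Vec d → Z → ℝ) (w : Vec d) : ℝ := ∫ z, f w z ∂μ

/-- The regularized risk `P(w) = E f(w, z) + lam ‖w‖₁`. -/
def risk (μ : Measure Z) (f : Vec d → Z → ℝ) (lam : ℝ) (w : Vec d) : ℝ :=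
  expectedLoss μ f w + lam * l1Norm w

/-- The regularized empirical risk `P_n(w) = n⁻¹ ∑_{i < n} f(w, z_i) + lam ‖w‖₁`. -/
def empiricalRisk (f : Vec d → Z → ℝ) (lam : ℝ) (n : ℕ) (z : ℕ → Z) (w : Vec d) : ℝ :=
  (1 / (n : ℝ)) * ∑ i ∈ Finset.range n, f w (z i) + lam * l1Norm w

/-- The set of minimizers of `P` over `K`. -/
def minimizers (K : Set (Vec d)) (P : Vec d → ℝ) : Set (Vec d) :=
  {v | v ∈ K ∧ ∀ u ∈ K, P v ≤ P u}

/-- The optimal value of `P` over `K`. -/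
def optimalValue (K : Set (Vec d)) (P : Vec d → ℝ) : ℝ := sInf (P '' K)

/-- The error bound condition `EBC(θ, α)` for `min_{w ∈ K} P(w)`: every `w ∈ K` has a closest
minimizer `w'` (in Euclidean distance), and `‖w - w'‖² ≤ α (P w - P w')^θ`. -/
def EBC (K : Set (Vec d)) (P : Vec d → ℝ) (θ α : ℝ) : Prop :=
  ∀ w ∈ K, ∃ w' ∈ minimizers K P,
    (∀ u ∈ minimizers K P, ‖w' - w‖ ≤ ‖u - w‖) ∧ ‖w - w'‖ ^ 2 ≤ α * (P w - P w') ^ θ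

/-- `f(·, z)` is `G`-Lipschitz on `K` for every `z`. -/
def IsLipschitzLoss (K : Set (Vec d)) (f : Vec d → Z → ℝ) (G : ℝ) : Prop :=
  ∀ z, ∀ w ∈ K, ∀ u ∈ K, |f w z - f u z| ≤ G * ‖w - u‖

/-- For every `z`, `f(·, z)` is non-negative, differentiable, convex and `L`-smooth on the open
set `U`. -/
def IsNonnegSmoothConvexLoss (U : Set (Vec d)) (f : Vec d → Z → ℝ) (L : ℝ) : Prop :=
  ∀ z, (∀ w ∈ U, 0 ≤ f w z) ∧
    (∀ w ∈ U, DifferentiableAt ℝ (fun v => f v z) w) ∧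
    ∀ w ∈ U, ∀ u ∈ U,
      0 ≤ f w z - f u z - inner ℝ (gradient (fun v => f v z) u) (w - u) ∧
      f w z - f u z - inner ℝ (gradient (fun v => f v z) u) (w - u) ≤ L / 2 * ‖w - u‖ ^ 2

/-! ### Samples -/

/-- `ζ 0, ζ 1, …` are i.i.d. random variables with law `μ`. -/
structure IsIIDSample {Ω : Type*} [MeasurableSpace Ω] (ν : Measure Ω) (μ : Measure Z)
    (ζ : ℕ → Ω → Z) : Prop where
  measurable : ∀ i, Measurable (ζ i)
  law : ∀ i, Measure.map (ζ i) ν = μ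
  indep : iIndepFun ζ ν

/-! ### The adaptive stochastic approximation algorithm -/

/-- `g` is a stochastic subgradient oracle for `P` on `K`, with norm bound `Γ`: queried at `w ∈ K`
with a sample `z ∼ μ`, it returns a vector `g w z` with mean in the subdifferential of `P` at `w`. -/
structure IsStochasticSubgradient (K : Set (Vec d)) (μ : Measure Z) (P : Vec d → ℝ)
    (g : Vec d → Z → Vec d) (Γ : ℝ) : Prop where
  measurable : Measurable (Function.uncurry g)
  norm_le : ∀ w ∈ K, ∀ z, ‖g w z‖ ≤ Γ
  mean_mem : ∀ w ∈ K, ∀ u ∈ K, P w + inner ℝ (∫ z, g w z ∂μ) (u - w) ≤ P u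

/-- Bounded measurable selections `g w z` of the subdifferentials of the regularized random
functions `f(·, z) + lam ‖·‖₁` at `w` are stochastic subgradients of the regularized risk. -/
theorem IsStochasticSubgradient.of_pointwise {K : Set (Vec d)} {μ : Measure Z}
    [IsProbabilityMeasure μ] {f : Vec d → Z → ℝ} {lam Γ : ℝ} {g : Vec d → Z → Vec d}
    (hf : ∀ w ∈ K, Integrable (f w) μ) (hg : Measurable (Function.uncurry g))
    (hΓ : ∀ w ∈ K, ∀ z, ‖g w z‖ ≤ Γ)
    (h : ∀ z, ∀ w ∈ K, ∀ u ∈ K,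
      f w z + lam * l1Norm w + inner ℝ (g w z) (u - w) ≤ f u z + lam * l1Norm u) :
    IsStochasticSubgradient K μ (risk μ f lam) g Γ := by
  refine ⟨hg, hΓ, fun w hw u hu => ?_⟩
  have hgi : Integrable (g w) μ :=
    Integrable.of_bound (hg.comp measurable_prodMk_left).aestronglyMeasurable Γ
      (Filter.Eventually.of_forall (hΓ w hw))
  have hin : Integrable (fun z => inner ℝ (g w z) (u - w)) μ := hgi.inner_const (u - w)
  have hmean : ∫ z, inner ℝ (g w z) (u - w) ∂μ = inner ℝ (∫ z, g w z ∂μ) (u - w) := by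
    have := integral_inner (𝕜 := ℝ) hgi (u - w)
    simp_rw [real_inner_comm (u - w)]
    exact this
  have h1 : ∫ z, (f w z + inner ℝ (g w z) (u - w)) ∂μ
      ≤ ∫ z, (f u z + (lam * l1Norm u - lam * l1Norm w)) ∂μ :=
    integral_mono ((hf w hw).add hin) ((hf u hu).add (integrable_const _))
      (fun z => by have := h z w hw u hu; simp only; linarith)
  rw [integral_add (hf w hw) hin, integral_add (hf u hu) (integrable_const _), hmean] at h1
  simp only [integral_const, probReal_univ, one_smul] at h1
  simp only [risk, expectedLoss]
  linarith

open Classical in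
/-- The Euclidean projection onto `K` (the closest point of `K`; it exists and is unique for
nonempty closed convex `K`, which are the only sets it is used for). -/
def proj (K : Set (Vec d)) (x : Vec d) : Vec d :=
  if h : ∃ v ∈ K, ∀ u ∈ K, ‖v - x‖ ≤ ‖u - x‖ then h.choose else x

/-- The iterates of the projected stochastic subgradient method: `w_1 = w₁`,
`w_{t+1} = Π_K (w_t - γ g(w_t, z_t))`. Here `ssgIter … t` is `w_{t+1}`, and it uses the samples
`z 0, …, z (t - 1)`. -/
def ssgIter (g : Vec d → Z → Vec d) (K : Set (Vec d)) (γ : ℝ) (w₁ : Vec d) (z : ℕ → Z) :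
    ℕ → Vec d
  | 0 => w₁
  | t + 1 => proj K (ssgIter g K γ w₁ z t - γ • g (ssgIter g K γ w₁ z t) (z t))

/-- `SSG(w₁, γ, T, K)`: the average of `w_1, …, w_{T+1}`. -/
def ssg (g : Vec d → Z → Vec d) (K : Set (Vec d)) (γ : ℝ) (w₁ : Vec d) (z : ℕ → Z) (T : ℕ) :
    Vec d :=
  (1 / ((T : ℝ) + 1)) • ∑ t ∈ Finset.range (T + 1), ssgIter g K γ w₁ z t

/-- The number of stages, `m = ⌊½ log₂ (2n / log₂ n)⌋ - 1`. -/
def asaStages (n : ℕ) : ℕ :=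
  ⌊(1 / 2 : ℝ) * Real.logb 2 (2 * (n : ℝ) / Real.logb 2 (n : ℝ))⌋₊ - 1

/-- The number of iterations per stage, `n₀ = ⌊n / m⌋`. -/
def asaStageLength (n : ℕ) : ℕ := n / asaStages n

/-- The point `ŵ_k` after `k` stages: stage `k + 1` runs `SSG` from `ŵ_k` for `n₀` iterations with
step size `R_k / (Γ √(n₀ + 1))` on `K ∩ closedBall ŵ_k R_k`, where `R_k = R₀ / 2 ^ k`, on the next
`n₀` samples. -/
def asaIter (g : Vec d → Z → Vec d) (K : Set (Vec d)) (Γ R₀ : ℝ) (w₁ : Vec d) (n₀ : ℕ)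
    (z : ℕ → Z) : ℕ → Vec d
  | 0 => w₁
  | k + 1 =>
      ssg g (K ∩ Metric.closedBall (asaIter g K Γ R₀ w₁ n₀ z k) (R₀ / 2 ^ k))
        (R₀ / 2 ^ k / (Γ * Real.sqrt ((n₀ : ℝ) + 1))) (asaIter g K Γ R₀ w₁ n₀ z k)
        (fun t => z (k * n₀ + t)) n₀

/-- The output of `ASA(w₁, n, R₀)`; it makes one pass over (at most) the `n` samples
`z 0, …, z (n - 1)`. -/
def asa (g : Vec d → Z → Vec d) (K : Set (Vec d)) (Γ R₀ : ℝ) (w₁ : Vec d) (n : ℕ) (z : ℕ → Z) :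
    Vec d :=
  asaIter g K Γ R₀ w₁ (asaStageLength n) z (asaStages n)

end L1Risk

end

open L1Risk

/-!
By Hoffman's bound, the distance to a polyhedron is at most a constant times the violation of its
inequalities. On a polyhedron, the minimizers of a convex quadratic function form a polyhedron,
cut out by the vanishing of finitely many squares and of one linear form, which are controlled by
the excess of the function; so `dist² ≤ α · excess`. This passes to functions that are quadratic on
each of finitely many polyhedral pieces, where on pieces without a minimizer the excess is bounded
below.

Empirical risk minimization: for a Lipschitz loss, the variance of `f w - f v` is at most
`G² ‖w - v‖²`, which for the closest minimizer `v` is at most `α G²` times the excess risk of `w`.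
With this variance Bernstein's inequality on a net of `n ^ O(d)` points bounds the excess risk of an
empirical minimizer by a small fraction of itself plus `O((d log n + log (1 / δ)) / n)`. For
non-negative smooth losses the squared slope is at most a multiple of the loss, which brings the
risk of `v`, and hence `P_*`, into the variance.

Adaptive stochastic approximation: a stage started within `R` of the minimizers ends with excess at
most `a R`; so it ends within `R / 2` of them, or its excess is already `O(α a²)`. The noise of a
stage is compared with its value at ghost iterates, driven by the noise itself, which removes the
supremum over the comparison point and leaves a sub-Gaussian martingale.
-/

open scoped InnerProductSpace Topology NNReal

namespace L1Risk

/-! ### Hoffman's error bound for systems of linear inequalities -/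

section Hoffman

variable {E : Type*} [NormedAddCommGroup E] [InnerProductSpace ℝ E] {ι κ : Type*}

lemma exists_norm_sub_le_of_isClosed {E : Type*} [NormedAddCommGroup E] [ProperSpace E]
    {K : Set E} (hc : IsClosed K) (hne : K.Nonempty) (x : E) :
    ∃ v ∈ K, ∀ u ∈ K, ‖v - x‖ ≤ ‖u - x‖ := by
  obtain ⟨v, hv, h⟩ := hc.exists_infDist_eq_dist hne x
  refine ⟨v, hv, fun u hu => ?_⟩
  rw [norm_sub_rev, ← dist_eq_norm, ← h, norm_sub_rev, ← dist_eq_norm]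
  exact Metric.infDist_le_dist_of_mem hu

lemma inner_sub_sub_nonpos_of_forall_norm_sub_le {K : Set E} (hK : Convex ℝ K) {x v : E}
    (hv : v ∈ K) (h : ∀ u ∈ K, ‖v - x‖ ≤ ‖u - x‖) {u : E} (hu : u ∈ K) :
    ⟪x - v, u - v⟫_ℝ ≤ 0 := by
  refine (norm_eq_iInf_iff_real_inner_le_zero hK hv).1 ?_ u hu
  have : Nonempty K := ⟨⟨v, hv⟩⟩
  refine le_antisymm (le_ciInf fun w => ?_) (ciInf_le ⟨0, ?_⟩ (⟨v, hv⟩ : K))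
  · rw [norm_sub_rev, norm_sub_rev x]
    exact h w w.2
  · rintro _ ⟨w, rfl⟩
    exact norm_nonneg _

lemma isClosed_setOf_forall_inner_le (a : ι → E) (b : ι → ℝ) :
    IsClosed {w : E | ∀ i, ⟪a i, w⟫_ℝ ≤ b i} := by
  simp only [Set.ofPred_forall]
  exact isClosed_iInter fun i => isClosed_le (by fun_prop) continuous_const

lemma convex_setOf_forall_inner_le (a : ι → E) (b : ι → ℝ) :
    Convex ℝ {w : E | ∀ i, ⟪a i, w⟫_ℝ ≤ b i} := by
  simp only [Set.ofPred_forall]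
  exact convex_iInter fun i => convex_halfSpace_le (innerSL ℝ (a i)).isLinear _

lemma exists_pos_le_sum_posPart_of_polar [FiniteDimensional ℝ E] (a : ι → E) (I : Finset ι) :
    ∃ c > 0, ∀ u : E, (∀ v, (∀ i ∈ I, ⟪a i, v⟫_ℝ ≤ 0) → ⟪u, v⟫_ℝ ≤ 0) →
      c * ‖u‖ ≤ ∑ i ∈ I, (⟪a i, u⟫_ℝ)⁺ := by
  set C : Set E := Metric.sphere 0 1 ∩
    {u | ∀ v, (∀ i ∈ I, ⟪a i, v⟫_ℝ ≤ 0) → ⟪u, v⟫_ℝ ≤ 0}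
  have hC : IsCompact C := by
    refine (isCompact_sphere _ _).inter_right ?_
    simp only [Set.ofPred_forall]
    exact isClosed_iInter fun v => isClosed_iInter fun _ =>
      isClosed_le (by fun_prop) continuous_const
  -- A unit vector of the polar with vanishing residuals would lie in the cone as well.
  have hpos : ∀ u ∈ C, 0 < ∑ i ∈ I, (⟪a i, u⟫_ℝ)⁺ := by
    rintro u ⟨hu, hpolar⟩
    refine (Finset.sum_nonneg fun i _ => posPart_nonneg _).lt_of_ne fun h => ?_
    have hcone := (Finset.sum_eq_zero_iff_of_nonneg fun i _ => posPart_nonneg _).1 h.symm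
    have := hpolar u fun i hi => posPart_eq_zero.1 (hcone i hi)
    rw [real_inner_self_eq_norm_sq, mem_sphere_zero_iff_norm.1 hu] at this
    norm_num at this
  obtain ⟨c, hc, hle⟩ := hC.exists_forall_le' (f := fun u => ∑ i ∈ I, (⟪a i, u⟫_ℝ)⁺)
    (by simp only [posPart_def]; fun_prop) hpos
  refine ⟨c, hc, fun u hu => ?_⟩
  rcases eq_or_ne u 0 with rfl | hu0
  · simp
  have hmem : ‖u‖⁻¹ • u ∈ C := by
    refine ⟨by simpa using norm_smul_inv_norm (𝕜 := ℝ) hu0, fun v hv => ?_⟩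
    rw [real_inner_smul_left]
    exact mul_nonpos_of_nonneg_of_nonpos (by positivity) (hu v hv)
  have hscale : ∑ i ∈ I, (⟪a i, ‖u‖⁻¹ • u⟫_ℝ)⁺ = ‖u‖⁻¹ * ∑ i ∈ I, (⟪a i, u⟫_ℝ)⁺ := by
    rw [Finset.mul_sum]
    refine Finset.sum_congr rfl fun i _ => ?_
    rw [inner_smul_right, posPart_def, posPart_def, mul_max_of_nonneg _ _ (by positivity), mul_zero]
  have h := hle _ hmem
  rwa [hscale, inv_mul_eq_div, le_div_iff₀ (norm_pos_iff.2 hu0)] at h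

lemma inner_sub_nonpos_of_active [Finite ι] {a : ι → E} {b : ι → ℝ} {w p : E}
    (hp : ∀ i, ⟪a i, p⟫_ℝ ≤ b i)
    (hclose : ∀ u, (∀ i, ⟪a i, u⟫_ℝ ≤ b i) → ‖p - w‖ ≤ ‖u - w‖)
    {v : E} (hv : ∀ i, ⟪a i, p⟫_ℝ = b i → ⟪a i, v⟫_ℝ ≤ 0) : ⟪w - p, v⟫_ℝ ≤ 0 := by
  have hfeasible : ∀ᶠ t : ℝ in 𝓝[>] 0, ∀ i, ⟪a i, p + t • v⟫_ℝ ≤ b i := by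
    refine Filter.eventually_all.2 fun i => ?_
    rcases (hp i).eq_or_lt with hi | hi
    · filter_upwards [self_mem_nhdsWithin] with t ht
      rw [inner_add_right, inner_smul_right, hi]
      linarith [mul_nonpos_of_nonneg_of_nonpos (le_of_lt ht) (hv i hi)]
    · have hcont : Continuous fun t : ℝ => ⟪a i, p + t • v⟫_ℝ := by fun_prop
      exact nhdsWithin_le_nhds ((hcont.tendsto 0).eventually (eventually_le_nhds (by simpa)))
  obtain ⟨t, hmem, ht⟩ := (hfeasible.and self_mem_nhdsWithin).exists
  have h := inner_sub_sub_nonpos_of_forall_norm_sub_le (convex_setOf_forall_inner_le a b) hp hclose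
    hmem
  rw [add_sub_cancel_left, inner_smul_right] at h
  exact nonpos_of_mul_nonpos_right h ht

theorem exists_hoffman_bound [FiniteDimensional ℝ E] [Fintype ι] (a : ι → E) (b : ι → ℝ)
    (hne : {w : E | ∀ i, ⟪a i, w⟫_ℝ ≤ b i}.Nonempty) :
    ∃ H > 0, ∀ w, ∃ p, (∀ i, ⟪a i, p⟫_ℝ ≤ b i) ∧
      ‖w - p‖ ≤ H * ∑ i, (⟪a i, w⟫_ℝ - b i)⁺ := by
  classical
  choose c hc0 hc using exists_pos_le_sum_posPart_of_polar a
  refine ⟨∑ I, (c I)⁻¹, Finset.sum_pos (fun I _ => inv_pos.2 (hc0 I)) ⟨∅, by simp⟩, fun w => ?_⟩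
  obtain ⟨p, hp, hclose⟩ :=
    exists_norm_sub_le_of_isClosed (isClosed_setOf_forall_inner_le a b) hne w
  refine ⟨p, hp, ?_⟩
  set I : Finset ι := {i | ⟪a i, p⟫_ℝ = b i}
  have hI : c I * ‖w - p‖ ≤ ∑ i ∈ I, (⟪a i, w⟫_ℝ - b i)⁺ := by
    refine (hc I _ fun v hv => inner_sub_nonpos_of_active hp hclose fun i hi =>
      hv i (by simpa [I])).trans_eq (Finset.sum_congr rfl fun i hi => ?_)
    rw [inner_sub_right, (Finset.mem_filter.1 hi).2]
  calc ‖w - p‖ = (c I)⁻¹ * (c I * ‖w - p‖) := (inv_mul_cancel_left₀ (hc0 I).ne' _).symm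
    _ ≤ (c I)⁻¹ * ∑ i ∈ I, (⟪a i, w⟫_ℝ - b i)⁺ :=
      mul_le_mul_of_nonneg_left hI (inv_pos.2 (hc0 I)).le
    _ ≤ (∑ I, (c I)⁻¹) * ∑ i, (⟪a i, w⟫_ℝ - b i)⁺ := by
      refine mul_le_mul ?_ ?_ (Finset.sum_nonneg fun i _ => posPart_nonneg _)
        (Finset.sum_nonneg fun I _ => (inv_pos.2 (hc0 I)).le)
      · exact Finset.single_le_sum (f := fun I => (c I)⁻¹)
          (fun I _ => (inv_pos.2 (hc0 I)).le) (Finset.mem_univ I)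
      · exact Finset.sum_le_sum_of_subset_of_nonneg (Finset.subset_univ I)
          fun i _ _ => posPart_nonneg _

theorem exists_hoffman_bound_of_eq [FiniteDimensional ℝ E] [Fintype ι] [Fintype κ] (a : ι → E)
    (b : ι → ℝ) (e : κ → E) (y : κ → ℝ)
    (hne : {w : E | (∀ i, ⟪a i, w⟫_ℝ ≤ b i) ∧ ∀ k, ⟪e k, w⟫_ℝ = y k}.Nonempty) :
    ∃ H > 0, ∀ w, ∃ p, (∀ i, ⟪a i, p⟫_ℝ ≤ b i) ∧ (∀ k, ⟪e k, p⟫_ℝ = y k) ∧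
      ‖w - p‖ ≤ H * (∑ i, (⟪a i, w⟫_ℝ - b i)⁺ + ∑ k, |⟪e k, w⟫_ℝ - y k|) := by
  obtain ⟨x, hxa, hxe⟩ := hne
  obtain ⟨H, hH, h⟩ := exists_hoffman_bound (Sum.elim a (Sum.elim e (-e)))
    (Sum.elim b (Sum.elim y (-y))) ⟨x, by simp [hxa, hxe]⟩
  refine ⟨H, hH, fun w => ?_⟩
  obtain ⟨p, hp, hle⟩ := h w
  simp only [Sum.forall, Sum.elim_inl, Sum.elim_inr, Pi.neg_apply, inner_neg_left,
    neg_le_neg_iff] at hp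
  refine ⟨p, hp.1, fun k => le_antisymm (hp.2.1 k) (hp.2.2 k), hle.trans_eq ?_⟩
  have habs : ∀ k, |⟪e k, w⟫_ℝ - y k| = (⟪e k, w⟫_ℝ - y k)⁺ + (-⟪e k, w⟫_ℝ - -y k)⁺ := fun k => by
    rw [← posPart_add_negPart, ← posPart_neg]
    ring_nf
  simp only [Fintype.sum_sum_type, Sum.elim_inl, Sum.elim_inr, Pi.neg_apply, inner_neg_left, habs,
    Finset.sum_add_distrib]

end Hoffman

/-! ### Quadratic growth of convex quadratic functions on polyhedra -/

section QuadraticGrowth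

variable {E : Type*} [NormedAddCommGroup E] [InnerProductSpace ℝ E] {ι κ : Type*}
  {S : Set E} {P : E → ℝ}

lemma exists_pos_add_smul_mem_sub_smul_mem [FiniteDimensional ℝ E] (hS : Convex ℝ S)
    (hne : S.Nonempty) {v : E} (hv : v ∈ vectorSpan ℝ S) :
    ∃ x ∈ S, ∃ t > (0 : ℝ), x + t • v ∈ S ∧ x - t • v ∈ S := by
  obtain ⟨x, y, hy, rfl⟩ := hne.intrinsicInterior hS
  have hmem : ∀ t : ℝ, t • v + (y : E) ∈ affineSpan ℝ S := fun t =>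
    AffineSubspace.vadd_mem_of_mem_direction
      (by rw [direction_affineSpan]; exact Submodule.smul_mem _ t hv) y.2
  let line : ℝ → affineSpan ℝ S := fun t => ⟨t • v + y, hmem t⟩
  have hline : Continuous line := by fun_prop
  have hev : ∀ᶠ t in 𝓝 0, (line t : E) ∈ S :=
    hline.tendsto' 0 y (Subtype.ext (by simp [line])) (mem_interior_iff_mem_nhds.1 hy)
  have hev_neg : ∀ᶠ t : ℝ in 𝓝 0, (line (-t) : E) ∈ S :=
    (continuous_neg.tendsto' 0 0 neg_zero).eventually hev
  obtain ⟨t, ⟨hadd, hsub⟩, ht⟩ :=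
    (((hev.and hev_neg).filter_mono nhdsWithin_le_nhds).and
      (self_mem_nhdsWithin : Set.Ioi (0 : ℝ) ∈ 𝓝[>] 0)).exists
  have hyS : y ∈ Subtype.val ⁻¹' S := interior_subset hy
  refine ⟨y, hyS, t, ht, ?_, ?_⟩
  · rwa [add_comm]
  · rwa [sub_eq_neg_add, ← neg_smul]

lemma inner_map_self_nonneg_of_convexOn [FiniteDimensional ℝ E] {T : E →L[ℝ] E} {b : E} {c : ℝ}
    (hP : ∀ w ∈ S, P w = ⟪T w, w⟫_ℝ + ⟪b, w⟫_ℝ + c) (hconv : ConvexOn ℝ S P)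
    (hne : S.Nonempty) {v : E} (hv : v ∈ vectorSpan ℝ S) : 0 ≤ ⟪T v, v⟫_ℝ := by
  obtain ⟨x, hx, t, ht, hadd, hsub⟩ := exists_pos_add_smul_mem_sub_smul_mem hconv.1 hne hv
  have hmid := hconv.2 hadd hsub (by norm_num : (0 : ℝ) ≤ 1 / 2) (by norm_num : (0 : ℝ) ≤ 1 / 2)
    (by norm_num)
  have hcenter : (1 / 2 : ℝ) • (x + t • v) + (1 / 2 : ℝ) • (x - t • v) = x := by module
  rw [hcenter, hP x hx, hP _ hadd, hP _ hsub] at hmid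
  simp only [map_add, map_sub, map_smul, inner_add_left, inner_add_right, inner_sub_left,
    inner_sub_right, real_inner_smul_left, real_inner_smul_right, smul_eq_mul] at hmid
  have : 0 ≤ t ^ 2 * ⟪T v, v⟫_ℝ := by linarith
  exact nonneg_of_mul_nonneg_right this (by positivity)

lemma exists_inner_map_self_eq_sum_sq [FiniteDimensional ℝ E] {T : E →L[ℝ] E} {V : Submodule ℝ E}
    (hT : ∀ v ∈ V, 0 ≤ ⟪T v, v⟫_ℝ) :
    ∃ (m : ℕ) (e : Fin m → E), ∀ v ∈ V, ⟪T v, v⟫_ℝ = ∑ k, ⟪e k, v⟫_ℝ ^ 2 := by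
  set N : E →L[ℝ] E := V.starProjection ∘L T ∘L V.starProjection with hN
  set M : E →L[ℝ] E := (1 / 2 : ℝ) • (N + N.adjoint) with hM
  have hMN : ∀ v, ⟪M v, v⟫_ℝ = ⟪T (V.starProjection v), V.starProjection v⟫_ℝ := fun v => by
    have : ⟪M v, v⟫_ℝ = ⟪N v, v⟫_ℝ := by
      rw [hM, smul_apply, add_apply, real_inner_smul_left,
        inner_add_left, ContinuousLinearMap.adjoint_inner_left, real_inner_comm (N v)]
      ring
    rw [this, hN]
    exact V.inner_starProjection_left_eq_right _ _
  have hpos : M.IsPositive := by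
    refine (ContinuousLinearMap.isPositive_iff' M).2 ⟨?_, fun v => ?_⟩
    · rw [ContinuousLinearMap.isSelfAdjoint_iff', hM]
      simp [add_comm]
    · rw [hMN]
      exact hT _ (V.starProjection_apply_mem v)
  obtain ⟨m, e, he⟩ := ContinuousLinearMap.isPositive_iff_eq_sum_rankOne.1 hpos
  refine ⟨m, e, fun v hv => ?_⟩
  have hv' : V.starProjection v = v := V.starProjection_eq_self_iff.2 hv
  rw [← hv', ← hMN, hv', he]
  simp [sum_inner, real_inner_smul_left, sq]

lemma exists_sub_eq_sum_sq_add_inner [FiniteDimensional ℝ E] {T : E →L[ℝ] E} {b : E} {c : ℝ}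
    (hP : ∀ w ∈ S, P w = ⟪T w, w⟫_ℝ + ⟪b, w⟫_ℝ + c) (hconv : ConvexOn ℝ S P) {x : E}
    (hx : x ∈ S) :
    ∃ (m : ℕ) (e : Fin m → E) (g : E), ∀ w ∈ S,
      P w - P x = ∑ k, ⟪e k, w - x⟫_ℝ ^ 2 + ⟪g, w - x⟫_ℝ := by
  obtain ⟨m, e, he⟩ := exists_inner_map_self_eq_sum_sq fun v hv =>
    inner_map_self_nonneg_of_convexOn hP hconv ⟨x, hx⟩ hv
  refine ⟨m, e, T x + T.adjoint x + b, fun w hw => ?_⟩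
  rw [← he (w - x) (vsub_mem_vectorSpan ℝ hw hx), hP w hw, hP x hx]
  simp only [map_sub, inner_add_left, inner_sub_left, inner_sub_right,
    ContinuousLinearMap.adjoint_inner_left, real_inner_comm (T w) x,
    real_inner_comm (T x) x]
  ring

lemma inner_nonneg_of_forall_le [Fintype κ] (hS : Convex ℝ S) {e : κ → E} {g x : E} (hx : x ∈ S)
    (hmin : ∀ w ∈ S, P x ≤ P w)
    (hexp : ∀ w ∈ S, P w - P x = ∑ k, ⟪e k, w - x⟫_ℝ ^ 2 + ⟪g, w - x⟫_ℝ)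
    {w : E} (hw : w ∈ S) : 0 ≤ ⟪g, w - x⟫_ℝ := by
  have hsegment : ∀ t ∈ Set.Ioc (0 : ℝ) 1,
      0 ≤ t * ∑ k, ⟪e k, w - x⟫_ℝ ^ 2 + ⟪g, w - x⟫_ℝ := fun t ht => by
    have hmem := hS.add_smul_sub_mem hx hw ⟨ht.1.le, ht.2⟩
    have h := hexp _ hmem
    simp only [add_sub_cancel_left, inner_smul_right, mul_pow, ← Finset.mul_sum] at h
    refine le_of_mul_le_mul_left ?_ ht.1
    linarith [hmin _ hmem]
  have hlim : Filter.Tendsto (fun t : ℝ => t * ∑ k, ⟪e k, w - x⟫_ℝ ^ 2 + ⟪g, w - x⟫_ℝ)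
      (𝓝[>] 0) (𝓝 ⟪g, w - x⟫_ℝ) :=
    (Continuous.tendsto' (by fun_prop) 0 _ (by simp)).mono_left nhdsWithin_le_nhds
  exact ge_of_tendsto hlim (Filter.mem_of_superset (Ioc_mem_nhdsGT one_pos) hsegment)

lemma sq_add_sum_abs_le [Fintype κ] (y : κ → ℝ) {γ M : ℝ} (hγ : 0 ≤ γ) (hM : γ ≤ M) :
    (γ + ∑ k, |y k|) ^ 2 ≤ 2 * (M + Fintype.card κ) * (γ + ∑ k, y k ^ 2) := by
  have hcauchy : (∑ k, |y k|) ^ 2 ≤ Fintype.card κ * ∑ k, y k ^ 2 := by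
    simpa only [sq_abs, Finset.card_univ] using
      sq_sum_le_card_mul_sum_sq (s := Finset.univ) (f := fun k => |y k|)
  have hsum : 0 ≤ ∑ k, y k ^ 2 := Finset.sum_nonneg fun k _ => sq_nonneg _
  have hcard : (0 : ℝ) ≤ Fintype.card κ := Nat.cast_nonneg _
  calc (γ + ∑ k, |y k|) ^ 2 ≤ 2 * (γ ^ 2 + (∑ k, |y k|) ^ 2) := add_sq_le
    _ ≤ 2 * (M * γ + Fintype.card κ * ∑ k, y k ^ 2) := by rw [sq γ]; gcongr
    _ ≤ 2 * (M + Fintype.card κ) * (γ + ∑ k, y k ^ 2) := by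
      nlinarith [mul_nonneg (hγ.trans hM) hsum, mul_nonneg hcard hγ]

/-- The minimizers over the polyhedron form the polyhedron on which, additionally, all squares and
the linear term vanish; Hoffman's bound for it gives quadratic growth. -/
theorem exists_growth_of_sub_eq_sum_sq_add_inner [FiniteDimensional ℝ E] [Finite ι] [Fintype κ]
    {a : ι → E} {b : ι → ℝ} (hbdd : Bornology.IsBounded {w : E | ∀ i, ⟪a i, w⟫_ℝ ≤ b i})
    {e : κ → E} {g x : E} (hx : ∀ i, ⟪a i, x⟫_ℝ ≤ b i)
    (hmin : ∀ w, (∀ i, ⟪a i, w⟫_ℝ ≤ b i) → P x ≤ P w)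
    (hexp : ∀ w, (∀ i, ⟪a i, w⟫_ℝ ≤ b i) →
      P w - P x = ∑ k, ⟪e k, w - x⟫_ℝ ^ 2 + ⟪g, w - x⟫_ℝ) :
    ∃ α ≥ 0, ∀ w, (∀ i, ⟪a i, w⟫_ℝ ≤ b i) →
      ∃ p, (∀ i, ⟪a i, p⟫_ℝ ≤ b i) ∧ P p = P x ∧ ‖w - p‖ ^ 2 ≤ α * (P w - P x) := by
  cases nonempty_fintype ι
  obtain ⟨H, hH, hoffman⟩ := exists_hoffman_bound_of_eq a b (fun k : Option κ => k.elim g e)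
    (fun k => ⟪k.elim g e, x⟫_ℝ) ⟨x, hx, fun _ => rfl⟩
  obtain ⟨D, hD⟩ := hbdd.subset_closedBall x
  have hdist : ∀ w, (∀ i, ⟪a i, w⟫_ℝ ≤ b i) → ‖w - x‖ ≤ D := fun w hw =>
    mem_closedBall_iff_norm.1 (hD hw)
  have hD0 : 0 ≤ D := (norm_nonneg _).trans (hdist x hx)
  refine ⟨H ^ 2 * (2 * (‖g‖ * D + Fintype.card κ)), by positivity, fun w hw => ?_⟩
  obtain ⟨p, hp, hpx, hle⟩ := hoffman w
  have hval : P p = P x := by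
    have hg := hpx none
    have he := fun k => hpx (some k)
    simp only [Option.elim] at hg he
    exact sub_eq_zero.1 (by simp [hexp p hp, inner_sub_right, hg, he])
  refine ⟨p, hp, hval, ?_⟩
  have hfeasible : ∑ i, (⟪a i, w⟫_ℝ - b i)⁺ = 0 :=
    Finset.sum_eq_zero fun i _ => posPart_eq_zero.2 (sub_nonpos.2 (hw i))
  have hγ : 0 ≤ ⟪g, w - x⟫_ℝ :=
    inner_nonneg_of_forall_le (convex_setOf_forall_inner_le a b) hx hmin hexp hw
  simp only [hfeasible, zero_add, ← inner_sub_right, Fintype.sum_option, Option.elim,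
    abs_of_nonneg hγ] at hle
  calc ‖w - p‖ ^ 2 ≤ H ^ 2 * (⟪g, w - x⟫_ℝ + ∑ k, |⟪e k, w - x⟫_ℝ|) ^ 2 := by
        rw [← mul_pow]
        gcongr
    _ ≤ H ^ 2 * (2 * (‖g‖ * D + Fintype.card κ) *
          (⟪g, w - x⟫_ℝ + ∑ k, ⟪e k, w - x⟫_ℝ ^ 2)) := by
      gcongr
      exact sq_add_sum_abs_le _ hγ ((real_inner_le_norm _ _).trans (by gcongr; exact hdist w hw))
    _ = H ^ 2 * (2 * (‖g‖ * D + Fintype.card κ)) * (P w - P x) := by rw [hexp w hw]; ring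

end QuadraticGrowth

/-! ### The error bound condition for piecewise quadratic convex functions -/

section PiecewiseQuadratic

variable {d : ℕ} {K S : Set (Vec d)} {F H P : Vec d → ℝ}

lemma isPolyhedron_of_finite {ι : Type*} [Finite ι] (a : ι → Vec d) (b : ι → ℝ) :
    IsPolyhedron {w : Vec d | ∀ i, ⟪a i, w⟫_ℝ ≤ b i} := by
  cases nonempty_fintype ι
  let φ := Fintype.equivFin ι
  refine ⟨Fintype.card ι, a ∘ φ.symm, b ∘ φ.symm, ?_⟩
  ext w
  exact (φ.symm.forall_congr_right (q := fun i => ⟪a i, w⟫_ℝ ≤ b i)).symm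

lemma isPolyhedron_univ : IsPolyhedron (Set.univ : Set (Vec d)) :=
  ⟨0, Fin.elim0, Fin.elim0, by simp⟩

lemma IsPolyhedron.inter (hK : IsPolyhedron K) (hS : IsPolyhedron S) : IsPolyhedron (K ∩ S) := by
  obtain ⟨m, a, b, rfl⟩ := hK
  obtain ⟨n, a', b', rfl⟩ := hS
  convert isPolyhedron_of_finite (Sum.elim a a') (Sum.elim b b') using 1
  ext w
  simp

lemma IsPolyhedron.isClosed (hK : IsPolyhedron K) : IsClosed K := by
  obtain ⟨m, a, b, rfl⟩ := hK
  exact isClosed_setOf_forall_inner_le a b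

lemma IsPolyhedron.convex (hK : IsPolyhedron K) : Convex ℝ K := by
  obtain ⟨m, a, b, rfl⟩ := hK
  exact convex_setOf_forall_inner_le a b

lemma IsQuadraticOn.mono (hF : IsQuadraticOn K F) (hS : S ⊆ K) : IsQuadraticOn S F := by
  obtain ⟨A, b, c, h⟩ := hF
  exact ⟨A, b, c, fun w hw => h w (hS hw)⟩

lemma IsQuadraticOn.add (hF : IsQuadraticOn K F) (hH : IsQuadraticOn K H) :
    IsQuadraticOn K fun w => F w + H w := by
  obtain ⟨A, b, c, h⟩ := hF
  obtain ⟨A', b', c', h'⟩ := hH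
  refine ⟨A + A', b + b', c + c', fun w hw => ?_⟩
  simp only [h w hw, h' w hw, Matrix.add_mulVec, dotProduct_add]
  ring

lemma IsQuadraticOn.const_mul (r : ℝ) (hF : IsQuadraticOn K F) :
    IsQuadraticOn K fun w => r * F w := by
  obtain ⟨A, b, c, h⟩ := hF
  refine ⟨r • A, r • b, r * c, fun w hw => ?_⟩
  simp only [h w hw, Matrix.smul_mulVec, dotProduct_smul, smul_eq_mul]
  ring

lemma isQuadraticOn_of_forall_eq_inner_add (a : Vec d) (c : ℝ)
    (h : ∀ w ∈ K, F w = ⟪a, w⟫_ℝ + c) : IsQuadraticOn K F :=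
  ⟨0, a.ofLp, c, fun w hw => by
    simp [h w hw, EuclideanSpace.inner_eq_star_dotProduct]⟩

lemma IsQuadraticOn.exists_eq_inner (hF : IsQuadraticOn K F) :
    ∃ (T : Vec d →L[ℝ] Vec d) (b : Vec d) (c : ℝ),
      ∀ w ∈ K, F w = ⟪T w, w⟫_ℝ + ⟪b, w⟫_ℝ + c := by
  obtain ⟨A, b, c, h⟩ := hF
  refine ⟨(Matrix.toEuclideanLin A).toContinuousLinearMap, WithLp.toLp 2 b, c, fun w hw => ?_⟩
  simp [h w hw, EuclideanSpace.inner_eq_star_dotProduct, Matrix.ofLp_toLpLin]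

lemma IsQuadraticOn.continuousOn (hF : IsQuadraticOn K F) : ContinuousOn F K := by
  obtain ⟨T, b, c, h⟩ := hF.exists_eq_inner
  exact ContinuousOn.congr (by fun_prop) h

/-- The functions that are quadratic on each of finitely many polyhedra covering `K`; this common
generalization of quadratic and piecewise linear functions is stable under sums. -/
def IsPiecewiseQuadraticOn (K : Set (Vec d)) (F : Vec d → ℝ) : Prop :=
  ∃ (m : ℕ) (Q : Fin m → Set (Vec d)),
    (∀ i, IsPolyhedron (Q i)) ∧ K ⊆ ⋃ i, Q i ∧ ∀ i, IsQuadraticOn (K ∩ Q i) F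

lemma isPiecewiseQuadraticOn_of_finite {ι : Type*} [Finite ι] (Q : ι → Set (Vec d))
    (hQ : ∀ i, IsPolyhedron (Q i)) (hcover : K ⊆ ⋃ i, Q i)
    (hF : ∀ i, IsQuadraticOn (K ∩ Q i) F) : IsPiecewiseQuadraticOn K F := by
  cases nonempty_fintype ι
  let φ := Fintype.equivFin ι
  refine ⟨Fintype.card ι, Q ∘ φ.symm, fun i => hQ _, ?_, fun i => hF _⟩
  exact hcover.trans_eq (φ.symm.surjective.iUnion_comp Q).symm

lemma IsQuadraticOn.isPiecewiseQuadraticOn (hF : IsQuadraticOn K F) :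
    IsPiecewiseQuadraticOn K F :=
  isPiecewiseQuadraticOn_of_finite (fun _ : Unit => Set.univ) (fun _ => isPolyhedron_univ)
    (Set.subset_iUnion_of_subset () (Set.subset_univ K)) fun _ => hF.mono Set.inter_subset_left

lemma IsPiecewiseLinearOn.isPiecewiseQuadraticOn (hF : IsPiecewiseLinearOn K F) :
    IsPiecewiseQuadraticOn K F := by
  obtain ⟨m, Q, a, c, hQ, hcover, h⟩ := hF
  exact ⟨m, Q, hQ, hcover, fun i => isQuadraticOn_of_forall_eq_inner_add (a i) (c i) (h i)⟩

lemma IsPiecewiseQuadraticOn.add (hF : IsPiecewiseQuadraticOn K F)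
    (hH : IsPiecewiseQuadraticOn K H) : IsPiecewiseQuadraticOn K fun w => F w + H w := by
  obtain ⟨m, Q, hQ, hcover, h⟩ := hF
  obtain ⟨n, R, hR, hcover', h'⟩ := hH
  refine isPiecewiseQuadraticOn_of_finite (fun i : Fin m × Fin n => Q i.1 ∩ R i.2)
    (fun i => (hQ i.1).inter (hR i.2)) (fun w hw => ?_) fun i =>
    ((h i.1).mono fun w hw => ⟨hw.1, hw.2.1⟩).add ((h' i.2).mono fun w hw => ⟨hw.1, hw.2.2⟩)
  obtain ⟨i, hi⟩ := Set.mem_iUnion.1 (hcover hw)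
  obtain ⟨j, hj⟩ := Set.mem_iUnion.1 (hcover' hw)
  exact Set.mem_iUnion.2 ⟨(i, j), hi, hj⟩

lemma IsPiecewiseQuadraticOn.const_mul (r : ℝ) (hF : IsPiecewiseQuadraticOn K F) :
    IsPiecewiseQuadraticOn K fun w => r * F w := by
  obtain ⟨m, Q, hQ, hcover, h⟩ := hF
  exact ⟨m, Q, hQ, hcover, fun i => (h i).const_mul r⟩

lemma IsPiecewiseQuadraticOn.continuousOn (hF : IsPiecewiseQuadraticOn K F) (hK : IsClosed K) :
    ContinuousOn F K := by
  obtain ⟨m, Q, hQ, hcover, h⟩ := hF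
  have hunion : K = ⋃ i, K ∩ Q i := by rw [← Set.inter_iUnion, Set.inter_eq_left.2 hcover]
  rw [hunion]
  exact (locallyFinite_of_finite _).continuousOn_iUnion (fun i => hK.inter (hQ i).isClosed)
    fun i => (h i).continuousOn

lemma minimizers_nonempty (hK : IsCompact K) (hne : K.Nonempty) (hP : ContinuousOn P K) :
    (minimizers K P).Nonempty :=
  hK.exists_isMinOn hne hP

lemma isClosed_minimizers (hK : IsClosed K) (hP : ContinuousOn P K) :
    IsClosed (minimizers K P) := by
  rcases (minimizers K P).eq_empty_or_nonempty with h | ⟨v, hv⟩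
  · simp [h]
  · have : minimizers K P = K ∩ P ⁻¹' Set.Iic (P v) := by
      ext w
      exact ⟨fun hw => ⟨hw.1, hw.2 v hv.1⟩, fun hw => ⟨hw.1, fun u hu => hw.2.trans (hv.2 u hu)⟩⟩
    rw [this]
    exact hP.preimage_isClosed_of_isClosed hK isClosed_Iic

lemma eq_of_mem_minimizers {v u : Vec d} (hv : v ∈ minimizers K P) (hu : u ∈ minimizers K P) :
    P v = P u :=
  le_antisymm (hv.2 u hu.1) (hu.2 v hv.1)

lemma optimalValue_eq {v : Vec d} (hv : v ∈ minimizers K P) : optimalValue K P = P v :=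
  IsLeast.csInf_eq ⟨⟨v, hv.1, rfl⟩, by rintro _ ⟨u, hu, rfl⟩; exact hv.2 u hu⟩

lemma EBC_one_of_forall_exists (hclosed : IsClosed (minimizers K P)) {v : Vec d}
    (hv : v ∈ minimizers K P) {α : ℝ}
    (h : ∀ w ∈ K, ∃ p ∈ minimizers K P, ‖w - p‖ ^ 2 ≤ α * (P w - P v)) : EBC K P 1 α := by
  intro w hw
  obtain ⟨w', hw', hclose⟩ := exists_norm_sub_le_of_isClosed hclosed ⟨v, hv⟩ w
  obtain ⟨p, hp, hle⟩ := h w hw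
  refine ⟨w', hw', hclose, ?_⟩
  rw [Real.rpow_one, eq_of_mem_minimizers hw' hv, norm_sub_rev]
  refine (pow_le_pow_left₀ (norm_nonneg _) (hclose p hp) 2).trans ?_
  rwa [norm_sub_rev]

lemma IsQuadraticOn.exists_growth (hP : IsQuadraticOn S P) (hS : IsPolyhedron S)
    (hbdd : Bornology.IsBounded S) (hconv : ConvexOn ℝ S P) {x : Vec d}
    (hx : x ∈ minimizers S P) :
    ∃ α ≥ 0, ∀ w ∈ S, ∃ p ∈ minimizers S P, ‖w - p‖ ^ 2 ≤ α * (P w - P x) := by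
  obtain ⟨T, b, c, hquad⟩ := hP.exists_eq_inner
  obtain ⟨m, e, g, hexp⟩ := exists_sub_eq_sum_sq_add_inner hquad hconv hx.1
  obtain ⟨n, a, y, rfl⟩ := hS
  obtain ⟨α, hα, h⟩ := exists_growth_of_sub_eq_sum_sq_add_inner hbdd hx.1 hx.2 hexp
  refine ⟨α, hα, fun w hw => ?_⟩
  obtain ⟨p, hp, hpx, hle⟩ := h w hw
  exact ⟨p, ⟨hp, fun u hu => hpx.trans_le (hx.2 u hu)⟩, hle⟩

/-- If the minimum over `S` is not the minimum over `K`, the gap between the two and the diameter of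
`K` give the constant. -/
lemma IsQuadraticOn.exists_growth_of_subset (hP : IsQuadraticOn S P) (hS : IsPolyhedron S)
    (hSK : S ⊆ K) (hbdd : Bornology.IsBounded K) (hconv : ConvexOn ℝ S P) {v : Vec d}
    (hv : v ∈ minimizers K P) :
    ∃ α ≥ 0, ∀ w ∈ S, ∃ p ∈ minimizers K P, ‖w - p‖ ^ 2 ≤ α * (P w - P v) := by
  rcases S.eq_empty_or_nonempty with hempty | hne
  · exact ⟨0, le_rfl, by simp [hempty]⟩
  have hcompact : IsCompact S :=
    Metric.isCompact_of_isClosed_isBounded hS.isClosed (hbdd.subset hSK)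
  obtain ⟨x, hx⟩ := minimizers_nonempty hcompact hne hP.continuousOn
  rcases (hv.2 x (hSK hx.1)).eq_or_lt with heq | hlt
  · obtain ⟨α, hα, h⟩ := hP.exists_growth hS (hbdd.subset hSK) hconv hx
    refine ⟨α, hα, fun w hw => ?_⟩
    obtain ⟨p, hp, hle⟩ := h w hw
    refine ⟨p, ⟨hSK hp.1, fun u hu => ?_⟩, heq ▸ hle⟩
    rw [eq_of_mem_minimizers hp hx, ← heq]
    exact hv.2 u hu
  · have hgap : 0 < P x - P v := sub_pos.2 hlt
    obtain ⟨D, hD⟩ := hbdd.subset_closedBall v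
    refine ⟨D ^ 2 / (P x - P v), by positivity, fun w hw => ⟨v, hv, ?_⟩⟩
    calc ‖w - v‖ ^ 2 ≤ D ^ 2 := by gcongr; exact mem_closedBall_iff_norm.1 (hD (hSK hw))
      _ = D ^ 2 / (P x - P v) * (P x - P v) := (div_mul_cancel₀ _ hgap.ne').symm
      _ ≤ D ^ 2 / (P x - P v) * (P w - P v) := by gcongr; exact hx.2 w hw

theorem IsPiecewiseQuadraticOn.exists_EBC_one (hP : IsPiecewiseQuadraticOn K P)
    (hK : IsPolyhedron K) (hne : K.Nonempty) (hbdd : Bornology.IsBounded K)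
    (hconv : ConvexOn ℝ K P) : ∃ α > 0, EBC K P 1 α := by
  have hcont := hP.continuousOn hK.isClosed
  obtain ⟨v, hv⟩ := minimizers_nonempty
    (Metric.isCompact_of_isClosed_isBounded hK.isClosed hbdd) hne hcont
  obtain ⟨m, Q, hQ, hcover, hquad⟩ := hP
  choose α hα h using fun i => (hquad i).exists_growth_of_subset (hK.inter (hQ i))
    Set.inter_subset_left hbdd
    (hconv.subset Set.inter_subset_left (hK.convex.inter (hQ i).convex)) hv
  have hsum : 0 ≤ ∑ i, α i := Finset.sum_nonneg fun i _ => hα i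
  refine ⟨∑ i, α i + 1, by positivity,
    EBC_one_of_forall_exists (isClosed_minimizers hK.isClosed hcont) hv fun w hw => ?_⟩
  obtain ⟨i, hi⟩ := Set.mem_iUnion.1 (hcover hw)
  obtain ⟨p, hp, hle⟩ := h i w ⟨hw, hi⟩
  refine ⟨p, hp, hle.trans (mul_le_mul_of_nonneg_right ?_ (sub_nonneg.2 (hv.2 w hw)))⟩
  linarith [Finset.single_le_sum (f := α) (fun j _ => hα j) (Finset.mem_univ i)]

end PiecewiseQuadratic

section L1Norm

variable {d : ℕ}

lemma l1Norm_nonneg (w : Vec d) : 0 ≤ l1Norm w := Finset.sum_nonneg fun _ _ => abs_nonneg _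

lemma norm_le_l1Norm (w : Vec d) : ‖w‖ ≤ l1Norm w := by
  rw [EuclideanSpace.norm_eq]
  refine Real.sqrt_le_iff.2 ⟨l1Norm_nonneg w, ?_⟩
  simp only [Real.norm_eq_abs]
  exact Finset.sum_sq_le_sq_sum_of_nonneg fun _ _ => abs_nonneg _

lemma l1Ball_subset_closedBall (B : ℝ) : l1Ball d B ⊆ Metric.closedBall 0 B := fun w hw =>
  mem_closedBall_zero_iff.2 ((norm_le_l1Norm w).trans hw)

lemma zero_mem_l1Ball {B : ℝ} (hB : 0 ≤ B) : (0 : Vec d) ∈ l1Ball d B := by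
  simpa [l1Ball, l1Norm] using hB

/-- The vertices of the cube `[-1, 1]^d`; they are the gradients of the linear pieces of the `ℓ₁`
norm. -/
noncomputable def signVec (σ : Fin d → Bool) : Vec d :=
  WithLp.toLp 2 fun i => if σ i then 1 else -1

lemma inner_signVec (σ : Fin d → Bool) (w : Vec d) :
    ⟪signVec σ, w⟫_ℝ = ∑ i, signVec σ i * w i := by
  simp [PiLp.inner_apply, mul_comm]

lemma abs_signVec_apply (σ : Fin d → Bool) (i : Fin d) : |signVec σ i| = 1 := by
  cases h : σ i <;> simp [signVec, h]

lemma inner_signVec_le_l1Norm (σ : Fin d → Bool) (w : Vec d) :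
    ⟪signVec σ, w⟫_ℝ ≤ l1Norm w := by
  rw [inner_signVec]
  refine Finset.sum_le_sum fun i _ => (le_abs_self _).trans_eq ?_
  rw [abs_mul, abs_signVec_apply, one_mul]

lemma l1Norm_eq_inner_signVec {σ : Fin d → Bool} {w : Vec d} (h : ∀ i, 0 ≤ signVec σ i * w i) :
    l1Norm w = ⟪signVec σ, w⟫_ℝ := by
  rw [inner_signVec]
  refine Finset.sum_congr rfl fun i _ => ?_
  rw [← abs_of_nonneg (h i), abs_mul, abs_signVec_apply, one_mul]

lemma exists_forall_signVec_mul_nonneg (w : Vec d) : ∃ σ, ∀ i, 0 ≤ signVec σ i * w i := by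
  refine ⟨fun i => decide (0 ≤ w i), fun i => ?_⟩
  rcases le_or_gt 0 (w i) with h | h
  · simp [signVec, h]
  · simp [signVec, h.not_ge, h.le]

lemma isPolyhedron_setOf_signVec_mul_nonneg (σ : Fin d → Bool) :
    IsPolyhedron {w : Vec d | ∀ i, 0 ≤ signVec σ i * w i} := by
  convert isPolyhedron_of_finite (fun i => EuclideanSpace.single i (-signVec σ i)) fun _ => 0
    using 1
  ext w
  simp [EuclideanSpace.inner_single_left]

lemma isPolyhedron_l1Ball (B : ℝ) : IsPolyhedron (l1Ball d B) := by
  convert isPolyhedron_of_finite (signVec (d := d)) fun _ => B using 1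
  refine Set.Subset.antisymm (fun w hw σ => (inner_signVec_le_l1Norm σ w).trans hw) fun w hw => ?_
  obtain ⟨σ, hσ⟩ := exists_forall_signVec_mul_nonneg w
  exact (l1Norm_eq_inner_signVec hσ).trans_le (hw σ)

lemma isPiecewiseQuadraticOn_l1Norm (K : Set (Vec d)) : IsPiecewiseQuadraticOn K l1Norm :=
  isPiecewiseQuadraticOn_of_finite (fun σ => {w | ∀ i, 0 ≤ signVec σ i * w i})
    isPolyhedron_setOf_signVec_mul_nonneg
    (fun w _ => Set.mem_iUnion.2 (exists_forall_signVec_mul_nonneg w)) fun σ =>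
    isQuadraticOn_of_forall_eq_inner_add (signVec σ) 0 fun _ hw => by
      rw [l1Norm_eq_inner_signVec hw.2, add_zero]

end L1Norm

/-! ### Bernstein's inequality -/

section Bernstein

variable {Z : Type*} [MeasurableSpace Z] {Ω : Type*} [MeasurableSpace Ω]

lemma mgf_le_exp_of_integral_eq_zero {μ : Measure Z} [IsProbabilityMeasure μ] {Y : Z → ℝ}
    (hY : AEMeasurable Y μ) {b s : ℝ} (hb : ∀ᵐ z ∂μ, |Y z| ≤ b) (hmean : ∫ z, Y z ∂μ = 0)
    (hs : 0 ≤ s) (hbs : b * s ≤ 1) :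
    mgf Y μ s ≤ Real.exp (s ^ 2 * ∫ z, Y z ^ 2 ∂μ) := by
  have hYb : ∀ᵐ z ∂μ, Y z ∈ Set.Icc (-b) b := hb.mono fun z hz => abs_le.1 hz
  have hYi : Integrable Y μ := .of_mem_Icc (-b) b hY hYb
  have hY2 : Integrable (fun z => Y z ^ 2) μ := .of_bound (hY.pow_const 2).aestronglyMeasurable
    (b ^ 2) (hb.mono fun z hz => by rw [norm_pow]; exact pow_le_pow_left₀ (abs_nonneg _) hz 2)
  have hexp : ∀ᵐ z ∂μ, Real.exp (s * Y z) ≤ s ^ 2 * Y z ^ 2 + (s * Y z + 1) := by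
    filter_upwards [hb] with z hz
    have hsY : |s * Y z| ≤ 1 := by
      rw [abs_mul, abs_of_nonneg hs, mul_comm]
      exact (mul_le_mul_of_nonneg_right hz hs).trans hbs
    linarith [(abs_le.1 (Real.abs_exp_sub_one_sub_id_le hsY)).2, mul_pow s (Y z) 2]
  have hlin : Integrable (fun z => s * Y z + 1) μ := (hYi.const_mul s).add (integrable_const 1)
  calc mgf Y μ s
      ≤ ∫ z, (s ^ 2 * Y z ^ 2 + (s * Y z + 1)) ∂μ :=
        integral_mono_ae (integrable_exp_mul_of_mem_Icc hY hYb) ((hY2.const_mul _).add hlin) hexp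
    _ = s ^ 2 * ∫ z, Y z ^ 2 ∂μ + 1 := by
        rw [integral_add (hY2.const_mul _) hlin,
          integral_add (hYi.const_mul s) (integrable_const 1), integral_const_mul,
          integral_const_mul, hmean]
        simp
    _ ≤ Real.exp (s ^ 2 * ∫ z, Y z ^ 2 ∂μ) := Real.add_one_le_exp _

lemma abs_integral_le_of_ae_abs_le {μ : Measure Z} [IsProbabilityMeasure μ] {X : Z → ℝ} {b : ℝ}
    (hb : ∀ᵐ z ∂μ, |X z| ≤ b) : |∫ z, X z ∂μ| ≤ b := by
  simpa using norm_integral_le_of_norm_le_const (μ := μ) (f := X) hb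

lemma ae_abs_integral_sub_le {μ : Measure Z} [IsProbabilityMeasure μ] {X : Z → ℝ} {b : ℝ}
    (hb : ∀ᵐ z ∂μ, |X z| ≤ b) : ∀ᵐ z ∂μ, |∫ z, X z ∂μ - X z| ≤ 2 * b := by
  filter_upwards [hb] with z hz
  linarith [abs_sub (∫ z, X z ∂μ) (X z), abs_integral_le_of_ae_abs_le hb]

lemma mgf_integral_sub_le {μ : Measure Z} [IsProbabilityMeasure μ] {X : Z → ℝ}
    (hX : AEMeasurable X μ) {b s : ℝ} (hb : ∀ᵐ z ∂μ, |X z| ≤ b) (hs : 0 ≤ s)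
    (hbs : 2 * b * s ≤ 1) :
    mgf (fun z => ∫ z, X z ∂μ - X z) μ s ≤ Real.exp (s ^ 2 * ∫ z, X z ^ 2 ∂μ) := by
  have hXi : Integrable X μ := .of_bound hX.aestronglyMeasurable b hb
  have hvar : ∫ z, (∫ z, X z ∂μ - X z) ^ 2 ∂μ ≤ ∫ z, X z ^ 2 ∂μ := by
    simpa only [sub_sq_comm, variance_eq_integral hX, Pi.pow_apply] using
      variance_le_expectation_sq hX.aestronglyMeasurable
  refine (mgf_le_exp_of_integral_eq_zero (hX.const_sub _) (ae_abs_integral_sub_le hb) ?_ hs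
    hbs).trans (by gcongr)
  rw [integral_sub (integrable_const _) hXi]
  simp

lemma measureReal_sum_range_ge_le_exp {ν : Measure Ω} {Y : ℕ → Ω → ℝ} (hind : iIndepFun Y ν)
    (hY : ∀ i, AEMeasurable (Y i) ν) {b s κ : ℝ} (hb : ∀ i, ∀ᵐ ω ∂ν, Y i ω ≤ b) (hs : 0 ≤ s)
    (hmgf : ∀ i, mgf (Y i) ν s ≤ Real.exp κ) (n : ℕ) (t : ℝ) :
    ν.real {ω | n * t ≤ ∑ i ∈ Finset.range n, Y i ω} ≤ Real.exp (n * (κ - s * t)) := by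
  have := hind.isProbabilityMeasure
  have hsumb : ∀ᵐ ω ∂ν, (∑ i ∈ Finset.range n, Y i) ω ≤ n * b := by
    filter_upwards [ae_all_iff.2 hb] with ω hω
    simpa using Finset.sum_le_sum fun i (_ : i ∈ Finset.range n) => hω i
  have hsum : mgf (∑ i ∈ Finset.range n, Y i) ν s ≤ Real.exp (n * κ) := by
    rw [hind.mgf_sum₀ hY, Real.exp_nat_mul]
    simpa using Finset.prod_le_prod (fun i (_ : i ∈ Finset.range n) => mgf_nonneg)
      fun i _ => hmgf i
  have hchernoff := measure_ge_le_exp_mul_mgf (n * t) hs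
    (integrable_exp_mul_of_le s _ hs (Finset.aemeasurable_sum _ fun i _ => hY i) hsumb)
  simp only [Finset.sum_apply] at hchernoff
  calc _ ≤ Real.exp (-s * (n * t)) * Real.exp (n * κ) := hchernoff.trans (by gcongr)
    _ = Real.exp (n * (κ - s * t)) := by rw [← Real.exp_add]; ring_nf

/-- The mean of `X` over the first `n` points of the sample `z`. -/
noncomputable def sampleMean {α : Type*} (n : ℕ) (z : ℕ → α) (X : α → ℝ) : ℝ :=
  1 / (n : ℝ) * ∑ i ∈ Finset.range n, X (z i)

-- Optimizing the free parameter `s` gives the usual form of Bernstein's inequality.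
theorem IsIIDSample.measure_integral_sub_sampleMean_ge_le {ν : Measure Ω} {μ : Measure Z}
    [IsProbabilityMeasure μ] {ζ : ℕ → Ω → Z} (hζ : IsIIDSample ν μ ζ) {X : Z → ℝ}
    (hX : AEMeasurable X μ) {b V s : ℝ} (hb : ∀ᵐ z ∂μ, |X z| ≤ b) (hV : ∫ z, X z ^ 2 ∂μ ≤ V)
    (hs : 0 < s) (hbs : 2 * b * s ≤ 1) {n : ℕ} (hn : n ≠ 0) (q : ℝ) :
    ν {ω | s * V + q / s ≤ ∫ z, X z ∂μ - sampleMean n (fun i => ζ i ω) X}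
      ≤ ENNReal.ofReal (Real.exp (-(n * q))) := by
  have := hζ.indep.isProbabilityMeasure
  set m := ∫ z, X z ∂μ
  have hζm : ∀ i, AEMeasurable (ζ i) ν := fun i => (hζ.measurable i).aemeasurable
  have hXζ : ∀ i, AEMeasurable (fun z => m - X z) (ν.map (ζ i)) := fun i => by
    rw [hζ.law i]; exact hX.const_sub m
  have hmgf : ∀ i, mgf (fun ω => m - X (ζ i ω)) ν s ≤ Real.exp (s ^ 2 * V) := fun i => by
    change mgf ((fun z => m - X z) ∘ ζ i) ν s ≤ _
    rw [← mgf_map (hζm i) ((hXζ i).const_mul s).exp.aestronglyMeasurable, hζ.law i]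
    exact (mgf_integral_sub_le hX hb hs.le hbs).trans (by gcongr)
  have hbound : ∀ i, ∀ᵐ ω ∂ν, m - X (ζ i ω) ≤ 2 * b := fun i => by
    have h := ae_abs_integral_sub_le hb
    rw [← hζ.law i] at h
    filter_upwards [ae_of_ae_map (hζm i) h] with ω hω
    rw [hζ.law i] at hω
    exact (le_abs_self _).trans hω
  have htail := measureReal_sum_range_ge_le_exp
    (hζ.indep.comp₀ (fun _ z => m - X z) hζm hXζ) (fun i => (hXζ i).comp_aemeasurable (hζm i))
    hbound hs.le hmgf n (s * V + q / s)
  have hset : {ω | s * V + q / s ≤ m - sampleMean n (fun i => ζ i ω) X}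
      = {ω | n * (s * V + q / s) ≤ ∑ i ∈ Finset.range n, (m - X (ζ i ω))} := by
    ext ω
    have hn' : (0 : ℝ) < n := by positivity
    rw [Set.mem_ofPred_eq, Set.mem_ofPred_eq, ← mul_le_mul_iff_right₀ hn']
    simp only [sampleMean, Finset.sum_sub_distrib, Finset.sum_const, Finset.card_range,
      nsmul_eq_mul]
    field_simp
  rw [hset, ← ofReal_measureReal]
  refine ENNReal.ofReal_le_ofReal (htail.trans_eq ?_)
  congr 1
  field_simp
  ring

end Bernstein

/-! ### Nets and uniform deviations -/

section Nets

variable {E : Type*} [NormedAddCommGroup E] [NormedSpace ℝ E] [FiniteDimensional ℝ E]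

-- The balls of radius `ε / 2` about the points of `s` are disjoint and lie in the ball of
-- radius `R + ε / 2` about `0`; compare volumes.
lemma card_le_pow_finrank_of_separated {R ε : ℝ} (hR : 0 ≤ R) (hε : 0 < ε) (s : Finset E)
    (hs : ∀ c ∈ s, ‖c‖ ≤ R) (hsep : (s : Set E).Pairwise fun x y => ε ≤ dist x y) :
    (s.card : ℝ) ≤ (1 + 2 * R / ε) ^ Module.finrank ℝ E := by
  borelize E
  set r := ε / 2 with hr
  have hr0 : 0 < r := by positivity
  have hRr : 0 < R + r := by positivity
  let μ : Measure E := Measure.addHaar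
  have hdisj : (s : Set E).Pairwise (Function.onFun Disjoint fun c => Metric.ball c r) :=
    hsep.imp fun x y hxy => Metric.ball_disjoint_ball (by rwa [hr, add_halves])
  have hsub : (⋃ c ∈ s, Metric.ball c r) ⊆ Metric.ball 0 (R + r) :=
    Set.iUnion₂_subset fun x hx => Metric.ball_subset_ball' (by
      rw [dist_zero_right]; linarith [hs x hx])
  have hvol := measure_mono (μ := μ) hsub
  rw [measure_biUnion_finset hdisj fun c _ => measurableSet_ball] at hvol
  simp only [μ.addHaar_ball_of_pos _ hr0, μ.addHaar_ball_of_pos _ hRr, Finset.sum_const,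
    nsmul_eq_mul, ← mul_assoc] at hvol
  have hcard := (ENNReal.mul_le_mul_iff_left
    (Metric.measure_ball_pos _ _ zero_lt_one).ne' measure_ball_lt_top.ne).1 hvol
  have hcard' : s.card * r ^ Module.finrank ℝ E ≤ (R + r) ^ Module.finrank ℝ E := by
    simpa [hr0.le] using ENNReal.toReal_le_of_le_ofReal (by positivity) hcard
  calc (s.card : ℝ) ≤ (R + r) ^ Module.finrank ℝ E / r ^ Module.finrank ℝ E := by
        rwa [le_div_iff₀ (by positivity)]
    _ = (1 + 2 * R / ε) ^ Module.finrank ℝ E := by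
        rw [← div_pow, hr]; congr 1; field_simp; ring

lemma exists_finset_forall_norm_sub_le {K : Set E} {R ε : ℝ} (hR : 0 ≤ R) (hε : 0 < ε)
    (hK : K ⊆ Metric.closedBall 0 R) :
    ∃ N : Finset E, (N : Set E) ⊆ K ∧ (∀ w ∈ K, ∃ w' ∈ N, ‖w - w'‖ ≤ ε) ∧
      (N.card : ℝ) ≤ (1 + 2 * R / ε) ^ Module.finrank ℝ E := by
  lift ε to NNReal using hε.le
  have hε' : ε / 2 ≠ 0 := by simpa using (NNReal.coe_pos.1 hε).ne'
  obtain ⟨C, -, hCfin, hC⟩ := Metric.exists_finite_isCover_of_totallyBounded hε'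
    ((isCompact_closedBall (0 : E) R).totallyBounded.subset hK)
  have hpack : Metric.packingNumber ε K ≠ ⊤ := by
    refine ne_top_of_le_ne_top (Set.encard_ne_top_iff.2 hCfin) (le_trans ?_
      hC.externalCoveringNumber_le_encard)
    have := Metric.packingNumber_two_mul_le_externalCoveringNumber (ε / 2) K
    rwa [mul_div_cancel₀ _ two_ne_zero] at this
  have hfin : (Metric.maximalSeparatedSet ε K).Finite := by
    rwa [← Set.encard_ne_top_iff, Metric.encard_maximalSeparatedSet hpack]
  refine ⟨hfin.toFinset, by simpa using Metric.maximalSeparatedSet_subset, fun w hw => ?_,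
    card_le_pow_finrank_of_separated hR hε _ (fun c hc => ?_) fun x hx y hy hxy => ?_⟩
  · obtain ⟨w', hw', hdist⟩ := Metric.isCover_maximalSeparatedSet hpack hw
    refine ⟨w', hfin.mem_toFinset.2 hw', ?_⟩
    rwa [← dist_eq_norm, dist_nndist, NNReal.coe_le_coe, ← ENNReal.coe_le_coe, ← edist_nndist]
  · simpa using hK (Metric.maximalSeparatedSet_subset (hfin.mem_toFinset.1 hc))
  · have hdist := Metric.isSeparated_maximalSeparatedSet (hfin.mem_toFinset.1 hx)
      (hfin.mem_toFinset.1 hy) hxy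
    change (ε : ℝ) ≤ dist x y
    rw [dist_nndist, NNReal.coe_le_coe, ← ENNReal.coe_le_coe, ← edist_nndist]
    exact hdist.le

end Nets

section Deviation

variable {Z : Type*} [MeasurableSpace Z] {μ : Measure Z}

/-- The deviation of the sample mean of `X` below its expectation. -/
noncomputable def deviation (μ : Measure Z) (n : ℕ) (z : ℕ → Z) (X : Z → ℝ) : ℝ :=
  ∫ y, X y ∂μ - sampleMean n z X

lemma sampleMean_sub {α : Type*} (n : ℕ) (z : ℕ → α) (X Y : α → ℝ) :
    sampleMean n z (X - Y) = sampleMean n z X - sampleMean n z Y := by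
  simp only [sampleMean, Pi.sub_apply, Finset.sum_sub_distrib, mul_sub]

lemma abs_sampleMean_le {α : Type*} {X : α → ℝ} {b : ℝ} (hb : 0 ≤ b) (n : ℕ) (z : ℕ → α)
    (hX : ∀ y, |X y| ≤ b) : |sampleMean n z X| ≤ b := by
  rcases n.eq_zero_or_pos with rfl | hn
  · simpa [sampleMean] using hb
  have hn' : (0 : ℝ) < n := by exact_mod_cast hn
  rw [sampleMean, abs_mul, abs_of_pos (by positivity), one_div, inv_mul_le_iff₀ hn']
  calc |∑ i ∈ Finset.range n, X (z i)| ≤ ∑ i ∈ Finset.range n, |X (z i)| :=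
        Finset.abs_sum_le_sum_abs _ _
    _ ≤ n * b := by simpa using Finset.sum_le_sum fun i (_ : i ∈ Finset.range n) => hX (z i)

lemma deviation_sub {n : ℕ} {z : ℕ → Z} {X Y : Z → ℝ} (hX : Integrable X μ)
    (hY : Integrable Y μ) :
    deviation μ n z (X - Y) = deviation μ n z X - deviation μ n z Y := by
  simp only [deviation, sampleMean_sub, integral_sub' hX hY]
  ring

lemma abs_deviation_le [IsProbabilityMeasure μ] {X : Z → ℝ} {b : ℝ} (hb : 0 ≤ b) (n : ℕ)
    (z : ℕ → Z) (hX : ∀ y, |X y| ≤ b) : |deviation μ n z X| ≤ 2 * b := by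
  have hint := abs_integral_le_of_ae_abs_le (μ := μ) (.of_forall hX)
  rw [deviation]
  linarith [abs_sub (∫ y, X y ∂μ) (sampleMean n z X), abs_sampleMean_le hb n z hX]

lemma IsIIDSample.measure_exists_deviation_ge_le {Ω : Type*} [MeasurableSpace Ω] {ν : Measure Ω}
    [IsProbabilityMeasure μ] {ζ : ℕ → Ω → Z} (hζ : IsIIDSample ν μ ζ) {ι : Type*} (N : Finset ι)
    {X : ι → Z → ℝ} {b V s : ι → ℝ} (hX : ∀ i ∈ N, AEMeasurable (X i) μ)
    (hb : ∀ i ∈ N, ∀ᵐ z ∂μ, |X i z| ≤ b i) (hV : ∀ i ∈ N, ∫ z, X i z ^ 2 ∂μ ≤ V i)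
    (hs : ∀ i ∈ N, 0 < s i) (hbs : ∀ i ∈ N, 2 * b i * s i ≤ 1) {n : ℕ} (hn : n ≠ 0) (q : ℝ) :
    ν {ω | ∃ i ∈ N, s i * V i + q / s i ≤ deviation μ n (fun j => ζ j ω) (X i)}
      ≤ ENNReal.ofReal (N.card * Real.exp (-(n * q))) := by
  have hunion : {ω | ∃ i ∈ N, s i * V i + q / s i ≤ deviation μ n (fun j => ζ j ω) (X i)}
      = ⋃ i ∈ N, {ω | s i * V i + q / s i ≤ deviation μ n (fun j => ζ j ω) (X i)} := by
    ext; simp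
  rw [hunion]
  refine (measure_biUnion_finset_le N _).trans ((Finset.sum_le_sum fun i hi =>
    hζ.measure_integral_sub_sampleMean_ge_le (hX i hi) (hb i hi) (hV i hi) (hs i hi) (hbs i hi)
      hn q).trans_eq ?_)
  rw [Finset.sum_const, nsmul_eq_mul, ENNReal.ofReal_mul (by positivity), ENNReal.ofReal_natCast]

variable {d : ℕ} {f : Vec d → Z → ℝ} {K : Set (Vec d)} {G : ℝ}

lemma risk_sub_le_deviation {lam : ℝ} {n : ℕ} {z : ℕ → Z} {w v : Vec d}
    (hint : ∀ w ∈ K, Integrable (f w) μ) (hw : w ∈ minimizers K (empiricalRisk f lam n z))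
    (hv : v ∈ K) : risk μ f lam w - risk μ f lam v ≤ deviation μ n z (f w - f v) := by
  have h : sampleMean n z (f w) + lam * l1Norm w ≤ sampleMean n z (f v) + lam * l1Norm v :=
    hw.2 v hv
  rw [deviation_sub (hint w hw.1) (hint v hv)]
  simp only [risk, expectedLoss, deviation]
  linarith

variable [IsProbabilityMeasure μ]

lemma IsLipschitzLoss.deviation_sub_le (hG : 0 ≤ G) (hL : IsLipschitzLoss K f G) (n : ℕ)
    (z : ℕ → Z) {w v : Vec d} (hw : w ∈ K) (hv : v ∈ K) :
    deviation μ n z (f w - f v) ≤ 2 * G * ‖w - v‖ := by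
  have h := abs_deviation_le (μ := μ) (by positivity) n z fun y => hL y w hw v hv
  exact (le_abs_self _).trans (h.trans_eq (by ring))

lemma IsLipschitzLoss.deviation_sub_le_add (hG : 0 ≤ G) (hL : IsLipschitzLoss K f G)
    (hint : ∀ w ∈ K, Integrable (f w) μ) (n : ℕ) (z : ℕ → Z) {w v w' v' : Vec d} (hw : w ∈ K)
    (hv : v ∈ K) (hw' : w' ∈ K) (hv' : v' ∈ K) {ε : ℝ} (hww' : ‖w - w'‖ ≤ ε)
    (hvv' : ‖v - v'‖ ≤ ε) :
    deviation μ n z (f w - f v) ≤ deviation μ n z (f w' - f v') + 4 * G * ε := by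
  have h1 := hL.deviation_sub_le (μ := μ) hG n z hw hw'
  have h2 := hL.deviation_sub_le (μ := μ) hG n z hv' hv
  rw [norm_sub_rev] at h2
  rw [deviation_sub (hint _ ‹_›) (hint _ ‹_›)] at h1 h2 ⊢
  rw [deviation_sub (hint w' hw') (hint v' hv')]
  linarith [mul_le_mul_of_nonneg_left hww' hG, mul_le_mul_of_nonneg_left hvv' hG]

/-- The level `q` at which Bernstein's inequality survives a union bound over the pairs of points
of a `B / n²`-net of a subset of a ball of radius `B` in `ℝ^d`: such a net has at most
`exp (4 d log n)` points. -/
noncomputable def netLevel (d n : ℕ) (δ : ℝ) : ℝ := (8 * (d * Real.log n) + Real.log (1 / δ)) / n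

lemma one_add_two_mul_div_pow_le_exp {B : ℝ} (hB : 0 < B) (d : ℕ) {n : ℕ} (hn : 2 ≤ n) :
    (1 + 2 * B / (B / (n : ℝ) ^ 2)) ^ d ≤ Real.exp (4 * (d * Real.log n)) := by
  have hn2 : (2 : ℝ) ≤ n := by exact_mod_cast hn
  have hbase : 1 + 2 * B / (B / (n : ℝ) ^ 2) ≤ (n : ℝ) ^ 4 := by
    have : 2 * B / (B / (n : ℝ) ^ 2) = 2 * n ^ 2 := by field_simp
    rw [this]
    nlinarith [sq_nonneg ((n : ℝ) ^ 2 - 4), mul_self_nonneg ((n : ℝ) - 2)]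
  calc (1 + 2 * B / (B / (n : ℝ) ^ 2)) ^ d ≤ ((n : ℝ) ^ 4) ^ d := by gcongr
    _ = Real.exp (4 * (d * Real.log n)) := by
      rw [← pow_mul, ← Real.exp_log (by positivity : (0 : ℝ) < n ^ (4 * d)), Real.log_pow]
      push_cast
      ring_nf

lemma mul_self_mul_exp_neg_netLevel_le {c δ : ℝ} {d n : ℕ} (hn : n ≠ 0) (hδ : 0 < δ) (hc0 : 0 ≤ c)
    (hc : c ≤ Real.exp (4 * (d * Real.log n))) :
    c * c * Real.exp (-(n * netLevel d n δ)) ≤ δ := by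
  have hnq : n * netLevel d n δ
      = 4 * (d * Real.log n) + (4 * (d * Real.log n) + Real.log (1 / δ)) := by
    rw [netLevel]; field_simp; ring
  calc c * c * Real.exp (-(n * netLevel d n δ))
      ≤ Real.exp (4 * (d * Real.log n)) * Real.exp (4 * (d * Real.log n))
        * Real.exp (-(n * netLevel d n δ)) := by gcongr
    _ = δ := by
      rw [← Real.exp_add, ← Real.exp_add, hnq, one_div, Real.log_inv]
      ring_nf
      exact Real.exp_log hδ

theorem IsLipschitzLoss.exists_net_deviation_bound {B : ℝ} (hB : 0 < B)
    (hK : K ⊆ Metric.closedBall 0 B) (hL : IsLipschitzLoss K f G)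
    (hint : ∀ w ∈ K, Integrable (f w) μ) {Ω : Type*} [MeasurableSpace Ω] {ν : Measure Ω}
    {ζ : ℕ → Ω → Z} (hζ : IsIIDSample ν μ ζ) {n : ℕ} (hn : 2 ≤ n) {δ : ℝ} (hδ : 0 < δ)
    {s V : Vec d → Vec d → ℝ} (hs : ∀ w ∈ K, ∀ v ∈ K, 0 < s w v)
    (hsG : ∀ w ∈ K, ∀ v ∈ K, 2 * (G * ‖w - v‖) * s w v ≤ 1)
    (hV : ∀ w ∈ K, ∀ v ∈ K, ∫ z, (f w z - f v z) ^ 2 ∂μ ≤ V w v) :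
    ∃ N : Finset (Vec d), (N : Set (Vec d)) ⊆ K ∧ (∀ w ∈ K, ∃ w' ∈ N, ‖w - w'‖ ≤ B / n ^ 2) ∧
      ν {ω | ∃ w ∈ N, ∃ v ∈ N, s w v * V w v + netLevel d n δ / s w v
          ≤ deviation μ n (fun i => ζ i ω) (f w - f v)} ≤ ENNReal.ofReal δ := by
  have hn0 : n ≠ 0 := by lia
  obtain ⟨N, hNK, hN, hcard⟩ := exists_finset_forall_norm_sub_le hB.le
    (show 0 < B / (n : ℝ) ^ 2 by positivity) hK
  rw [finrank_euclideanSpace_fin] at hcard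
  refine ⟨N, hNK, hN, ?_⟩
  have hmem : ∀ p ∈ N ×ˢ N, p.1 ∈ K ∧ p.2 ∈ K := fun p hp =>
    ⟨hNK (Finset.mem_product.1 hp).1, hNK (Finset.mem_product.1 hp).2⟩
  have hunion := hζ.measure_exists_deviation_ge_le (N ×ˢ N) (X := fun p => f p.1 - f p.2)
    (b := fun p => G * ‖p.1 - p.2‖) (V := fun p => V p.1 p.2) (s := fun p => s p.1 p.2)
    (fun p hp =>
      ((hint _ (hmem p hp).1).sub (hint _ (hmem p hp).2)).aestronglyMeasurable.aemeasurable)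
    (fun p hp => .of_forall fun z => hL z _ (hmem p hp).1 _ (hmem p hp).2)
    (fun p hp => hV _ (hmem p hp).1 _ (hmem p hp).2)
    (fun p hp => hs _ (hmem p hp).1 _ (hmem p hp).2)
    (fun p hp => hsG _ (hmem p hp).1 _ (hmem p hp).2) hn0 (netLevel d n δ)
  refine (measure_mono ?_).trans (hunion.trans (ENNReal.ofReal_le_ofReal ?_))
  · rintro ω ⟨w, hw, v, hv, h⟩
    exact ⟨(w, v), Finset.mk_mem_product hw hv, h⟩
  · rw [Finset.card_product, Nat.cast_mul]
    exact mul_self_mul_exp_neg_netLevel_le hn0 hδ (Nat.cast_nonneg _)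
      (hcard.trans (one_add_two_mul_div_pow_le_exp hB d hn))

theorem IsLipschitzLoss.measure_exists_minimizer_le {B lam : ℝ} (hB : 0 < B)
    (hK : K ⊆ Metric.closedBall 0 B) (hG : 0 ≤ G) (hL : IsLipschitzLoss K f G)
    (hint : ∀ w ∈ K, Integrable (f w) μ) {Ω : Type*} [MeasurableSpace Ω] {ν : Measure Ω}
    {ζ : ℕ → Ω → Z} (hζ : IsIIDSample ν μ ζ) {n : ℕ} (hn : 2 ≤ n) {δ : ℝ} (hδ : 0 < δ)
    {s V : Vec d → Vec d → ℝ} (hs : ∀ w ∈ K, ∀ v ∈ K, 0 < s w v)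
    (hsG : ∀ w ∈ K, ∀ v ∈ K, 2 * (G * ‖w - v‖) * s w v ≤ 1)
    (hV : ∀ w ∈ K, ∀ v ∈ K, ∫ z, (f w z - f v z) ^ 2 ∂μ ≤ V w v) :
    ν {ω | ∃ w ∈ minimizers K (empiricalRisk f lam n (fun i => ζ i ω)), ∃ v ∈ K,
        ∀ w' ∈ K, ∀ v' ∈ K, ‖w - w'‖ ≤ B / n ^ 2 → ‖v - v'‖ ≤ B / n ^ 2 →
          s w' v' * V w' v' + netLevel d n δ / s w' v' + 4 * G * (B / n ^ 2)
            ≤ risk μ f lam w - risk μ f lam v} ≤ ENNReal.ofReal δ := by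
  obtain ⟨N, hNK, hN, hmeas⟩ := hL.exists_net_deviation_bound hB hK hint hζ hn hδ hs hsG hV
  refine (measure_mono ?_).trans hmeas
  rintro ω ⟨w, hw, v, hv, h⟩
  obtain ⟨w', hw', hww'⟩ := hN w hw.1
  obtain ⟨v', hv', hvv'⟩ := hN v hv
  refine ⟨w', hw', v', hv', ?_⟩
  have hrisk := h w' (hNK hw') v' (hNK hv') hww' hvv'
  have hdev := hL.deviation_sub_le_add hG hint n (fun i => ζ i ω) hw.1 hv (hNK hw') (hNK hv')
    hww' hvv'
  linarith [risk_sub_le_deviation hint hw hv]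

end Deviation

/-! ### Fast rates of empirical risk minimization -/

section ERM

lemma EBC.exists_minimizer {d : ℕ} {K : Set (Vec d)} {P : Vec d → ℝ} {α : ℝ} (h : EBC K P 1 α)
    {w : Vec d} (hw : w ∈ K) : ∃ v ∈ minimizers K P, ‖w - v‖ ^ 2 ≤ α * (P w - P v) := by
  obtain ⟨v, hv, -, hle⟩ := h w hw
  exact ⟨v, hv, by simpa using hle⟩

lemma sub_optimalValue_eq_zero {d : ℕ} [Subsingleton (Vec d)] {K : Set (Vec d)} {w : Vec d}
    (hw : w ∈ K) (P : Vec d → ℝ) : P w - optimalValue K P = 0 := by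
  rw [optimalValue_eq (v := w) ⟨hw, fun u _ => by rw [Subsingleton.elim w u]⟩, sub_self]

lemma norm_sub_sq_le_of_norm_sub_le {E : Type*} [SeminormedAddCommGroup E] {w v w' v' : E} {ε : ℝ}
    (hw : ‖w - w'‖ ≤ ε) (hv : ‖v - v'‖ ≤ ε) : ‖w' - v'‖ ^ 2 ≤ 2 * ‖w - v‖ ^ 2 + 8 * ε ^ 2 := by
  have htri : ‖w' - v'‖ ≤ ‖w - v‖ + 2 * ε := by
    have hdecomp : w' - v' = (w - v) + ((v - v') - (w - w')) := by abel
    rw [hdecomp]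
    linarith [norm_add_le (w - v) ((v - v') - (w - w')), norm_sub_le (v - v') (w - w')]
  calc ‖w' - v'‖ ^ 2 ≤ (‖w - v‖ + 2 * ε) ^ 2 := by gcongr
    _ ≤ 2 * ‖w - v‖ ^ 2 + 8 * ε ^ 2 := by linarith [sq_nonneg (‖w - v‖ - 2 * ε)]

lemma norm_sub_le_two_mul_of_mem_closedBall {E : Type*} [SeminormedAddCommGroup E] {w v : E}
    {B : ℝ} (hw : w ∈ Metric.closedBall 0 B) (hv : v ∈ Metric.closedBall 0 B) :
    ‖w - v‖ ≤ 2 * B := by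
  rw [mem_closedBall_zero_iff] at hw hv
  linarith [norm_sub_le w v]

/-- The complexity term `(d log n + log (1 / δ)) / n` of the fast rates. -/
noncomputable def complexity (d n : ℕ) (δ : ℝ) : ℝ := (d * Real.log n + Real.log (1 / δ)) / n

variable {d n : ℕ} {δ : ℝ}

lemma log_one_div_nonneg (hδ : 0 < δ) (hδ1 : δ ≤ 1) : 0 ≤ Real.log (1 / δ) :=
  Real.log_nonneg ((one_le_div hδ).2 hδ1)

lemma complexity_nonneg (d n : ℕ) (hδ : 0 < δ) (hδ1 : δ ≤ 1) : 0 ≤ complexity d n δ :=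
  div_nonneg (add_nonneg (by positivity) (log_one_div_nonneg hδ hδ1)) n.cast_nonneg

lemma half_le_complexity_mul (hd : d ≠ 0) (hn : 2 ≤ n) (hδ : 0 < δ) (hδ1 : δ ≤ 1) :
    1 / 2 ≤ complexity d n δ * n := by
  have hn0 : (n : ℝ) ≠ 0 := by positivity
  have hlog : Real.log 2 ≤ Real.log n := Real.log_le_log two_pos (by exact_mod_cast hn)
  have hd1 : (1 : ℝ) ≤ d := by exact_mod_cast Nat.one_le_iff_ne_zero.2 hd
  rw [complexity, div_mul_cancel₀ _ hn0]
  nlinarith [log_one_div_nonneg hδ hδ1, Real.log_two_gt_d9]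

lemma netLevel_le (d n : ℕ) (hδ : 0 < δ) (hδ1 : δ ≤ 1) :
    netLevel d n δ ≤ 8 * complexity d n δ := by
  rw [netLevel, complexity, ← mul_div_assoc]
  gcongr
  linarith [log_one_div_nonneg hδ hδ1]

lemma netLevel_pos (hd : d ≠ 0) (hn : 2 ≤ n) (hδ : 0 < δ) (hδ1 : δ ≤ 1) :
    0 < netLevel d n δ := by
  have hlog : 0 < Real.log n := Real.log_pos (by exact_mod_cast hn)
  have := log_one_div_nonneg hδ hδ1
  rw [netLevel]
  positivity

lemma div_sq_le_of_half_le_mul {B n x : ℝ} (hB : 0 ≤ B) (hn : 1 ≤ n) (hx : 1 / 2 ≤ x * n) :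
    B / n ^ 2 ≤ B ∧ B / n ^ 2 ≤ 2 * B * x ∧ B / n ^ 2 ≤ 4 * B * x ^ 2 := by
  have hn0 : 0 < n⁻¹ := inv_pos.2 (by linarith)
  have hn1 : n⁻¹ ≤ 1 := inv_le_one_of_one_le₀ hn
  have hnx : n⁻¹ ≤ 2 * x := by
    rw [inv_le_iff_one_le_mul₀ (by linarith)]; linarith
  have hsq : n⁻¹ ^ 2 ≤ n⁻¹ := pow_le_of_le_one hn0.le hn1 two_ne_zero
  have hsqx : n⁻¹ ^ 2 ≤ (2 * x) ^ 2 := by gcongr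
  rw [div_eq_mul_inv, ← inv_pow]
  exact ⟨by nlinarith, by nlinarith, by nlinarith⟩

variable {Z : Type*} [MeasurableSpace Z] {μ : Measure Z} {f : Vec d → Z → ℝ} {K : Set (Vec d)}
  {B G lam α : ℝ} {Ω : Type*} [MeasurableSpace Ω] {ν : Measure Ω} {ζ : ℕ → Ω → Z}

lemma measure_excess_gt_eq_zero [Subsingleton (Vec d)] {b : ℝ} (hb : 0 ≤ b) (n : ℕ) :
    ν {ω | ∃ w ∈ minimizers K (empiricalRisk f lam n (fun i => ζ i ω)),
      b < risk μ f lam w - optimalValue K (risk μ f lam)} = 0 := by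
  convert measure_empty (μ := ν)
  refine Set.eq_empty_of_forall_notMem ?_
  rintro ω ⟨w, hw, hlt⟩
  exact hb.not_gt (hlt.trans_eq (sub_optimalValue_eq_zero hw.1 _))

variable [IsProbabilityMeasure μ]

theorem IsLipschitzLoss.measure_excess_gt_le (hB : 0 < B)
    (hK : K ⊆ Metric.closedBall 0 B) (hG : 0 ≤ G) (hL : IsLipschitzLoss K f G)
    (hint : ∀ w ∈ K, Integrable (f w) μ) (hE : EBC K (risk μ f lam) 1 α)
    (hζ : IsIIDSample ν μ ζ) (hn : 2 ≤ n) (hδ : 0 < δ)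
    {s V : Vec d → Vec d → ℝ} (hs : ∀ w ∈ K, ∀ v ∈ K, 0 < s w v)
    (hsG : ∀ w ∈ K, ∀ v ∈ K, 2 * (G * ‖w - v‖) * s w v ≤ 1)
    (hV : ∀ w ∈ K, ∀ v ∈ K, ∫ z, (f w z - f v z) ^ 2 ∂μ ≤ V w v) {b : ℝ}
    (hb : ∀ w ∈ K, ∀ v ∈ minimizers K (risk μ f lam), ∀ w' ∈ K, ∀ v' ∈ K,
      ‖w - v‖ ^ 2 ≤ α * (risk μ f lam w - risk μ f lam v) →
      risk μ f lam w - risk μ f lam v ≤ 2 * G * ‖w - v‖ →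
      ‖w - w'‖ ≤ B / n ^ 2 → ‖v - v'‖ ≤ B / n ^ 2 →
      risk μ f lam w - risk μ f lam v
        ≤ s w' v' * V w' v' + netLevel d n δ / s w' v' + 4 * G * (B / n ^ 2) →
      risk μ f lam w - risk μ f lam v ≤ b) :
    ν {ω | ∃ w ∈ minimizers K (empiricalRisk f lam n (fun i => ζ i ω)),
      b < risk μ f lam w - optimalValue K (risk μ f lam)} ≤ ENNReal.ofReal δ := by
  refine (measure_mono ?_).trans
    (hL.measure_exists_minimizer_le (lam := lam) hB hK hG hint hζ hn hδ hs hsG hV)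
  rintro ω ⟨w, hw, hlt⟩
  obtain ⟨v, hv, hwv⟩ := hE.exists_minimizer hw.1
  rw [optimalValue_eq hv] at hlt
  refine ⟨w, hw, v, hv.1, fun w' hw' v' hv' hww' hvv' => ?_⟩
  by_contra! hle
  have hlip := (risk_sub_le_deviation hint hw hv.1).trans
    (hL.deviation_sub_le hG n (fun i => ζ i ω) hw.1 hv.1)
  exact hlt.not_ge (hb w hw.1 v hv w' hw' v' hv' hwv hlip hww' hvv' hle.le)

lemma IsLipschitzLoss.integral_sub_sq_le (hL : IsLipschitzLoss K f G) {w v : Vec d} (hw : w ∈ K)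
    (hv : v ∈ K) : ∫ z, (f w z - f v z) ^ 2 ∂μ ≤ G ^ 2 * ‖w - v‖ ^ 2 := by
  refine (le_abs_self _).trans (abs_integral_le_of_ae_abs_le (.of_forall fun z => ?_))
  rw [abs_pow, ← mul_pow]
  exact pow_le_pow_left₀ (abs_nonneg _) (hL z w hw v hv) 2

/-- `r` and `r'` are the distances of two points and of their net approximations, `ε` the radius of
the net, `Δ` the excess risk. The tilt `(4 (G B + α G²))⁻¹` makes the variance term at most
`Δ / 2`, up to the error from the net. -/
lemma excess_le_of_variance_le {α B G Δ r r' ε q x : ℝ} (hB : 0 < B) (hG : 0 < G) (hα : 0 ≤ α)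
    (hΔ : 0 ≤ Δ) (hr : r ^ 2 ≤ α * Δ) (hr' : r' ^ 2 ≤ 2 * r ^ 2 + 8 * ε ^ 2) (hε : 0 ≤ ε)
    (hεB : ε ≤ B) (hεx : ε ≤ 2 * B * x) (hq : q ≤ 8 * x)
    (h : Δ ≤ (4 * (G * B + α * G ^ 2))⁻¹ * (G ^ 2 * r' ^ 2) + q / (4 * (G * B + α * G ^ 2))⁻¹
      + 4 * G * ε) : Δ ≤ 88 * (G * B + α * G ^ 2) * x := by
  set M : ℝ := 4 * (G * B + α * G ^ 2) with hM
  have hM0 : 0 < M := by positivity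
  have hvar : M⁻¹ * (G ^ 2 * r' ^ 2) ≤ Δ / 2 + 2 * G * ε := by
    rw [inv_mul_le_iff₀ hM0, hM]
    have hr'' : G ^ 2 * r' ^ 2 ≤ G ^ 2 * (2 * (α * Δ) + 8 * ε ^ 2) := by gcongr; linarith
    have hεB' : G ^ 2 * ε ^ 2 ≤ G ^ 2 * (B * ε) := by gcongr; nlinarith
    have hBΔ : 0 ≤ G * B * Δ := by positivity
    have hαε : 0 ≤ α * G ^ 2 * (G * ε) := by positivity
    linarith
  have hlevel : q / M⁻¹ ≤ 8 * x * M := by rw [div_inv_eq_mul]; gcongr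
  have hnet : G * ε ≤ G * (2 * B * x) := by gcongr
  have hx : 0 ≤ x := by
    by_contra! hx
    linarith [mul_pos_of_neg_of_neg hx (neg_neg_of_pos hB)]
  have hαx : 0 ≤ α * G ^ 2 * x := by positivity
  rw [hM] at hlevel
  nlinarith

theorem IsLipschitzLoss.measure_erm_excess_gt_le (hB : 0 < B) (hK : K ⊆ Metric.closedBall 0 B)
    (hG : 0 < G) (hα : 0 ≤ α) (hL : IsLipschitzLoss K f G) (hint : ∀ w ∈ K, Integrable (f w) μ)
    (hE : EBC K (risk μ f lam) 1 α) (hζ : IsIIDSample ν μ ζ) (hn : 2 ≤ n) (hδ : 0 < δ)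
    (hδ1 : δ ≤ 1) :
    ν {ω | ∃ w ∈ minimizers K (empiricalRisk f lam n (fun i => ζ i ω)),
      88 * (G * B + α * G ^ 2) * complexity d n δ
        < risk μ f lam w - optimalValue K (risk μ f lam)} ≤ ENNReal.ofReal δ := by
  rcases eq_or_ne d 0 with rfl | hd
  · have := complexity_nonneg 0 n hδ hδ1
    rw [measure_excess_gt_eq_zero (by positivity)]
    exact zero_le
  have hM : 0 < 4 * (G * B + α * G ^ 2) := by positivity
  refine hL.measure_excess_gt_le hB hK hG.le hint hE hζ hn hδ
    (s := fun _ _ => (4 * (G * B + α * G ^ 2))⁻¹) (V := fun w v => G ^ 2 * ‖w - v‖ ^ 2)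
    (fun _ _ _ _ => inv_pos.2 hM) (fun w hw v hv => ?_)
    (fun w hw v hv => hL.integral_sub_sq_le hw hv) ?_
  · have hdist := norm_sub_le_two_mul_of_mem_closedBall (hK hw) (hK hv)
    rw [mul_inv_le_iff₀ hM]
    nlinarith [mul_nonneg hα (sq_nonneg G)]
  · intro w hw v hv w' _ v' _ hwv _ hww' hvv' hle
    obtain ⟨hεB, hεx, -⟩ := div_sq_le_of_half_le_mul (n := (n : ℝ)) hB.le
      (by exact_mod_cast (one_le_two.trans hn)) (half_le_complexity_mul hd hn hδ hδ1)
    exact excess_le_of_variance_le hB hG hα (sub_nonneg.2 (hv.2 w hw)) hwv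
      (norm_sub_sq_le_of_norm_sub_le hww' hvv') (by positivity) hεB hεx (netLevel_le d n hδ hδ1)
      hle

end ERM

/-! ### Optimistic rates for smooth losses -/

section SelfBounding

variable {E : Type*} [NormedAddCommGroup E] [InnerProductSpace ℝ E] {h : E → ℝ} {p v w : E}
  {A B G L ρ : ℝ}

lemma abs_inner_le_of_abs_sub_le (hL : 0 ≤ L) (hlip : |h w - h v| ≤ G * ‖w - v‖)
    (hsmooth : |h w - h v - ⟪p, w - v⟫_ℝ| ≤ L / 2 * ‖w - v‖ ^ 2) (hwv : ‖w - v‖ ≤ 2 * B) :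
    |⟪p, w - v⟫_ℝ| ≤ (G + L * B) * ‖w - v‖ := by
  have hquad : L / 2 * ‖w - v‖ ^ 2 ≤ L * B * ‖w - v‖ := by
    nlinarith [mul_le_mul_of_nonneg_left hwv (mul_nonneg hL (norm_nonneg (w - v)))]
  have htri := abs_sub (h w - h v) (h w - h v - ⟪p, w - v⟫_ℝ)
  rw [sub_sub_cancel] at htri
  linarith

/-- The value of `h` stays non-negative after a gradient step from `v` along `x`, taken short enough
to remain in the ball. -/
lemma inner_sq_le_of_nonneg_of_smooth (hL : 0 ≤ L) (hρ : 0 < ρ) (hA : 0 < A)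
    (hnonneg : ∀ u ∈ Metric.ball v ρ, 0 ≤ h u)
    (hsmooth : ∀ u ∈ Metric.ball v ρ, h u - h v - ⟪p, u - v⟫_ℝ ≤ L / 2 * ‖u - v‖ ^ 2) {x : E}
    (hx : |⟪p, x⟫_ℝ| ≤ A * ‖x‖) : ⟪p, x⟫_ℝ ^ 2 ≤ 2 * (L + 2 * A / ρ) * ‖x‖ ^ 2 * h v := by
  rcases eq_or_ne x 0 with rfl | hx0
  · simp
  set c : ℝ := L + 2 * A / ρ with hc
  have hc0 : 0 < c := by positivity
  have hLc : L ≤ c := le_add_of_nonneg_right (by positivity)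
  set a : ℝ := ⟪p, x⟫_ℝ
  set r : ℝ := ‖x‖
  have hr : 0 < r := norm_pos_iff.2 hx0
  set t : ℝ := a / (c * r ^ 2) with ht
  have hstep : v - t • x ∈ Metric.ball v ρ := by
    have hAc : A / c < ρ := by
      rw [div_lt_iff₀ hc0, hc, mul_add, mul_div_cancel₀ _ hρ.ne']
      nlinarith [mul_nonneg hρ.le hL]
    rw [Metric.mem_ball, dist_eq_norm, sub_sub_cancel_left, norm_neg, norm_smul, Real.norm_eq_abs]
    calc |t| * r = |a| / r / c := by
          rw [ht, abs_div, abs_of_pos (by positivity : 0 < c * r ^ 2)]; field_simp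
      _ ≤ A / c := by gcongr; rwa [div_le_iff₀ hr]
      _ < ρ := hAc
  have hdecrease := hsmooth _ hstep
  rw [sub_sub_cancel_left, inner_neg_right, inner_smul_right, norm_neg, norm_smul, mul_pow,
    Real.norm_eq_abs, sq_abs] at hdecrease
  have hquad : L / 2 * (t ^ 2 * r ^ 2) ≤ t * a / 2 := by
    calc L / 2 * (t ^ 2 * r ^ 2) ≤ c / 2 * (t ^ 2 * r ^ 2) := by gcongr
      _ = t * a / 2 := by rw [ht]; field_simp
  have hta : t * a ≤ 2 * h v := by linarith [hnonneg _ hstep]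
  calc a ^ 2 = t * a * (c * r ^ 2) := by rw [ht]; field_simp
    _ ≤ 2 * h v * (c * r ^ 2) := by gcongr
    _ = 2 * c * r ^ 2 * h v := by ring

/-- The constant `H` in the self-bounding property
`(h w - h v)² ≤ 2 ‖w - v‖² (H (h v) + (L ‖w - v‖ / 2)²)` of a `G`-Lipschitz function on a set of
diameter `2 B` that is non-negative and `L`-smooth on its `ρ`-neighbourhood. -/
noncomputable def selfBound (B G L ρ : ℝ) : ℝ := 2 * (L + 2 * (G + L * B) / ρ)

lemma selfBound_pos (hB : 0 ≤ B) (hG : 0 < G) (hL : 0 ≤ L) (hρ : 0 < ρ) :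
    0 < selfBound B G L ρ := by
  unfold selfBound
  positivity

lemma sub_sq_le_of_nonneg_of_smooth (hB : 0 ≤ B) (hG : 0 < G) (hL : 0 ≤ L) (hρ : 0 < ρ)
    (hnonneg : ∀ u ∈ Metric.ball v ρ, 0 ≤ h u)
    (hsmooth : ∀ u ∈ insert w (Metric.ball v ρ),
      |h u - h v - ⟪p, u - v⟫_ℝ| ≤ L / 2 * ‖u - v‖ ^ 2)
    (hlip : |h w - h v| ≤ G * ‖w - v‖) (hwv : ‖w - v‖ ≤ 2 * B) :
    (h w - h v) ^ 2
      ≤ ‖w - v‖ ^ 2 * (2 * selfBound B G L ρ * h v + L ^ 2 / 2 * ‖w - v‖ ^ 2) := by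
  have hw := hsmooth w (Set.mem_insert _ _)
  have hinner := inner_sq_le_of_nonneg_of_smooth hL hρ (by positivity) hnonneg
    (fun u hu => (le_abs_self _).trans (hsmooth u (Set.mem_insert_of_mem _ hu)))
    (abs_inner_le_of_abs_sub_le hL hlip hw hwv)
  have hrem : (h w - h v - ⟪p, w - v⟫_ℝ) ^ 2 ≤ (L / 2 * ‖w - v‖ ^ 2) ^ 2 :=
    sq_le_sq' (abs_le.1 hw).1 (abs_le.1 hw).2
  rw [selfBound]
  linarith [sq_nonneg (⟪p, w - v⟫_ℝ - (h w - h v - ⟪p, w - v⟫_ℝ))]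

end SelfBounding

section SmoothERM

lemma IsNonnegSmoothConvexLoss.sub_sq_le {d : ℕ} {Z : Type*} {f : Vec d → Z → ℝ} {K : Set (Vec d)}
    {B G L ρ : ℝ} (hB : 0 ≤ B) (hG : 0 < G) (hL : 0 ≤ L) (hρ : 0 < ρ)
    (hK : K ⊆ Metric.closedBall 0 B) (hlip : IsLipschitzLoss K f G)
    (hf : IsNonnegSmoothConvexLoss (Metric.thickening ρ K) f L) {w v : Vec d} (hw : w ∈ K)
    (hv : v ∈ K) (z : Z) :
    (f w z - f v z) ^ 2
      ≤ ‖w - v‖ ^ 2 * (2 * selfBound B G L ρ * f v z + L ^ 2 / 2 * ‖w - v‖ ^ 2) := by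
  have hsub := Metric.self_subset_thickening hρ K
  have hball := Metric.ball_subset_thickening hv ρ
  obtain ⟨hnonneg, -, hsmooth⟩ := hf z
  refine sub_sq_le_of_nonneg_of_smooth (h := fun u => f u z)
    (p := gradient (fun u => f u z) v) hB hG hL hρ
    (fun u hu => hnonneg u (hball hu)) (fun u hu => ?_) (hlip z w hw v hv)
    (norm_sub_le_two_mul_of_mem_closedBall (hK hw) (hK hv))
  obtain ⟨hlow, hup⟩ := hsmooth u (Set.insert_subset (hsub hw) hball hu) v (hsub hv)
  rwa [abs_of_nonneg hlow]

section Arithmetic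

variable {α B G L H η q x P Δ ε r F : ℝ}

lemma div_mul_mul_le {U W : ℝ} (hη : 0 ≤ η) (hW : 0 < W) (hUW : U ≤ W) :
    η / W * (r ^ 2 * U) ≤ η * r ^ 2 := by
  rw [div_mul_eq_mul_div, div_le_iff₀ hW]
  calc η * (r ^ 2 * U) ≤ η * (r ^ 2 * W) := by gcongr
    _ = η * r ^ 2 * W := by ring

/-- The denominator `W` of the tilt `η / W` in Bernstein's inequality for a pair of points at
distance `r`, the second of which has expected loss `F`. Its first two terms dominate the variance
divided by `r²`, and the third one the range of the increments. -/
noncomputable def smoothWeight (G L H η q F r : ℝ) : ℝ :=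
  2 * H * F + L ^ 2 / 2 * r ^ 2 + 2 * G * η * r + q

lemma smoothWeight_pos (hG : 0 ≤ G) (hH : 0 ≤ H) (hη : 0 ≤ η) (hq : 0 < q) (hF : 0 ≤ F)
    (hr : 0 ≤ r) : 0 < smoothWeight G L H η q F r := by
  unfold smoothWeight
  positivity

lemma mul_div_smoothWeight_le_one (hG : 0 ≤ G) (hH : 0 ≤ H) (hη : 0 ≤ η) (hq : 0 < q) (hF : 0 ≤ F)
    (hr : 0 ≤ r) : 2 * (G * r) * (η / smoothWeight G L H η q F r) ≤ 1 := by
  rw [← mul_div_assoc, div_le_one (smoothWeight_pos hG hH hη hq hF hr), smoothWeight]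
  have hrest : 0 ≤ 2 * H * F + L ^ 2 / 2 * r ^ 2 + q := by positivity
  linarith

lemma div_div_smoothWeight_le (hη : 0 < η) (hH : 0 ≤ H) (hq : 0 ≤ q)
    (hsmall : q * (L ^ 2 + 1) ≤ 2 * η ^ 2) (hF : F ≤ P + G * ε) :
    q / (η / smoothWeight G L H η q F r)
      ≤ 2 * η * r ^ 2 + 2 * H / η * (q * P) + 2 * H * G / η * (q * ε)
        + (G ^ 2 + 1) / η * q ^ 2 := by
  rw [div_div_eq_mul_div, div_le_iff₀ hη, smoothWeight]
  have hFq : 2 * H * q * F ≤ 2 * H * q * (P + G * ε) := by gcongr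
  have hLq : q * (L ^ 2 / 2) * r ^ 2 ≤ η ^ 2 * r ^ 2 := by gcongr; linarith
  have hexpand : (2 * η * r ^ 2 + 2 * H / η * (q * P) + 2 * H * G / η * (q * ε)
      + (G ^ 2 + 1) / η * q ^ 2) * η
      = 2 * η ^ 2 * r ^ 2 + 2 * H * q * (P + G * ε) + (G ^ 2 + 1) * q ^ 2 := by
    field_simp
    ring
  rw [hexpand]
  linarith [sq_nonneg (η * r - G * q)]

/-- The constant of the optimistic rate, for the self-bounding constant `H` and the fraction `η` of
the squared distance that the variance is allowed to cost. The last summand covers the small sample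
sizes, for which the excess risk is bounded by the oscillation `4 G B` of the risk. -/
noncomputable def smoothConst (B G L H η : ℝ) : ℝ :=
  192 * η * B ^ 2 + 32 * H * G * B * η + 128 * (G ^ 2 + 1) / η + 32 * G * B + 32 * H / η
    + 4 * G * B * (4 * (L ^ 2 + 1) / η ^ 2) ^ 2

lemma smoothConst_nonneg (hB : 0 ≤ B) (hG : 0 ≤ G) (hH : 0 ≤ H) (hη : 0 ≤ η) :
    0 ≤ smoothConst B G L H η := by
  unfold smoothConst
  positivity

lemma netError_le_smoothConst_mul (hB : 0 ≤ B) (hG : 0 ≤ G) (hH : 0 ≤ H) (hη : 0 < η) (hP : 0 ≤ P)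
    (hx : 0 ≤ x) (hq : 0 ≤ q) (hqx : q ≤ 8 * x) (hqη : q ≤ 2 * η ^ 2) (hε : 0 ≤ ε) (hεB : ε ≤ B)
    (hεx : ε ≤ 4 * B * x ^ 2) :
    48 * η * ε ^ 2 + 4 * H / η * (q * P) + 4 * H * G / η * (q * ε)
        + 2 * (G ^ 2 + 1) / η * q ^ 2 + 8 * G * ε
      ≤ smoothConst B G L H η * (x ^ 2 + x * P) := by
  have hε2 : 48 * η * ε ^ 2 ≤ 192 * η * B ^ 2 * x ^ 2 := by
    calc 48 * η * ε ^ 2 ≤ 48 * η * (B * (4 * B * x ^ 2)) := by rw [sq]; gcongr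
      _ = 192 * η * B ^ 2 * x ^ 2 := by ring
  have hqP : 4 * H / η * (q * P) ≤ 32 * H / η * (x * P) := by
    calc 4 * H / η * (q * P) ≤ 4 * H / η * (8 * x * P) := by gcongr
      _ = 32 * H / η * (x * P) := by ring
  have hqε : 4 * H * G / η * (q * ε) ≤ 32 * H * G * B * η * x ^ 2 := by
    calc 4 * H * G / η * (q * ε) ≤ 4 * H * G / η * (2 * η ^ 2 * (4 * B * x ^ 2)) := by gcongr
      _ = 32 * H * G * B * η * x ^ 2 := by field_simp; ring
  have hq2 : 2 * (G ^ 2 + 1) / η * q ^ 2 ≤ 128 * (G ^ 2 + 1) / η * x ^ 2 := by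
    calc 2 * (G ^ 2 + 1) / η * q ^ 2 ≤ 2 * (G ^ 2 + 1) / η * (8 * x) ^ 2 := by gcongr
      _ = 128 * (G ^ 2 + 1) / η * x ^ 2 := by ring
  have hGε : 8 * G * ε ≤ 32 * G * B * x ^ 2 := by
    calc 8 * G * ε ≤ 8 * G * (4 * B * x ^ 2) := by gcongr
      _ = 32 * G * B * x ^ 2 := by ring
  have hcoeffP : 32 * H / η ≤ smoothConst B G L H η := by
    rw [smoothConst, ← sub_nonneg]
    ring_nf
    positivity
  have hcoeff : 192 * η * B ^ 2 + 32 * H * G * B * η + 128 * (G ^ 2 + 1) / η + 32 * G * B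
      ≤ smoothConst B G L H η := by
    rw [smoothConst, ← sub_nonneg]
    ring_nf
    positivity
  calc _ ≤ (192 * η * B ^ 2 + 32 * H * G * B * η + 128 * (G ^ 2 + 1) / η + 32 * G * B) * x ^ 2
        + 32 * H / η * (x * P) := by linarith
    _ ≤ smoothConst B G L H η * x ^ 2 + smoothConst B G L H η * (x * P) := by gcongr
    _ = smoothConst B G L H η * (x ^ 2 + x * P) := (mul_add _ _ _).symm

/-- The radius `r` of a pair of net points is controlled by the excess risk `Δ`, so that the terms
`3 η r²` of the deviation bound are absorbed into the left-hand side when `12 η α = 1`. -/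
lemma excess_le_of_selfBounding_of_small (hB : 0 ≤ B) (hG : 0 ≤ G) (hH : 0 ≤ H) (hη : 0 < η)
    (hηα : η * α = 1 / 12) (hP : 0 ≤ P) (hx : 0 ≤ x) (hq : 0 < q) (hqx : q ≤ 8 * x)
    (hsmall : q * (L ^ 2 + 1) ≤ 2 * η ^ 2) (hε : 0 ≤ ε) (hεB : ε ≤ B) (hεx : ε ≤ 4 * B * x ^ 2)
    (hr : 0 ≤ r) (hrΔ : r ^ 2 ≤ 2 * (α * Δ) + 8 * ε ^ 2) (hF0 : 0 ≤ F) (hF : F ≤ P + G * ε)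
    (h : Δ ≤ η / smoothWeight G L H η q F r * (r ^ 2 * (2 * H * F + L ^ 2 / 2 * r ^ 2))
      + q / (η / smoothWeight G L H η q F r) + 4 * G * ε) :
    Δ ≤ smoothConst B G L H η * (x ^ 2 + x * P) := by
  have hvar := div_mul_mul_le (r := r) (U := 2 * H * F + L ^ 2 / 2 * r ^ 2)
    (W := smoothWeight G L H η q F r) hη.le (smoothWeight_pos hG hH hη.le hq hF0 hr)
    (by rw [smoothWeight, add_assoc _ _ q]; exact le_add_of_nonneg_right (by positivity))
  have hlevel := div_div_smoothWeight_le (r := r) hη hH hq.le hsmall hF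
  have habsorb : 3 * η * r ^ 2 ≤ Δ / 2 + 24 * η * ε ^ 2 := by
    calc 3 * η * r ^ 2 ≤ 3 * η * (2 * (α * Δ) + 8 * ε ^ 2) := by gcongr
      _ = 6 * (η * α) * Δ + 24 * η * ε ^ 2 := by ring
      _ = Δ / 2 + 24 * η * ε ^ 2 := by rw [hηα]; ring
  have hqη : q ≤ 2 * η ^ 2 :=
    (le_mul_of_one_le_right hq.le (by nlinarith [sq_nonneg L])).trans hsmall
  have hnet := netError_le_smoothConst_mul (L := L) hB hG hH hη hP hx hq.le hqx hqη hε hεB hεx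
  have hdouble : 48 * η * ε ^ 2 + 4 * H / η * (q * P) + 4 * H * G / η * (q * ε)
      + 2 * (G ^ 2 + 1) / η * q ^ 2 + 8 * G * ε
      = 2 * (24 * η * ε ^ 2 + 2 * H / η * (q * P) + 2 * H * G / η * (q * ε)
        + (G ^ 2 + 1) / η * q ^ 2 + 4 * G * ε) := by ring
  linarith

lemma four_mul_le_smoothConst_mul (hB : 0 ≤ B) (hG : 0 ≤ G) (hH : 0 ≤ H) (hη : 0 < η) (hP : 0 ≤ P)
    (hx : 0 ≤ x) (hqx : q ≤ 8 * x) (hlarge : 2 * η ^ 2 < q * (L ^ 2 + 1)) :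
    4 * G * B ≤ smoothConst B G L H η * (x ^ 2 + x * P) := by
  have hone : 1 ≤ 4 * (L ^ 2 + 1) / η ^ 2 * x := by
    rw [div_mul_eq_mul_div, le_div_iff₀ (by positivity)]
    nlinarith [mul_le_mul_of_nonneg_right hqx (by positivity : 0 ≤ L ^ 2 + 1)]
  have hconst : 4 * G * B * (4 * (L ^ 2 + 1) / η ^ 2) ^ 2 ≤ smoothConst B G L H η := by
    rw [smoothConst]
    exact le_add_of_nonneg_left (by positivity)
  have hC := smoothConst_nonneg (L := L) hB hG hH hη.le
  calc 4 * G * B ≤ 4 * G * B * (4 * (L ^ 2 + 1) / η ^ 2 * x) ^ 2 :=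
        le_mul_of_one_le_right (by positivity) (one_le_pow₀ hone)
    _ = 4 * G * B * (4 * (L ^ 2 + 1) / η ^ 2) ^ 2 * x ^ 2 := by ring
    _ ≤ smoothConst B G L H η * (x ^ 2 + x * P) := by
      gcongr
      exact le_add_of_nonneg_right (by positivity)

lemma excess_le_of_selfBounding (hB : 0 ≤ B) (hG : 0 ≤ G) (hH : 0 ≤ H) (hη : 0 < η)
    (hηα : η * α = 1 / 12) (hP : 0 ≤ P) (hx : 0 ≤ x) (hq : 0 < q) (hqx : q ≤ 8 * x)
    (hε : 0 ≤ ε) (hεB : ε ≤ B) (hεx : ε ≤ 4 * B * x ^ 2) (hr : 0 ≤ r)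
    (hrΔ : r ^ 2 ≤ 2 * (α * Δ) + 8 * ε ^ 2) (hF0 : 0 ≤ F) (hF : F ≤ P + G * ε)
    (hosc : Δ ≤ 4 * G * B)
    (h : Δ ≤ η / smoothWeight G L H η q F r * (r ^ 2 * (2 * H * F + L ^ 2 / 2 * r ^ 2))
      + q / (η / smoothWeight G L H η q F r) + 4 * G * ε) :
    Δ ≤ smoothConst B G L H η * (x ^ 2 + x * P) := by
  rcases le_or_gt (q * (L ^ 2 + 1)) (2 * η ^ 2) with hsmall | hlarge
  · exact excess_le_of_selfBounding_of_small hB hG hH hη hηα hP hx hq hqx hsmall hε hεB hεx hr hrΔ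
      hF0 hF h
  · exact hosc.trans (four_mul_le_smoothConst_mul hB hG hH hη hP hx hqx hlarge)

end Arithmetic

variable {d : ℕ} {Z : Type*} [MeasurableSpace Z] {μ : Measure Z} {f : Vec d → Z → ℝ}
  {K : Set (Vec d)} {B G lam α L ρ : ℝ}

lemma expectedLoss_le_risk (hlam : 0 ≤ lam) (w : Vec d) :
    expectedLoss μ f w ≤ risk μ f lam w :=
  le_add_of_nonneg_right (mul_nonneg hlam (l1Norm_nonneg w))

lemma IsNonnegSmoothConvexLoss.expectedLoss_nonneg {U : Set (Vec d)}
    (hf : IsNonnegSmoothConvexLoss U f L) {w : Vec d} (hw : w ∈ U) : 0 ≤ expectedLoss μ f w :=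
  integral_nonneg fun z => (hf z).1 w hw

variable [IsProbabilityMeasure μ]

lemma IsNonnegSmoothConvexLoss.integral_sub_sq_le (hB : 0 ≤ B) (hG : 0 < G) (hL : 0 ≤ L)
    (hρ : 0 < ρ) (hK : K ⊆ Metric.closedBall 0 B) (hlip : IsLipschitzLoss K f G)
    (hf : IsNonnegSmoothConvexLoss (Metric.thickening ρ K) f L) {w v : Vec d} (hw : w ∈ K)
    (hv : v ∈ K) (hint : Integrable (f v) μ) :
    ∫ z, (f w z - f v z) ^ 2 ∂μ ≤ ‖w - v‖ ^ 2
      * (2 * selfBound B G L ρ * expectedLoss μ f v + L ^ 2 / 2 * ‖w - v‖ ^ 2) := by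
  have hloss : Integrable (fun z => 2 * selfBound B G L ρ * f v z) μ := hint.const_mul _
  refine (integral_mono_of_nonneg (.of_forall fun z => sq_nonneg _)
    ((hloss.add (integrable_const (L ^ 2 / 2 * ‖w - v‖ ^ 2))).const_mul _)
    (.of_forall (hf.sub_sq_le hB hG hL hρ hK hlip hw hv))).trans_eq ?_
  simp only [Pi.add_apply]
  rw [integral_const_mul, integral_add hloss (integrable_const _), integral_const_mul]
  simp [expectedLoss]

lemma IsLipschitzLoss.abs_expectedLoss_sub_le (hL : IsLipschitzLoss K f G)
    (hint : ∀ w ∈ K, Integrable (f w) μ) {w v : Vec d} (hw : w ∈ K) (hv : v ∈ K) :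
    |expectedLoss μ f w - expectedLoss μ f v| ≤ G * ‖w - v‖ := by
  rw [expectedLoss, expectedLoss, ← integral_sub (hint w hw) (hint v hv)]
  exact abs_integral_le_of_ae_abs_le (.of_forall fun z => hL z w hw v hv)

theorem IsNonnegSmoothConvexLoss.measure_erm_excess_gt_le (hB : 0 < B)
    (hK : K ⊆ Metric.closedBall 0 B) (hG : 0 < G) (hα : 0 < α) (hlam : 0 ≤ lam) (hL : 0 ≤ L)
    (hρ : 0 < ρ) (hlip : IsLipschitzLoss K f G)
    (hf : IsNonnegSmoothConvexLoss (Metric.thickening ρ K) f L)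
    (hint : ∀ w ∈ K, Integrable (f w) μ) (hE : EBC K (risk μ f lam) 1 α)
    {Ω : Type*} [MeasurableSpace Ω] {ν : Measure Ω} {ζ : ℕ → Ω → Z} (hζ : IsIIDSample ν μ ζ)
    {n : ℕ} (hn : 2 ≤ n) {δ : ℝ} (hδ : 0 < δ) (hδ1 : δ ≤ 1) :
    ν {ω | ∃ w ∈ minimizers K (empiricalRisk f lam n (fun i => ζ i ω)),
      smoothConst B G L (selfBound B G L ρ) (1 / (12 * α))
          * (complexity d n δ ^ 2 + complexity d n δ * optimalValue K (risk μ f lam))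
        < risk μ f lam w - optimalValue K (risk μ f lam)} ≤ ENNReal.ofReal δ := by
  have hF : ∀ u ∈ K, 0 ≤ expectedLoss μ f u := fun u hu =>
    hf.expectedLoss_nonneg (Metric.self_subset_thickening hρ K hu)
  have hP : 0 ≤ optimalValue K (risk μ f lam) := Real.sInf_nonneg <| by
    rintro _ ⟨u, hu, rfl⟩
    exact (hF u hu).trans (expectedLoss_le_risk hlam u)
  have hH := selfBound_pos hB.le hG hL hρ
  have hx := complexity_nonneg d n hδ hδ1
  rcases eq_or_ne d 0 with rfl | hd
  · have := smoothConst_nonneg (L := L) (η := 1 / (12 * α)) hB.le hG.le hH.le (by positivity)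
    rw [measure_excess_gt_eq_zero (by positivity)]
    exact zero_le
  set H := selfBound B G L ρ
  obtain ⟨η, hη⟩ : ∃ η, η = 1 / (12 * α) := ⟨_, rfl⟩
  have hη0 : 0 < η := by rw [hη]; positivity
  have hηα : η * α = 1 / 12 := by rw [hη]; field_simp
  have hq := netLevel_pos hd hn hδ hδ1
  rw [← hη]
  refine hlip.measure_excess_gt_le hB hK hG.le hint hE hζ hn hδ
    (s := fun w v => η / smoothWeight G L H η (netLevel d n δ) (expectedLoss μ f v) ‖w - v‖)
    (fun w _ v hv => div_pos hη0 (smoothWeight_pos hG.le hH.le hη0.le hq (hF v hv) (norm_nonneg _)))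
    (fun w _ v hv =>
      mul_div_smoothWeight_le_one hG.le hH.le hη0.le hq (hF v hv) (norm_nonneg _))
    (fun w hw v hv => hf.integral_sub_sq_le hB.le hG hL hρ hK hlip hw hv (hint v hv)) ?_
  intro w hw v hv w' _ v' hv' hwv hosc hww' hvv' hle
  rw [optimalValue_eq hv] at hP ⊢
  obtain ⟨hεB, -, hεx⟩ := div_sq_le_of_half_le_mul (n := (n : ℝ)) hB.le
    (by exact_mod_cast (one_le_two.trans hn)) (half_le_complexity_mul hd hn hδ hδ1)
  have hr := norm_sub_sq_le_of_norm_sub_le hww' hvv'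
  have hFv' : expectedLoss μ f v' ≤ risk μ f lam v + G * (B / n ^ 2) := by
    have hdiff := (abs_le.1 (hlip.abs_expectedLoss_sub_le hint hv.1 hv')).1
    linarith [expectedLoss_le_risk (μ := μ) (f := f) hlam v, mul_le_mul_of_nonneg_left hvv' hG.le]
  have hdist := norm_sub_le_two_mul_of_mem_closedBall (hK hw) (hK hv.1)
  exact excess_le_of_selfBounding hB.le hG.le hH.le hη0 hηα hP hx hq (netLevel_le d n hδ hδ1)
    (by positivity) hεB hεx (norm_nonneg _) (hr.trans (by linarith)) (hF v' hv') hFv'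
    (hosc.trans (by nlinarith)) hle

end SmoothERM

/-! ### Euclidean projections -/

section Projection

variable {d : ℕ} {K : Set (Vec d)}

lemma proj_mem_and_forall_norm_sub_le (hcl : IsClosed K) (hne : K.Nonempty) (x : Vec d) :
    proj K x ∈ K ∧ ∀ u ∈ K, ‖proj K x - x‖ ≤ ‖u - x‖ := by
  have h := exists_norm_sub_le_of_isClosed hcl hne x
  rw [proj, dif_pos h]
  exact h.choose_spec

lemma proj_mem (hcl : IsClosed K) (hne : K.Nonempty) (x : Vec d) : proj K x ∈ K :=
  (proj_mem_and_forall_norm_sub_le hcl hne x).1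

lemma norm_proj_sub_self_le (hcl : IsClosed K) {u : Vec d} (hu : u ∈ K) (x : Vec d) :
    ‖proj K x - x‖ ≤ ‖u - x‖ :=
  (proj_mem_and_forall_norm_sub_le hcl ⟨u, hu⟩ x).2 u hu

lemma proj_eq_self (hcl : IsClosed K) {x : Vec d} (hx : x ∈ K) : proj K x = x := by
  simpa [sub_eq_zero] using norm_proj_sub_self_le hcl hx x

lemma inner_sub_proj_nonpos (hK : Convex ℝ K) (hcl : IsClosed K) {u : Vec d} (hu : u ∈ K)
    (x : Vec d) : ⟪x - proj K x, u - proj K x⟫_ℝ ≤ 0 :=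
  have h := proj_mem_and_forall_norm_sub_le hcl ⟨u, hu⟩ x
  inner_sub_sub_nonpos_of_forall_norm_sub_le hK h.1 h.2 hu

lemma lipschitzWith_proj (hK : Convex ℝ K) (hcl : IsClosed K) (hne : K.Nonempty) :
    LipschitzWith 1 (proj K) := by
  refine LipschitzWith.of_dist_le_mul fun x y => ?_
  rw [NNReal.coe_one, one_mul, dist_eq_norm, dist_eq_norm]
  have hx := inner_sub_proj_nonpos hK hcl (proj_mem hcl hne y) x
  have hy := inner_sub_proj_nonpos hK hcl (proj_mem hcl hne x) y
  set p := proj K x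
  set q := proj K y
  have hsq : ‖p - q‖ ^ 2 = ⟪x - p, q - p⟫_ℝ + ⟪y - q, p - q⟫_ℝ + ⟪x - y, p - q⟫_ℝ := by
    rw [← real_inner_self_eq_norm_sq]
    simp only [inner_sub_left, inner_sub_right]
    ring
  have hcs := real_inner_le_norm (x - y) (p - q)
  by_contra! h
  nlinarith [norm_nonneg (x - y)]

lemma norm_proj_sub_le (hK : Convex ℝ K) (hcl : IsClosed K) {u : Vec d} (hu : u ∈ K) (x : Vec d) :
    ‖proj K x - u‖ ≤ ‖x - u‖ := by
  have h := (lipschitzWith_proj hK hcl ⟨u, hu⟩).dist_le_mul x u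
  rwa [NNReal.coe_one, one_mul, dist_eq_norm, dist_eq_norm, proj_eq_self hcl hu] at h

lemma add_smul_sub_mem_inter_closedBall {E : Type*} [NormedAddCommGroup E] [NormedSpace ℝ E]
    {K : Set E} (hK : Convex ℝ K) {c p : E} (hc : c ∈ K) (hp : p ∈ K) {R δ : ℝ} (hR : 0 ≤ R)
    (hδ : 0 < δ) (h : ‖p - c‖ ≤ R + δ) :
    p + (δ / (R + δ)) • (c - p) ∈ K ∩ Metric.closedBall c R := by
  have hRδ : 0 < R + δ := by positivity
  refine ⟨hK.add_smul_sub_mem hp hc ⟨by positivity, ?_⟩, ?_⟩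
  · rw [div_le_one hRδ]
    exact le_add_of_nonneg_left hR
  have hdiff : p + (δ / (R + δ)) • (c - p) - c = (R / (R + δ)) • (p - c) := by
    have hδR : δ / (R + δ) = 1 - R / (R + δ) := by
      field_simp
      ring
    rw [hδR]
    module
  rw [mem_closedBall_iff_norm, hdiff, norm_smul, Real.norm_of_nonneg (by positivity),
    div_mul_eq_mul_div, div_le_iff₀ hRδ]
  gcongr

-- `p` is moved towards `c'`, by at most a fraction `‖c - c'‖ / (R + ‖c - c'‖)`, to reach the set
-- onto which `x` is projected.
lemma inner_sub_proj_inter_closedBall_le (hK : Convex ℝ K) (hcl : IsClosed K) {R : ℝ}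
    (hR : 0 ≤ R) {c c' p : Vec d} (hc' : c' ∈ K) (hp : p ∈ K ∩ Metric.closedBall c R)
    (x : Vec d) :
    ⟪x - proj (K ∩ Metric.closedBall c' R) x, p - proj (K ∩ Metric.closedBall c' R) x⟫_ℝ
      ≤ ‖c - c'‖ * ‖x - c'‖ := by
  have hK' := hK.inter (convex_closedBall c' R)
  have hcl' := hcl.inter (Metric.isClosed_closedBall (x := c') (ε := R))
  rcases eq_or_ne c c' with rfl | hne
  · simpa using inner_sub_proj_nonpos hK' hcl' hp x
  set p' := proj (K ∩ Metric.closedBall c' R) x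
  set δ := ‖c - c'‖
  have hδ : 0 < δ := norm_pos_iff.2 (sub_ne_zero.2 hne)
  have hpc' : ‖p - c'‖ ≤ R + δ :=
    (norm_sub_le_norm_sub_add_norm_sub p c c').trans
      (add_le_add_left (mem_closedBall_iff_norm.1 hp.2) δ)
  have hxp' : ‖x - p'‖ ≤ ‖x - c'‖ := by
    rw [norm_sub_rev, norm_sub_rev x]
    exact norm_proj_sub_self_le hcl' ⟨hc', Metric.mem_closedBall_self hR⟩ x
  have hvar := inner_sub_proj_nonpos hK' hcl'
    (add_smul_sub_mem_inter_closedBall hK hc' hp.1 hR hδ hpc') x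
  rw [add_sub_right_comm, inner_add_right, inner_smul_right, ← neg_sub p c', inner_neg_right]
    at hvar
  calc ⟪x - p', p - p'⟫_ℝ ≤ δ / (R + δ) * ⟪x - p', p - c'⟫_ℝ := by linarith
    _ ≤ δ / (R + δ) * (‖x - p'‖ * ‖p - c'‖) := by gcongr; exact real_inner_le_norm _ _
    _ ≤ δ / (R + δ) * (‖x - c'‖ * (R + δ)) := by gcongr
    _ = δ * ‖x - c'‖ := by field_simp

lemma norm_proj_inter_closedBall_sub_sq_le (hK : Convex ℝ K) (hcl : IsClosed K) {R : ℝ}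
    (hR : 0 ≤ R) {c c' : Vec d} (hc : c ∈ K) (hc' : c' ∈ K) (x : Vec d) :
    ‖proj (K ∩ Metric.closedBall c R) x - proj (K ∩ Metric.closedBall c' R) x‖ ^ 2
      ≤ ‖c - c'‖ * (‖x - c‖ + ‖x - c'‖) := by
  have hmem : ∀ c ∈ K, proj (K ∩ Metric.closedBall c R) x ∈ K ∩ Metric.closedBall c R :=
    fun c hc => proj_mem (hcl.inter Metric.isClosed_closedBall)
      ⟨c, hc, Metric.mem_closedBall_self hR⟩ x
  have h := inner_sub_proj_inter_closedBall_le hK hcl hR hc' (hmem c hc) x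
  have h' := inner_sub_proj_inter_closedBall_le hK hcl hR hc (hmem c' hc') x
  rw [norm_sub_rev c' c] at h'
  set p := proj (K ∩ Metric.closedBall c R) x
  set p' := proj (K ∩ Metric.closedBall c' R) x
  have hsq : ‖p - p'‖ ^ 2 = ⟪x - p', p - p'⟫_ℝ + ⟪x - p, p' - p⟫_ℝ := by
    rw [← real_inner_self_eq_norm_sq]
    simp only [inner_sub_left, inner_sub_right]
    ring
  linarith

lemma continuous_proj_inter_closedBall (hK : Convex ℝ K) (hcl : IsClosed K) (hne : K.Nonempty)
    {R : ℝ} (hR : 0 ≤ R) :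
    Continuous fun p : Vec d × Vec d => proj (K ∩ Metric.closedBall (proj K p.1) R) p.2 := by
  have hcont : Continuous (proj K) := (lipschitzWith_proj hK hcl hne).continuous
  have hmem : ∀ c, proj K c ∈ K := proj_mem hcl hne
  refine continuous_iff_continuousAt.2 fun ⟨c₀, x₀⟩ => tendsto_iff_dist_tendsto_zero.2 ?_
  have hbound : Continuous fun p : Vec d × Vec d => ‖p.2 - x₀‖
      + √(‖proj K p.1 - proj K c₀‖ * (‖x₀ - proj K p.1‖ + ‖x₀ - proj K c₀‖)) := by
    fun_prop
  have hlim := hbound.tendsto (c₀, x₀)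
  simp only [sub_self, norm_zero, zero_mul, Real.sqrt_zero, add_zero] at hlim
  refine squeeze_zero (fun _ => dist_nonneg) (fun p => ?_) hlim
  refine (dist_triangle _ (proj (K ∩ Metric.closedBall (proj K p.1) R) x₀) _).trans
    (add_le_add ?_ ?_)
  · have h := (lipschitzWith_proj (hK.inter (convex_closedBall (proj K p.1) R))
      (hcl.inter Metric.isClosed_closedBall)
      ⟨_, hmem p.1, Metric.mem_closedBall_self hR⟩).dist_le_mul p.2 x₀
    rwa [NNReal.coe_one, one_mul, dist_eq_norm p.2] at h
  · rw [dist_eq_norm]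
    exact Real.le_sqrt_of_sq_le
      (norm_proj_inter_closedBall_sub_sq_le hK hcl hR (hmem p.1) (hmem c₀) x₀)

lemma norm_proj_sub_smul_sub_sq_le (hK : Convex ℝ K) (hcl : IsClosed K) {u : Vec d} (hu : u ∈ K)
    (γ : ℝ) (y h : Vec d) :
    ‖proj K (y - γ • h) - u‖ ^ 2 ≤ ‖y - u‖ ^ 2 - 2 * γ * ⟪h, y - u⟫_ℝ + γ ^ 2 * ‖h‖ ^ 2 := by
  calc ‖proj K (y - γ • h) - u‖ ^ 2 ≤ ‖y - γ • h - u‖ ^ 2 := by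
        gcongr
        exact norm_proj_sub_le hK hcl hu _
    _ = ‖y - u‖ ^ 2 - 2 * γ * ⟪h, y - u⟫_ℝ + γ ^ 2 * ‖h‖ ^ 2 := by
        rw [sub_right_comm, norm_sub_sq_real, inner_smul_right, norm_smul, mul_pow,
          Real.norm_eq_abs, sq_abs, real_inner_comm]
        ring

lemma sum_inner_le_of_proj_steps (hK : Convex ℝ K) (hcl : IsClosed K) {γ H : ℝ} {y h : ℕ → Vec d}
    (hy : ∀ t, y (t + 1) = proj K (y t - γ • h t)) {u : Vec d} (hu : u ∈ K)
    (hh : ∀ t, ‖h t‖ ≤ H) (T : ℕ) :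
    2 * γ * ∑ t ∈ Finset.range T, ⟪h t, y t - u⟫_ℝ ≤ ‖y 0 - u‖ ^ 2 + T * (γ ^ 2 * H ^ 2) := by
  suffices htel : ‖y T - u‖ ^ 2 + 2 * γ * ∑ t ∈ Finset.range T, ⟪h t, y t - u⟫_ℝ
      ≤ ‖y 0 - u‖ ^ 2 + T * (γ ^ 2 * H ^ 2) by linarith [sq_nonneg ‖y T - u‖]
  induction T with
  | zero => simp
  | succ T ih =>
    have hstep := norm_proj_sub_smul_sub_sq_le hK hcl hu γ (y T) (h T)
    have hnorm : γ ^ 2 * ‖h T‖ ^ 2 ≤ γ ^ 2 * H ^ 2 := by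
      gcongr
      exact hh T
    rw [← hy] at hstep
    rw [Finset.sum_range_succ]
    push_cast
    linarith

lemma sum_inner_le_mul_sqrt_of_proj_steps (hK : Convex ℝ K) (hcl : IsClosed K) {γ Γ R a : ℝ}
    (hγ : 0 < γ) {T : ℕ} (hγR : γ * (Γ * √((T : ℝ) + 1)) = R) {y h : ℕ → Vec d}
    (hy : ∀ t, y (t + 1) = proj K (y t - γ • h t)) {u : Vec d} (hu : u ∈ K)
    (hu0 : ‖y 0 - u‖ ≤ R) (hh : ∀ t, ‖h t‖ ≤ a * Γ) :
    ∑ t ∈ Finset.range T, ⟪h t, y t - u⟫_ℝ ≤ (1 + a ^ 2) / 2 * (Γ * R * √((T : ℝ) + 1)) := by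
  have hsteps : T * (γ ^ 2 * (a * Γ) ^ 2) ≤ a ^ 2 * R ^ 2 := by
    calc T * (γ ^ 2 * (a * Γ) ^ 2) ≤ ((T : ℝ) + 1) * (γ ^ 2 * (a * Γ) ^ 2) := by
          gcongr
          exact le_add_of_nonneg_right zero_le_one
      _ = a ^ 2 * (γ ^ 2 * (Γ ^ 2 * √((T : ℝ) + 1) ^ 2)) := by
          rw [Real.sq_sqrt (by positivity)]
          ring
      _ = a ^ 2 * R ^ 2 := by rw [← hγR]; ring
  have hstart : ‖y 0 - u‖ ^ 2 ≤ R ^ 2 := by gcongr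
  refine le_of_mul_le_mul_left (?_ : 2 * γ * _ ≤ 2 * γ * _) (by positivity)
  calc _ ≤ ‖y 0 - u‖ ^ 2 + T * (γ ^ 2 * (a * Γ) ^ 2) := sum_inner_le_of_proj_steps hK hcl hy hu hh T
    _ ≤ (1 + a ^ 2) * R * R := by linarith
    _ = (1 + a ^ 2) * (γ * (Γ * √((T : ℝ) + 1))) * R := by rw [hγR]
    _ = _ := by ring

end Projection

/-! ### Stochastic subgradient iterates -/

section Iterates

variable {d : ℕ} {Z : Type*} {K : Set (Vec d)} {g : Vec d → Z → Vec d} {γ Γ R₀ : ℝ} {w₁ : Vec d}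

lemma ssgIter_mem (hcl : IsClosed K) (hw₁ : w₁ ∈ K) (z : ℕ → Z) (t : ℕ) :
    ssgIter g K γ w₁ z t ∈ K := by
  cases t with
  | zero => exact hw₁
  | succ t => exact proj_mem hcl ⟨w₁, hw₁⟩ _

lemma sum_range_one_div_eq_one (T : ℕ) :
    ∑ _t ∈ Finset.range (T + 1), 1 / ((T : ℝ) + 1) = 1 := by
  rw [Finset.sum_const, Finset.card_range, nsmul_eq_mul]
  push_cast
  exact mul_one_div_cancel (by positivity)

lemma ssg_mem (hK : Convex ℝ K) (hcl : IsClosed K) (hw₁ : w₁ ∈ K) (z : ℕ → Z) (T : ℕ) :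
    ssg g K γ w₁ z T ∈ K := by
  rw [ssg, Finset.smul_sum]
  exact hK.sum_mem (fun _ _ => by positivity) (sum_range_one_div_eq_one T)
    fun t _ => ssgIter_mem hcl hw₁ z t

lemma ssg_sub_le_sum_div {P : Vec d → ℝ} (hP : ConvexOn ℝ K P) (hcl : IsClosed K) (hw₁ : w₁ ∈ K)
    (z : ℕ → Z) (T : ℕ) (u : Vec d) :
    P (ssg g K γ w₁ z T) - P u
      ≤ (∑ t ∈ Finset.range (T + 1), (P (ssgIter g K γ w₁ z t) - P u)) / ((T : ℝ) + 1) := by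
  have hJensen := hP.map_sum_le (t := Finset.range (T + 1)) (w := fun _ => 1 / ((T : ℝ) + 1))
    (p := ssgIter g K γ w₁ z) (fun _ _ => by positivity) (sum_range_one_div_eq_one T)
    fun t _ => ssgIter_mem hcl hw₁ z t
  rw [← Finset.smul_sum, ← Finset.smul_sum, ← ssg, smul_eq_mul, one_div_mul_eq_div] at hJensen
  rw [Finset.sum_sub_distrib, sub_div, Finset.sum_const, Finset.card_range, nsmul_eq_mul]
  push_cast
  rw [mul_div_cancel_left₀ _ (by positivity)]
  exact sub_le_sub_right hJensen _

lemma asaIter_mem (hK : Convex ℝ K) (hcl : IsClosed K) (hR₀ : 0 ≤ R₀) (hw₁ : w₁ ∈ K) (n₀ : ℕ)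
    (z : ℕ → Z) (k : ℕ) : asaIter g K Γ R₀ w₁ n₀ z k ∈ K := by
  induction k with
  | zero => exact hw₁
  | succ k ih =>
    exact (ssg_mem (hK.inter (convex_closedBall _ _)) (hcl.inter Metric.isClosed_closedBall)
      ⟨ih, Metric.mem_closedBall_self (by positivity)⟩ _ _).1

lemma asaIter_eq_self (hK : Convex ℝ K) (hcl : IsClosed K) (hw₁ : w₁ ∈ K) (n₀ : ℕ) (z : ℕ → Z)
    (k : ℕ) : asaIter g K Γ 0 w₁ n₀ z k = w₁ := by
  induction k with
  | zero => rfl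
  | succ k ih =>
    have hmem := (ssg_mem (g := g) (γ := 0 / 2 ^ k / (Γ * √((n₀ : ℝ) + 1)))
      (hK.inter (convex_closedBall w₁ (0 / 2 ^ k))) (hcl.inter Metric.isClosed_closedBall)
      ⟨hw₁, Metric.mem_closedBall_self (by positivity)⟩ (fun t => z (k * n₀ + t)) n₀).2
    rw [asaIter, ih]
    simpa using hmem

end Iterates

section Oracle

variable {d : ℕ} {Z : Type*} [MeasurableSpace Z]

/-- The mean `∫ z, g w z ∂μ` of a stochastic subgradient oracle `g`, a subgradient at `w`. -/
noncomputable def oracleMean (μ : Measure Z) (g : Vec d → Z → Vec d) (w : Vec d) : Vec d :=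
  ∫ z, g w z ∂μ

/-- The ghost iterates: projected steps from the starting point of the stochastic subgradient
method, driven by the noise of the oracle along the iterates of the method. They depend only on the
past sample points, so that they can replace the reference point in the noise term of the regret. -/
noncomputable def ghostIter (μ : Measure Z) (g : Vec d → Z → Vec d) (K : Set (Vec d)) (γ : ℝ)
    (w₁ : Vec d) (z : ℕ → Z) : ℕ → Vec d
  | 0 => w₁
  | t + 1 => proj K (ghostIter μ g K γ w₁ z t
      - γ • (oracleMean μ g (ssgIter g K γ w₁ z t) - g (ssgIter g K γ w₁ z t) (z t)))

/-- The noise of the oracle `g` at `p.1`, paired with `p.1 - p.2`. -/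
noncomputable def oracleNoise (μ : Measure Z) (g : Vec d → Z → Vec d) (p : Vec d × Vec d) (z : Z) :
    ℝ :=
  ⟪oracleMean μ g p.1 - g p.1 z, p.1 - p.2⟫_ℝ

/-- The accumulated noise of `T` steps of the stochastic subgradient method, a martingale in `T`:
the noise at an iterate is paired with its difference from the ghost iterate. -/
noncomputable def noiseSum (μ : Measure Z) (g : Vec d → Z → Vec d) (K : Set (Vec d)) (γ : ℝ)
    (w₁ : Vec d) (z : ℕ → Z) (T : ℕ) : ℝ :=
  ∑ t ∈ Finset.range T,
    oracleNoise μ g (ssgIter g K γ w₁ z t, ghostIter μ g K γ w₁ z t) (z t)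

variable {K : Set (Vec d)} {μ : Measure Z} {P : Vec d → ℝ} {g : Vec d → Z → Vec d} {γ Γ R : ℝ}

lemma ghostIter_mem (hcl : IsClosed K) {w₁ : Vec d} (hw₁ : w₁ ∈ K) (z : ℕ → Z) (t : ℕ) :
    ghostIter μ g K γ w₁ z t ∈ K := by
  cases t with
  | zero => exact hw₁
  | succ t => exact proj_mem hcl ⟨w₁, hw₁⟩ _

namespace IsStochasticSubgradient

lemma subset (hg : IsStochasticSubgradient K μ P g Γ) {K' : Set (Vec d)} (hK' : K' ⊆ K) :
    IsStochasticSubgradient K' μ P g Γ :=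
  ⟨hg.measurable, fun w hw => hg.norm_le w (hK' hw),
    fun w hw u hu => hg.mean_mem w (hK' hw) u (hK' hu)⟩

lemma sub_le_inner_oracleMean (hg : IsStochasticSubgradient K μ P g Γ) {w u : Vec d} (hw : w ∈ K)
    (hu : u ∈ K) : P w - P u ≤ ⟪oracleMean μ g w, w - u⟫_ℝ := by
  have h : P w + ⟪oracleMean μ g w, u - w⟫_ℝ ≤ P u := hg.mean_mem w hw u hu
  rw [← neg_sub w u, inner_neg_right] at h
  linarith

variable [IsProbabilityMeasure μ]

lemma measurable_oracleMean (hg : IsStochasticSubgradient K μ P g Γ) :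
    Measurable (oracleMean μ g) :=
  hg.measurable.stronglyMeasurable.integral_prod_right.measurable

lemma norm_oracleMean_le (hg : IsStochasticSubgradient K μ P g Γ) {w : Vec d} (hw : w ∈ K) :
    ‖oracleMean μ g w‖ ≤ Γ := by
  simpa [oracleMean] using norm_integral_le_of_norm_le_const (μ := μ)
    (Filter.Eventually.of_forall (hg.norm_le w hw))

lemma norm_oracleMean_sub_le (hg : IsStochasticSubgradient K μ P g Γ) {w : Vec d} (hw : w ∈ K)
    (z : Z) : ‖oracleMean μ g w - g w z‖ ≤ 2 * Γ := by
  rw [two_mul]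
  exact norm_sub_le_of_le (hg.norm_oracleMean_le hw) (hg.norm_le w hw z)

lemma measurable_oracleNoise (hg : IsStochasticSubgradient K μ P g Γ) :
    Measurable (Function.uncurry (oracleNoise μ g)) := by
  have hmean : Measurable fun q : (Vec d × Vec d) × Z => oracleMean μ g q.1.1 :=
    hg.measurable_oracleMean.comp measurable_fst.fst
  have horacle : Measurable fun q : (Vec d × Vec d) × Z => g q.1.1 q.2 :=
    hg.measurable.comp (measurable_fst.fst.prodMk measurable_snd)
  exact (hmean.sub horacle).inner (measurable_fst.fst.sub measurable_fst.snd)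

lemma abs_oracleNoise_le (hg : IsStochasticSubgradient K μ P g Γ) {p : Vec d × Vec d}
    (hp : p.1 ∈ K) {D : ℝ} (hD : ‖p.1 - p.2‖ ≤ D) (z : Z) :
    |oracleNoise μ g p z| ≤ 2 * Γ * D :=
  (abs_real_inner_le_norm _ _).trans <| mul_le_mul (hg.norm_oracleMean_sub_le hp z) hD
    (norm_nonneg _) ((norm_nonneg _).trans (hg.norm_oracleMean_sub_le hp z))

lemma integral_oracleNoise (hg : IsStochasticSubgradient K μ P g Γ) {p : Vec d × Vec d}
    (hp : p.1 ∈ K) : ∫ z, oracleNoise μ g p z ∂μ = 0 := by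
  have hint : Integrable (g p.1) μ :=
    Integrable.of_bound (hg.measurable.comp measurable_prodMk_left).aestronglyMeasurable Γ
      (Filter.Eventually.of_forall (hg.norm_le _ hp))
  have hcentered : Integrable (fun z => oracleMean μ g p.1 - g p.1 z) μ :=
    (integrable_const _).sub hint
  simp only [oracleNoise, real_inner_comm (p.1 - p.2)]
  rw [integral_inner hcentered, integral_sub (integrable_const _) hint, integral_const,
    probReal_univ, one_smul, oracleMean, sub_self, inner_zero_right]

variable {c u : Vec d} {T : ℕ}

lemma sum_ssgIter_sub_le (hg : IsStochasticSubgradient K μ P g Γ) (hK : Convex ℝ K)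
    (hcl : IsClosed K) (hγ : 0 < γ) (hγR : γ * (Γ * √((T : ℝ) + 1)) = R) (hc : c ∈ K) (hu : u ∈ K)
    (huc : ‖c - u‖ ≤ R) (z : ℕ → Z) :
    ∑ t ∈ Finset.range T, (P (ssgIter g K γ c z t) - P u)
      ≤ 7 / 2 * (Γ * R * √((T : ℝ) + 1)) + noiseSum μ g K γ c z T := by
  set v := ssgIter g K γ c z
  set y := ghostIter μ g K γ c z
  have hv : ∀ t, v t ∈ K := ssgIter_mem hcl hc z
  have hregret := sum_inner_le_mul_sqrt_of_proj_steps hK hcl hγ hγR (y := v) (a := 1)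
    (h := fun t => g (v t) (z t)) (fun _ => rfl) hu huc
    (fun t => (hg.norm_le _ (hv t) _).trans_eq (one_mul Γ).symm)
  have hghost := sum_inner_le_mul_sqrt_of_proj_steps hK hcl hγ hγR (y := y) (a := 2)
    (h := fun t => oracleMean μ g (v t) - g (v t) (z t)) (fun _ => rfl) hu huc
    (fun t => hg.norm_oracleMean_sub_le (hv t) _)
  have hsum : ∑ t ∈ Finset.range T, (P (v t) - P u)
      ≤ ∑ t ∈ Finset.range T, ⟪g (v t) (z t), v t - u⟫_ℝ
        + ∑ t ∈ Finset.range T, ⟪oracleMean μ g (v t) - g (v t) (z t), y t - u⟫_ℝ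
        + noiseSum μ g K γ c z T := by
    rw [noiseSum, ← Finset.sum_add_distrib, ← Finset.sum_add_distrib]
    refine Finset.sum_le_sum fun t _ => (hg.sub_le_inner_oracleMean (hv t) hu).trans_eq ?_
    simp only [oracleNoise, inner_sub_left, inner_sub_right]
    ring
  linarith

theorem ssg_sub_le (hg : IsStochasticSubgradient K μ P g Γ) (hP : ConvexOn ℝ K P)
    (hcl : IsClosed K) (hΓ : 0 < Γ) (hR : 0 < R) (hc : c ∈ K) (hKR : ∀ w ∈ K, ‖w - c‖ ≤ R)
    (hγ : γ = R / (Γ * √((T : ℝ) + 1))) {z : ℕ → Z} {θ : ℝ}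
    (hnoise : noiseSum μ g K γ c z T ≤ Γ * R * √((T : ℝ) + 1) * θ) (hu : u ∈ K) :
    P (ssg g K γ c z T) - P u ≤ Γ * ((11 / 2 + θ) / √((T : ℝ) + 1)) * R := by
  have hγ0 : 0 < γ := by rw [hγ]; positivity
  have hγR : γ * (Γ * √((T : ℝ) + 1)) = R := by rw [hγ]; field_simp
  have hsum := hg.sum_ssgIter_sub_le hP.1 hcl hγ0 hγR hc hu
    ((norm_sub_rev c u).trans_le (hKR u hu)) z
  have hlast : P (ssgIter g K γ c z T) - P u ≤ 2 * (Γ * R * √((T : ℝ) + 1)) := by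
    set w := ssgIter g K γ c z T
    have hw : w ∈ K := ssgIter_mem hcl hc z T
    have hwu : ‖w - u‖ ≤ R + R :=
      (norm_sub_le_norm_sub_add_norm_sub w c u).trans
        (add_le_add (hKR w hw) ((norm_sub_rev c u).trans_le (hKR u hu)))
    calc P w - P u ≤ ‖oracleMean μ g w‖ * ‖w - u‖ :=
          (hg.sub_le_inner_oracleMean hw hu).trans (real_inner_le_norm _ _)
      _ ≤ Γ * (R + R) := by gcongr; exact hg.norm_oracleMean_le hw
      _ = 2 * (Γ * R) := by ring
      _ ≤ 2 * (Γ * R * √((T : ℝ) + 1)) :=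
        mul_le_mul_of_nonneg_left
          (le_mul_of_one_le_right (by positivity) (Real.one_le_sqrt.2 (by simp))) zero_le_two
  calc P (ssg g K γ c z T) - P u
      ≤ (∑ t ∈ Finset.range (T + 1), (P (ssgIter g K γ c z t) - P u)) / ((T : ℝ) + 1) :=
        ssg_sub_le_sum_div hP hcl hc z T u
    _ ≤ Γ * R * (11 / 2 + θ) * √((T : ℝ) + 1) / ((T : ℝ) + 1) := by
        rw [Finset.sum_range_succ]
        gcongr
        linarith
    _ = Γ * ((11 / 2 + θ) / √((T : ℝ) + 1)) * R := by
        rw [mul_div_assoc, Real.sqrt_div_self']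
        ring

end IsStochasticSubgradient

end Oracle

/-! ### Sub-Gaussian martingale differences -/

section SubGaussian

variable {α Z Ω : Type*} [MeasurableSpace α] [MeasurableSpace Z] [MeasurableSpace Ω]
  {ρ : Measure α} {μ : Measure Z} {ν : Measure Ω}

lemma hasSubgaussianMGF_of_abs_le [IsProbabilityMeasure μ] {Y : Z → ℝ} (hY : AEMeasurable Y μ)
    {b : ℝ≥0} (hb : ∀ᵐ z ∂μ, |Y z| ≤ b) (h0 : ∫ z, Y z ∂μ = 0) :
    HasSubgaussianMGF Y (b ^ 2) μ := by
  have h := hasSubgaussianMGF_of_mem_Icc_of_integral_eq_zero hY (hb.mono fun z => abs_le.1) h0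
  rwa [sub_neg_eq_add, ← two_mul, nnnorm_mul, Real.nnnorm_ofNat, NNReal.nnnorm_eq,
    mul_div_cancel_left₀ _ two_ne_zero] at h

section Prod

variable {u : α → ℝ} {v : α → Z → ℝ} {C : ℝ}

lemma integrable_prod_mul_of_integral_le [SFinite ρ] [SFinite μ] (hu : Integrable u ρ)
    (hv : Measurable (Function.uncurry v)) (hv0 : ∀ x z, 0 ≤ v x z)
    (hvint : ∀ x, Integrable (v x) μ) (hC : ∀ x, ∫ z, v x z ∂μ ≤ C) :
    Integrable (fun p : α × Z => u p.1 * v p.1 p.2) (ρ.prod μ) := by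
  have hmeas : AEStronglyMeasurable (fun p : α × Z => u p.1 * v p.1 p.2) (ρ.prod μ) :=
    hu.1.comp_fst.mul hv.aestronglyMeasurable
  refine (integrable_prod_iff hmeas).2 ⟨.of_forall fun x => (hvint x).const_mul (u x), ?_⟩
  refine (hu.norm.mul_const C).mono' hmeas.norm.integral_prod_right' (.of_forall fun x => ?_)
  simp only [norm_mul, integral_const_mul, Real.norm_of_nonneg (hv0 _ _), norm_norm]
  rw [Real.norm_of_nonneg (integral_nonneg (hv0 x))]
  gcongr
  exact hC x

lemma integral_prod_mul_le_of_integral_le [SFinite ρ] [SFinite μ] (hu : Integrable u ρ)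
    (hu0 : ∀ x, 0 ≤ u x) (hv : Measurable (Function.uncurry v)) (hv0 : ∀ x z, 0 ≤ v x z)
    (hvint : ∀ x, Integrable (v x) μ) (hC : ∀ x, ∫ z, v x z ∂μ ≤ C) :
    ∫ p : α × Z, u p.1 * v p.1 p.2 ∂ρ.prod μ ≤ (∫ x, u x ∂ρ) * C := by
  rw [integral_prod _ (integrable_prod_mul_of_integral_le hu hv hv0 hvint hC),
    ← integral_mul_const]
  simp only [integral_const_mul]
  exact integral_mono_of_nonneg
    (.of_forall fun x => mul_nonneg (hu0 x) (integral_nonneg (hv0 x))) (hu.mul_const C)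
    (.of_forall fun x => mul_le_mul_of_nonneg_left (hC x) (hu0 x))

end Prod

lemma hasSubgaussianMGF_prod_add [SFinite ρ] [SFinite μ] {S : α → ℝ} {φ : α → Z → ℝ} {c c' : ℝ≥0}
    (hS : HasSubgaussianMGF S c ρ) (hφ : Measurable (Function.uncurry φ))
    (hφS : ∀ x, HasSubgaussianMGF (φ x) c' μ) :
    HasSubgaussianMGF (fun p : α × Z => S p.1 + φ p.1 p.2) (c + c') (ρ.prod μ) := by
  have hsplit : ∀ t : ℝ, (fun p : α × Z => Real.exp (t * (S p.1 + φ p.1 p.2)))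
      = fun p => Real.exp (t * S p.1) * Real.exp (t * φ p.1 p.2) :=
    fun t => funext fun p => by rw [mul_add, Real.exp_add]
  have hexp : ∀ t : ℝ, Measurable (Function.uncurry fun x z => Real.exp (t * φ x z)) :=
    fun t => (hφ.const_mul t).exp
  refine ⟨fun t => ?_, fun t => ?_⟩
  · rw [hsplit]
    exact integrable_prod_mul_of_integral_le (hS.integrable_exp_mul t) (hexp t)
      (fun _ _ => (Real.exp_pos _).le) (fun x => (hφS x).integrable_exp_mul t)
      (fun x => (hφS x).mgf_le t)
  calc mgf (fun p : α × Z => S p.1 + φ p.1 p.2) (ρ.prod μ) t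
      ≤ mgf S ρ t * Real.exp (c' * t ^ 2 / 2) := by
        rw [mgf, hsplit]
        exact integral_prod_mul_le_of_integral_le (hS.integrable_exp_mul t)
          (fun _ => (Real.exp_pos _).le) (hexp t) (fun _ _ => (Real.exp_pos _).le)
          (fun x => (hφS x).integrable_exp_mul t) (fun x => (hφS x).mgf_le t)
    _ ≤ Real.exp (c * t ^ 2 / 2) * Real.exp (c' * t ^ 2 / 2) := by
        gcongr
        exact hS.mgf_le t
    _ = Real.exp (↑(c + c') * t ^ 2 / 2) := by
        rw [← Real.exp_add, NNReal.coe_add]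
        ring_nf

lemma identDistrib_prodMk_of_indepFun [IsFiniteMeasure ν] {X : Ω → α} {ξ : Ω → Z}
    (hX : Measurable X) (hξ : Measurable ξ) (h : IndepFun X ξ ν) :
    IdentDistrib (fun p : Ω × Z => (X p.1, p.2)) (fun ω => (X ω, ξ ω))
      (ν.prod (ν.map ξ)) ν where
  aemeasurable_fst := ((hX.comp measurable_fst).prodMk measurable_snd).aemeasurable
  aemeasurable_snd := (hX.prodMk hξ).aemeasurable
  map_eq := by
    rw [(indepFun_iff_map_prod_eq_prod_map_map hX.aemeasurable hξ.aemeasurable).1 h]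
    conv_rhs => rw [← Measure.map_id (μ := ν.map ξ)]
    exact (Measure.map_prod_map ν (ν.map ξ) hX measurable_id).symm

lemma hasSubgaussianMGF_add_of_indepFun [IsProbabilityMeasure ν] {X : Ω → α} {ξ : Ω → Z}
    {S : Ω → ℝ} {φ : α → Z → ℝ} {c c' : ℝ≥0} (hSm : Measurable S) (hX : Measurable X)
    (hξ : Measurable ξ) (hindep : IndepFun (fun ω => (S ω, X ω)) ξ ν)
    (hφ : Measurable (Function.uncurry φ)) (hS : HasSubgaussianMGF S c ν)
    (hφS : ∀ ω, HasSubgaussianMGF (φ (X ω)) c' (ν.map ξ)) :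
    HasSubgaussianMGF (fun ω => S ω + φ (X ω) (ξ ω)) (c + c') ν := by
  have hprod : HasSubgaussianMGF (fun p : Ω × Z => S p.1 + φ (X p.1) p.2) (c + c')
      (ν.prod (ν.map ξ)) :=
    hasSubgaussianMGF_prod_add (φ := fun ω => φ (X ω)) hS
      (hφ.comp ((hX.comp measurable_fst).prodMk measurable_snd)) hφS
  have hsum : Measurable fun q : (ℝ × α) × Z => q.1.1 + φ q.1.2 q.2 :=
    measurable_fst.fst.add (hφ.comp (measurable_fst.snd.prodMk measurable_snd))
  exact hprod.congr_identDistrib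
    ((identDistrib_prodMk_of_indepFun (hSm.prodMk hX) hξ hindep).comp hsum)

end SubGaussian

section Azuma

variable {Z Ω β : Type*} [MeasurableSpace Z] [MeasurableSpace β]

/-- The σ-algebra generated by the first `i` sample points `ζ 0, …, ζ (i - 1)`. -/
abbrev past (ζ : ℕ → Ω → Z) (i : ℕ) : MeasurableSpace Ω :=
  ⨆ j ∈ Set.Iio i, MeasurableSpace.comap (ζ j) inferInstance

lemma past_mono (ζ : ℕ → Ω → Z) {i j : ℕ} (h : i ≤ j) : past ζ i ≤ past ζ j :=
  biSup_mono fun _ hk => lt_of_lt_of_le hk h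

lemma measurable_past (ζ : ℕ → Ω → Z) {i j : ℕ} (h : i < j) : Measurable[past ζ j] (ζ i) :=
  measurable_iff_comap_le.2 (le_biSup (fun k => MeasurableSpace.comap (ζ k) _) h)

lemma measurable_past_sum {ζ : ℕ → Ω → Z} {φ : β → Z → ℝ}
    (hφ : Measurable (Function.uncurry φ)) {i : ℕ} {X : ℕ → Ω → β}
    (hX : ∀ t, Measurable[past ζ (i + t)] (X t)) (T : ℕ) :
    Measurable[past ζ (i + T)] fun ω => ∑ t ∈ Finset.range T, φ (X t ω) (ζ (i + t) ω) := by
  refine Finset.measurable_sum _ fun t ht => ?_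
  have htT : t < T := Finset.mem_range.1 ht
  exact hφ.comp (((hX t).mono (past_mono ζ (by omega)) le_rfl).prodMk
    (measurable_past ζ (by omega)))

variable [MeasurableSpace Ω] {ν : Measure Ω} {μ : Measure Z} {ζ : ℕ → Ω → Z}

lemma IsIIDSample.past_le (hζ : IsIIDSample ν μ ζ) (i : ℕ) : past ζ i ≤ ‹MeasurableSpace Ω› :=
  iSup₂_le fun j _ => (hζ.measurable j).comap_le

lemma IsIIDSample.indepFun_past (hζ : IsIIDSample ν μ ζ) {i : ℕ} {X : Ω → β}
    (hX : Measurable[past ζ i] X) : IndepFun X (ζ i) ν := by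
  have h := indep_iSup_of_disjoint (fun j => (hζ.measurable j).comap_le) hζ.indep
    (S := Set.Iio i) (T := {i}) (by simp)
  rw [iSup_singleton] at h
  exact indep_of_indep_of_le_left h (measurable_iff_comap_le.1 hX)

theorem IsIIDSample.hasSubgaussianMGF_sum [IsProbabilityMeasure ν] (hζ : IsIIDSample ν μ ζ)
    {φ : β → Z → ℝ} (hφ : Measurable (Function.uncurry φ)) {i : ℕ} {X : ℕ → Ω → β}
    (hX : ∀ t, Measurable[past ζ (i + t)] (X t)) {c : ℝ≥0}
    (hφS : ∀ t ω, HasSubgaussianMGF (φ (X t ω)) c μ) (T : ℕ) :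
    HasSubgaussianMGF (fun ω => ∑ t ∈ Finset.range T, φ (X t ω) (ζ (i + t) ω)) (T * c) ν := by
  induction T with
  | zero => simp
  | succ T ih =>
    have hmeas := measurable_past_sum hφ hX T
    simp only [Finset.sum_range_succ, Nat.cast_succ, add_one_mul]
    refine hasSubgaussianMGF_add_of_indepFun (hmeas.mono (hζ.past_le _) le_rfl)
      ((hX T).mono (hζ.past_le _) le_rfl) (hζ.measurable _)
      (hζ.indepFun_past (hmeas.prodMk (hX T))) hφ ih fun ω => ?_
    rw [hζ.law]
    exact hφS T ω

end Azuma

/-! ### Adaptive stochastic approximation -/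

section Stages

variable {d : ℕ} {K : Set (Vec d)} {P : Vec d → ℝ} {α a : ℝ} {v : Vec d}

lemma dist_le_or_sub_le_of_stage (hE : EBC K P 1 α) (hα : 0 ≤ α) (ha : 0 ≤ a)
    (hv : v ∈ minimizers K P) {R : ℝ} (hR : 0 ≤ R) {c c' : Vec d} (hc : c ∈ K) (hc' : c' ∈ K)
    (hstage : ∀ u ∈ K, ‖u - c‖ ≤ R → P c' - P u ≤ a * R)
    (h : (∃ u ∈ minimizers K P, ‖c - u‖ ≤ R) ∨ P c - P v ≤ 8 * α * a ^ 2 - 2 * a * R) :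
    (∃ u ∈ minimizers K P, ‖c' - u‖ ≤ R / 2) ∨
      P c' - P v ≤ 8 * α * a ^ 2 - 2 * a * (R / 2) := by
  rcases h with ⟨u, hu, hcu⟩ | hexcess
  · have hprogress : P c' - P v ≤ a * R := by
      rw [← eq_of_mem_minimizers hu hv]
      exact hstage u hu.1 (by rwa [norm_sub_rev])
    rcases le_total (4 * α * a) R with hlarge | hsmall
    · obtain ⟨u', hu', hquad⟩ := hE.exists_minimizer hc'
      rw [eq_of_mem_minimizers hu' hv] at hquad
      refine Or.inl ⟨u', hu', (sq_le_sq₀ (norm_nonneg _) (by positivity)).1 ?_⟩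
      calc ‖c' - u'‖ ^ 2 ≤ α * (a * R) := hquad.trans (by gcongr)
        _ ≤ (R / 2) ^ 2 := by nlinarith
    · exact Or.inr (by nlinarith)
  · have hprogress := hstage c hc (by simpa using hR)
    exact Or.inr (by linarith)

lemma sub_le_max_of_stage (hv : v ∈ minimizers K P) {R : ℝ} (hR : 0 ≤ R) (ha : 0 ≤ a)
    {c c' : Vec d} (hc : c ∈ K) (hstage : ∀ u ∈ K, ‖u - c‖ ≤ R → P c' - P u ≤ a * R)
    (h : (∃ u ∈ minimizers K P, ‖c - u‖ ≤ R) ∨ P c - P v ≤ 8 * α * a ^ 2 - 2 * a * R) :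
    P c' - P v ≤ max (a * R) (8 * α * a ^ 2) := by
  rcases h with ⟨u, hu, hcu⟩ | hexcess
  · rw [← eq_of_mem_minimizers hu hv]
    exact (hstage u hu.1 (by rwa [norm_sub_rev])).trans (le_max_left _ _)
  · have hprogress := hstage c hc (by simpa using hR)
    have haR : 0 ≤ a * R := by positivity
    exact le_max_of_le_right (by linarith)

lemma sub_le_max_of_stages (hE : EBC K P 1 α) (hα : 0 ≤ α) (ha : 0 ≤ a)
    (hv : v ∈ minimizers K P) {R₀ : ℝ} (hR₀ : 0 ≤ R₀) {c : ℕ → Vec d} (hc : ∀ k, c k ∈ K)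
    (hcv : ‖c 0 - v‖ ≤ R₀) {m : ℕ}
    (hstage : ∀ k ≤ m, ∀ u ∈ K, ‖u - c k‖ ≤ R₀ / 2 ^ k →
      P (c (k + 1)) - P u ≤ a * (R₀ / 2 ^ k)) :
    P (c (m + 1)) - P v ≤ max (a * (R₀ / 2 ^ m)) (8 * α * a ^ 2) := by
  have hinv : ∀ k ≤ m, (∃ u ∈ minimizers K P, ‖c k - u‖ ≤ R₀ / 2 ^ k) ∨
      P (c k) - P v ≤ 8 * α * a ^ 2 - 2 * a * (R₀ / 2 ^ k) := by
    intro k hk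
    induction k with
    | zero => exact Or.inl ⟨v, hv, by simpa using hcv⟩
    | succ k ih =>
      rw [pow_succ, ← div_div]
      exact dist_le_or_sub_le_of_stage hE hα ha hv (by positivity) (hc k) (hc (k + 1))
        (hstage k (by omega)) (ih (by omega))
  exact sub_le_max_of_stage hv (by positivity) ha (hc m) (hstage m le_rfl) (hinv m le_rfl)

end Stages

section ASA

variable {d : ℕ} {Z Ω : Type*} [MeasurableSpace Z] {K : Set (Vec d)} {μ : Measure Z}
  {P : Vec d → ℝ} {g : Vec d → Z → Vec d} {Γ R R₀ : ℝ} {ζ : ℕ → Ω → Z}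

lemma measurable_proj_inter_closedBall {m : MeasurableSpace Ω} (hK : Convex ℝ K)
    (hcl : IsClosed K) (hne : K.Nonempty) (hR : 0 ≤ R) {C x : Ω → Vec d} (hC : Measurable C)
    (hCK : ∀ ω, C ω ∈ K) (hx : Measurable x) :
    Measurable fun ω => proj (K ∩ Metric.closedBall (C ω) R) (x ω) := by
  simpa only [Function.comp_def, proj_eq_self hcl (hCK _)] using
    (continuous_proj_inter_closedBall hK hcl hne hR).measurable.comp (hC.prodMk hx)

namespace IsStochasticSubgradient

variable [IsProbabilityMeasure μ]

lemma measurable_past_iterates (hg : IsStochasticSubgradient K μ P g Γ) (hK : Convex ℝ K)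
    (hcl : IsClosed K) (hne : K.Nonempty) (hR : 0 ≤ R) (γ : ℝ) {i : ℕ} {C : Ω → Vec d}
    (hC : Measurable[past ζ i] C) (hCK : ∀ ω, C ω ∈ K) (t : ℕ) :
    Measurable[past ζ (i + t)] fun ω =>
      (ssgIter g (K ∩ Metric.closedBall (C ω) R) γ (C ω) (fun j => ζ (i + j) ω) t,
        ghostIter μ g (K ∩ Metric.closedBall (C ω) R) γ (C ω) (fun j => ζ (i + j) ω) t) := by
  induction t with
  | zero => exact hC.prodMk hC
  | succ t ih =>
    have ih' := ih.mono (past_mono ζ (show i + t ≤ i + (t + 1) by omega)) le_rfl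
    have hC' := hC.mono (past_mono ζ (show i ≤ i + (t + 1) by omega)) le_rfl
    have horacle := hg.measurable.comp
      (ih'.fst.prodMk (measurable_past ζ (show i + t < i + (t + 1) by omega)))
    have hmean := hg.measurable_oracleMean.comp ih'.fst
    exact (measurable_proj_inter_closedBall hK hcl hne hR hC' hCK
        (ih'.fst.sub (horacle.const_smul γ))).prodMk
      (measurable_proj_inter_closedBall hK hcl hne hR hC' hCK
        (ih'.snd.sub ((hmean.sub horacle).const_smul γ)))

lemma measurable_past_asaIter (hg : IsStochasticSubgradient K μ P g Γ) (hK : Convex ℝ K)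
    (hcl : IsClosed K) (hR₀ : 0 ≤ R₀) {w₁ : Vec d} (hw₁ : w₁ ∈ K) (n₀ k : ℕ) :
    Measurable[past ζ (k * n₀)] fun ω => asaIter g K Γ R₀ w₁ n₀ (fun i => ζ i ω) k := by
  induction k with
  | zero => exact measurable_const
  | succ k ih =>
    have hsum := Finset.measurable_sum (m := past ζ ((k + 1) * n₀)) (Finset.range (n₀ + 1))
      fun t ht => (hg.measurable_past_iterates hK hcl ⟨w₁, hw₁⟩ (R := R₀ / 2 ^ k) (by positivity)
        (R₀ / 2 ^ k / (Γ * √((n₀ : ℝ) + 1))) ih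
        (fun ω => asaIter_mem hK hcl hR₀ hw₁ n₀ (fun i => ζ i ω) k) t).fst.mono
          (past_mono ζ (by
            rw [add_one_mul]
            exact Nat.add_le_add_left (Nat.lt_succ_iff.1 (Finset.mem_range.1 ht)) _)) le_rfl
    exact (measurable_const_smul (1 / ((n₀ : ℝ) + 1))).comp hsum

variable [MeasurableSpace Ω] {ν : Measure Ω} [IsProbabilityMeasure ν]

lemma hasSubgaussianMGF_noiseSum (hg : IsStochasticSubgradient K μ P g Γ)
    (hζ : IsIIDSample ν μ ζ) (hK : Convex ℝ K) (hcl : IsClosed K) (hne : K.Nonempty)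
    (hΓ : 0 ≤ Γ) (hR : 0 ≤ R) (γ : ℝ) {i : ℕ} {C : Ω → Vec d} (hC : Measurable[past ζ i] C)
    (hCK : ∀ ω, C ω ∈ K) (T : ℕ) :
    HasSubgaussianMGF
      (fun ω => noiseSum μ g (K ∩ Metric.closedBall (C ω) R) γ (C ω) (fun j => ζ (i + j) ω) T)
      (T * (2 * Γ * (2 * R)).toNNReal ^ 2) ν := by
  have hCball : ∀ ω, C ω ∈ K ∩ Metric.closedBall (C ω) R :=
    fun ω => ⟨hCK ω, Metric.mem_closedBall_self hR⟩
  refine hζ.hasSubgaussianMGF_sum hg.measurable_oracleNoise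
    (hg.measurable_past_iterates hK hcl hne hR γ hC hCK) (fun t ω => ?_) T
  have hv := ssgIter_mem (g := g) (γ := γ) (hcl.inter Metric.isClosed_closedBall) (hCball ω)
    (fun j => ζ (i + j) ω) t
  have hy := ghostIter_mem (μ := μ) (g := g) (γ := γ) (hcl.inter Metric.isClosed_closedBall)
    (hCball ω) (fun j => ζ (i + j) ω) t
  refine hasSubgaussianMGF_of_abs_le
    (hg.measurable_oracleNoise.comp measurable_prodMk_left).aemeasurable (.of_forall fun z => ?_)
    (hg.integral_oracleNoise hv.1)
  rw [Real.coe_toNNReal _ (by positivity)]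
  refine hg.abs_oracleNoise_le hv.1 ?_ z
  rw [two_mul, ← dist_eq_norm]
  exact (dist_triangle_right _ _ (C ω)).trans (add_le_add hv.2 hy.2)

theorem measure_noiseSum_ge_le (hg : IsStochasticSubgradient K μ P g Γ)
    (hζ : IsIIDSample ν μ ζ) (hK : Convex ℝ K) (hcl : IsClosed K) (hne : K.Nonempty)
    (hΓ : 0 < Γ) (hR : 0 < R) (γ : ℝ) {i : ℕ} {C : Ω → Vec d} (hC : Measurable[past ζ i] C)
    (hCK : ∀ ω, C ω ∈ K) (T : ℕ) {θ : ℝ} (hθ : 0 ≤ θ) :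
    ν {ω | Γ * R * √((T : ℝ) + 1) * θ
        ≤ noiseSum μ g (K ∩ Metric.closedBall (C ω) R) γ (C ω) (fun j => ζ (i + j) ω) T}
      ≤ ENNReal.ofReal (Real.exp (-(θ ^ 2 / 32))) := by
  have hsub := hg.hasSubgaussianMGF_noiseSum hζ hK hcl hne hΓ.le hR.le γ hC hCK T
  -- The parameter is enlarged since the Chernoff bound of a variable with parameter `0` is trivial.
  have hsub' : HasSubgaussianMGF _ ((T + 1) * (2 * Γ * (2 * R)).toNNReal ^ 2) ν :=
    ⟨hsub.integrable_exp_mul, fun t => (hsub.mgf_le t).trans (by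
      gcongr
      exact le_self_add)⟩
  rw [← ofReal_measureReal]
  refine ENNReal.ofReal_le_ofReal ((hsub'.measure_ge_le (by positivity)).trans_eq ?_)
  congr 1
  push_cast
  rw [Real.coe_toNNReal _ (by positivity), mul_pow, mul_pow, Real.sq_sqrt (by positivity)]
  field_simp
  ring

end IsStochasticSubgradient

end ASA

section StageUnion

variable {d : ℕ} {Z : Type*} [MeasurableSpace Z] {K : Set (Vec d)} {μ : Measure Z}
  [IsProbabilityMeasure μ] {P : Vec d → ℝ} {g : Vec d → Z → Vec d} {Γ R₀ θ : ℝ} {w₁ : Vec d}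
  {n₀ : ℕ}

namespace IsStochasticSubgradient

lemma asaIter_succ_sub_le (hg : IsStochasticSubgradient K μ P g Γ) (hP : ConvexOn ℝ K P)
    (hcl : IsClosed K) (hΓ : 0 < Γ) (hR₀ : 0 < R₀) (hw₁ : w₁ ∈ K) {z : ℕ → Z} {k : ℕ}
    (hnoise : noiseSum μ g (K ∩ Metric.closedBall (asaIter g K Γ R₀ w₁ n₀ z k) (R₀ / 2 ^ k))
        (R₀ / 2 ^ k / (Γ * √((n₀ : ℝ) + 1))) (asaIter g K Γ R₀ w₁ n₀ z k)
        (fun t => z (k * n₀ + t)) n₀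
      ≤ Γ * (R₀ / 2 ^ k) * √((n₀ : ℝ) + 1) * θ)
    {u : Vec d} (hu : u ∈ K) (hdist : ‖u - asaIter g K Γ R₀ w₁ n₀ z k‖ ≤ R₀ / 2 ^ k) :
    P (asaIter g K Γ R₀ w₁ n₀ z (k + 1)) - P u
      ≤ Γ * ((11 / 2 + θ) / √((n₀ : ℝ) + 1)) * (R₀ / 2 ^ k) := by
  have hR : 0 < R₀ / 2 ^ k := by positivity
  exact (hg.subset Set.inter_subset_left).ssg_sub_le
    (hP.subset Set.inter_subset_left (hP.1.inter (convex_closedBall _ _)))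
    (hcl.inter Metric.isClosed_closedBall) hΓ hR
    ⟨asaIter_mem hP.1 hcl hR₀.le hw₁ n₀ z k, Metric.mem_closedBall_self hR.le⟩
    (fun w hw => mem_closedBall_iff_norm.1 hw.2) rfl hnoise ⟨hu, mem_closedBall_iff_norm.2 hdist⟩

variable {Ω : Type*} [MeasurableSpace Ω] {ν : Measure Ω} [IsProbabilityMeasure ν] {ζ : ℕ → Ω → Z}
  {α a : ℝ}

theorem measure_asaIter_excess_gt_le (hg : IsStochasticSubgradient K μ P g Γ)
    (hP : ConvexOn ℝ K P) (hcl : IsClosed K) (hΓ : 0 < Γ) (hα : 0 ≤ α) (hE : EBC K P 1 α)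
    (hR₀ : 0 < R₀) (hw₁ : w₁ ∈ K) {v : Vec d} (hv : v ∈ minimizers K P) (hdist : ‖w₁ - v‖ ≤ R₀)
    (hζ : IsIIDSample ν μ ζ) (m : ℕ) (hθ : 0 ≤ θ)
    (ha : a = Γ * ((11 / 2 + θ) / √((n₀ : ℝ) + 1))) :
    ν {ω | max (a * (R₀ / 2 ^ m)) (8 * α * a ^ 2)
        < P (asaIter g K Γ R₀ w₁ n₀ (fun i => ζ i ω) (m + 1)) - P v}
      ≤ ENNReal.ofReal ((m + 1) * Real.exp (-(θ ^ 2 / 32))) := by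
  let C (k : ℕ) (ω : Ω) : Vec d := asaIter g K Γ R₀ w₁ n₀ (fun i => ζ i ω) k
  have hCK (k : ℕ) (ω : Ω) : C k ω ∈ K := asaIter_mem hP.1 hcl hR₀.le hw₁ n₀ _ k
  let bad (k : ℕ) : Set Ω := {ω | Γ * (R₀ / 2 ^ k) * √((n₀ : ℝ) + 1) * θ
    ≤ noiseSum μ g (K ∩ Metric.closedBall (C k ω) (R₀ / 2 ^ k))
      (R₀ / 2 ^ k / (Γ * √((n₀ : ℝ) + 1))) (C k ω) (fun t => ζ (k * n₀ + t) ω) n₀}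
  have hbad (k : ℕ) : ν (bad k) ≤ ENNReal.ofReal (Real.exp (-(θ ^ 2 / 32))) :=
    hg.measure_noiseSum_ge_le hζ hP.1 hcl ⟨w₁, hw₁⟩ hΓ (by positivity) _
      (hg.measurable_past_asaIter hP.1 hcl hR₀.le hw₁ n₀ k) (hCK k) n₀ hθ
  have hgood (ω : Ω) (hω : ∀ k ≤ m, ω ∉ bad k) :
      P (C (m + 1) ω) - P v ≤ max (a * (R₀ / 2 ^ m)) (8 * α * a ^ 2) :=
    sub_le_max_of_stages hE hα (by rw [ha]; positivity) hv hR₀.le (fun k => hCK k ω) hdist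
      fun k hk u hu huC => ha ▸ hg.asaIter_succ_sub_le hP hcl hΓ hR₀ hw₁
        (not_le.1 (hω k hk)).le hu huC
  calc ν {ω | max (a * (R₀ / 2 ^ m)) (8 * α * a ^ 2) < P (C (m + 1) ω) - P v}
      ≤ ν (⋃ k ∈ Finset.range (m + 1), bad k) := measure_mono fun ω hω => by
        by_contra hnot
        simp only [Set.mem_iUnion, not_exists, Finset.mem_range, Nat.lt_succ_iff] at hnot
        exact (hgood ω hnot).not_gt hω
    _ ≤ ∑ k ∈ Finset.range (m + 1), ν (bad k) := measure_biUnion_finset_le _ _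
    _ ≤ ∑ _k ∈ Finset.range (m + 1), ENNReal.ofReal (Real.exp (-(θ ^ 2 / 32))) :=
      Finset.sum_le_sum fun k _ => hbad k
    _ = ENNReal.ofReal ((m + 1) * Real.exp (-(θ ^ 2 / 32))) := by
      rw [Finset.sum_const, Finset.card_range, nsmul_eq_mul, ENNReal.ofReal_mul (by positivity),
        ← Nat.cast_succ, ENNReal.ofReal_natCast]

end IsStochasticSubgradient

end StageUnion

section StageNumber

variable {n : ℕ}

lemma four_le_log (hn : 100 ≤ n) : 4 ≤ Real.log n := by
  have hn' : (100 : ℝ) ≤ n := by exact_mod_cast hn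
  rw [Real.le_log_iff_exp_le (by linarith)]
  calc Real.exp 4 = Real.exp 1 ^ 4 := by rw [← Real.exp_nat_mul]; norm_num
    _ ≤ 3 ^ 4 := pow_le_pow_left₀ (Real.exp_pos 1).le Real.exp_one_lt_three.le 4
    _ ≤ n := by linarith

lemma log_le_div_twenty (hn : 100 ≤ n) : Real.log n ≤ n / 20 := by
  have hn' : (100 : ℝ) ≤ n := by exact_mod_cast hn
  have hlog100 : Real.log 100 ≤ 5 := by
    rw [Real.log_le_iff_le_exp (by norm_num)]
    calc (100 : ℝ) ≤ 2.7 ^ 5 := by norm_num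
      _ ≤ Real.exp 1 ^ 5 := by gcongr; linarith [Real.exp_one_gt_d9]
      _ = Real.exp 5 := by rw [← Real.exp_nat_mul]; norm_num
  have htangent := Real.log_le_sub_one_of_pos (show 0 < (n : ℝ) / 100 by positivity)
  rw [Real.log_div (by positivity) (by norm_num)] at htangent
  linarith

lemma two_mul_div_logb_two (n : ℕ) :
    2 * (n : ℝ) / Real.logb 2 n = 2 * n * Real.log 2 / Real.log n := by
  rw [Real.logb, div_div_eq_mul_div]

lemma sixteen_le_two_mul_div_logb (hn : 100 ≤ n) : 16 ≤ 2 * (n : ℝ) / Real.logb 2 n := by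
  have hlog := four_le_log hn
  rw [two_mul_div_logb_two, le_div_iff₀ (by linarith)]
  nlinarith [log_le_div_twenty hn, Real.log_two_gt_d9]

lemma two_mul_div_logb_le (hn : 100 ≤ n) : 2 * (n : ℝ) / Real.logb 2 n ≤ n := by
  have hlog := four_le_log hn
  rw [two_mul_div_logb_two, div_le_iff₀ (by linarith)]
  nlinarith [(Nat.cast_nonneg n : (0 : ℝ) ≤ n), Real.log_two_lt_d9]

lemma pow_natFloor_logb_le {b x : ℝ} (hb : 1 < b) (hx : 1 ≤ x) : b ^ ⌊Real.logb b x⌋₊ ≤ x := by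
  rw [← Real.rpow_natCast, ← Real.le_logb_iff_rpow_le hb (by linarith)]
  exact Nat.floor_le (Real.logb_nonneg hb hx)

lemma lt_pow_natFloor_logb_add_one {b x : ℝ} (hb : 1 < b) (hx : 0 < x) :
    x < b ^ (⌊Real.logb b x⌋₊ + 1) := by
  rw [← Real.rpow_natCast, ← Real.logb_lt_iff_lt_rpow hb hx, Nat.cast_succ]
  exact Nat.lt_floor_add_one _

lemma logb_four (x : ℝ) : Real.logb 4 x = 1 / 2 * Real.logb 2 x := by
  rw [Real.logb, Real.logb, show (4 : ℝ) = 2 ^ 2 by norm_num, Real.log_pow, one_div_mul_eq_div,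
    div_div, mul_comm, Nat.cast_ofNat]

lemma two_le_natFloor_logb_four (hn : 100 ≤ n) :
    2 ≤ ⌊Real.logb 4 (2 * (n : ℝ) / Real.logb 2 n)⌋₊ := by
  have hQ := sixteen_le_two_mul_div_logb hn
  rw [Nat.le_floor_iff' two_ne_zero, Real.le_logb_iff_rpow_le (by norm_num) (by linarith)]
  norm_num
  exact hQ

lemma asaStages_add_one (hn : 100 ≤ n) :
    asaStages n + 1 = ⌊Real.logb 4 (2 * (n : ℝ) / Real.logb 2 n)⌋₊ := by
  rw [asaStages, ← logb_four, Nat.sub_add_cancel (one_le_two.trans (two_le_natFloor_logb_four hn))]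

lemma asaStages_pos (hn : 100 ≤ n) : 0 < asaStages n := by
  have := asaStages_add_one hn
  have := two_le_natFloor_logb_four hn
  omega

lemma asaStages_le_log (hn : 100 ≤ n) : (asaStages n : ℝ) ≤ Real.log n := by
  have hQ := sixteen_le_two_mul_div_logb hn
  have hpow : (4 : ℝ) ^ (asaStages n + 1) ≤ n := by
    rw [asaStages_add_one hn]
    exact (pow_natFloor_logb_le (by norm_num) (by linarith)).trans (two_mul_div_logb_le hn)
  have hlog := Real.log_le_log (by positivity) hpow
  rw [show (4 : ℝ) = 2 ^ 2 by norm_num, Real.log_pow, Real.log_pow] at hlog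
  push_cast at hlog
  nlinarith [Real.log_two_gt_d9]

lemma le_log_mul_four_pow_asaStages (hn : 100 ≤ n) :
    (n : ℝ) ≤ 12 * Real.log n * 4 ^ asaStages n := by
  have hlog := four_le_log hn
  have hQ := sixteen_le_two_mul_div_logb hn
  have hpow : 2 * (n : ℝ) / Real.logb 2 n < 4 ^ (asaStages n + 2) := by
    rw [show asaStages n + 2 = asaStages n + 1 + 1 from rfl, asaStages_add_one hn]
    exact lt_pow_natFloor_logb_add_one (by norm_num) (by linarith)
  rw [two_mul_div_logb_two, div_lt_iff₀ (by linarith), pow_add] at hpow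
  have : 0 < Real.log n * 4 ^ asaStages n := by positivity
  nlinarith [Real.log_two_gt_d9]

lemma one_div_asaStageLength_add_one_le (hn : 100 ≤ n) :
    1 / ((asaStageLength n : ℝ) + 1) ≤ asaStages n / n := by
  have hlt : (n : ℝ) < asaStages n * ((asaStageLength n : ℝ) + 1) := by
    exact_mod_cast Nat.lt_mul_div_succ n (asaStages_pos hn)
  have hn0 : (0 : ℝ) < n := by exact_mod_cast (by omega : 0 < n)
  rw [div_le_div_iff₀ (by positivity) hn0]
  linarith

end StageNumber

section ASARate

variable {n : ℕ} {δ : ℝ}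

/-- The rate `log n log (log n / δ) / n` of adaptive stochastic approximation. -/
noncomputable def asaRate (n : ℕ) (δ : ℝ) : ℝ := Real.log n * Real.log (Real.log n / δ) / n

/-- The factor `s` for which, with probability at least `1 - δ`, every stage of `asa` started within
`R_k` of a point `u` brings the risk below `P u + Γ s R_k`. -/
noncomputable def asaDeviation (n : ℕ) (δ : ℝ) : ℝ :=
  (11 / 2 + √(32 * Real.log (asaStages n / δ))) / √((asaStageLength n : ℝ) + 1)

lemma one_le_log_log_div (hn : 100 ≤ n) (hδ : 0 < δ) (hδ1 : δ ≤ 1) :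
    1 ≤ Real.log (Real.log n / δ) := by
  have hlog := four_le_log hn
  rw [Real.le_log_iff_exp_le (by positivity), le_div_iff₀ hδ]
  calc Real.exp 1 * δ ≤ 3 * 1 := by gcongr; exact Real.exp_one_lt_three.le
    _ ≤ Real.log n := by linarith

lemma log_div_le_asaRate (hn : 100 ≤ n) (hδ : 0 < δ) (hδ1 : δ ≤ 1) :
    Real.log n / n ≤ asaRate n δ := by
  have hlog := four_le_log hn
  rw [asaRate]
  gcongr
  exact le_mul_of_one_le_right (by linarith) (one_le_log_log_div hn hδ hδ1)

lemma asaRate_nonneg (hn : 100 ≤ n) (hδ : 0 < δ) (hδ1 : δ ≤ 1) : 0 ≤ asaRate n δ :=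
  (by positivity : 0 ≤ Real.log n / n).trans (log_div_le_asaRate hn hδ hδ1)

lemma asaDeviation_nonneg (n : ℕ) (δ : ℝ) : 0 ≤ asaDeviation n δ := by
  rw [asaDeviation]
  positivity

lemma log_asaStages_div_nonneg (hn : 100 ≤ n) (hδ : 0 < δ) (hδ1 : δ ≤ 1) :
    0 ≤ Real.log (asaStages n / δ) := by
  have hm : (1 : ℝ) ≤ asaStages n := by exact_mod_cast asaStages_pos hn
  exact Real.log_nonneg ((one_le_div hδ).2 (hδ1.trans hm))

lemma asaDeviation_sq_le (hn : 100 ≤ n) (hδ : 0 < δ) (hδ1 : δ ≤ 1) :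
    asaDeviation n δ ^ 2 ≤ 125 * asaRate n δ := by
  have hm : (0 : ℝ) < asaStages n := by exact_mod_cast asaStages_pos hn
  have hl := one_le_log_log_div hn hδ hδ1
  have hstages : Real.log (asaStages n / δ) ≤ Real.log (Real.log n / δ) := by
    gcongr
    exact asaStages_le_log hn
  have hlength : 1 / ((asaStageLength n : ℝ) + 1) ≤ Real.log n / n :=
    (one_div_asaStageLength_add_one_le hn).trans (by gcongr; exact asaStages_le_log hn)
  have hsqrt : √(32 * Real.log (asaStages n / δ)) ^ 2 = 32 * Real.log (asaStages n / δ) :=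
    Real.sq_sqrt (mul_nonneg (by norm_num) (log_asaStages_div_nonneg hn hδ hδ1))
  calc asaDeviation n δ ^ 2
      = (11 / 2 + √(32 * Real.log (asaStages n / δ))) ^ 2
          * (1 / ((asaStageLength n : ℝ) + 1)) := by
        rw [asaDeviation, div_pow, Real.sq_sqrt (by positivity), div_eq_mul_one_div]
    _ ≤ 125 * Real.log (Real.log n / δ) * (Real.log n / n) := by
        refine mul_le_mul ?_ hlength (by positivity) (by linarith)
        nlinarith [sq_nonneg (11 / 2 - √(32 * Real.log (asaStages n / δ)))]
    _ = 125 * asaRate n δ := by rw [asaRate]; ring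

lemma asaDeviation_div_two_pow_le (hn : 100 ≤ n) (hδ : 0 < δ) (hδ1 : δ ≤ 1) :
    asaDeviation n δ / 2 ^ asaStages n ≤ 39 * asaRate n δ := by
  have hr := asaRate_nonneg hn hδ hδ1
  have hn0 : (0 : ℝ) < n := by exact_mod_cast (by omega : 0 < n)
  have hone : 1 ≤ 12 * asaRate n δ * 4 ^ asaStages n := by
    calc 1 ≤ 12 * (Real.log n / n) * 4 ^ asaStages n := by
          rw [mul_div_assoc', div_mul_eq_mul_div, one_le_div hn0]
          exact le_log_mul_four_pow_asaStages hn
      _ ≤ 12 * asaRate n δ * 4 ^ asaStages n := by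
          gcongr
          exact log_div_le_asaRate hn hδ hδ1
  rw [div_le_iff₀ (by positivity)]
  refine (sq_le_sq₀ (asaDeviation_nonneg n δ) (by positivity)).1 ?_
  have hfour : ((2 : ℝ) ^ asaStages n) ^ 2 = 4 ^ asaStages n := by
    rw [pow_right_comm]; norm_num
  calc asaDeviation n δ ^ 2 ≤ 125 * asaRate n δ * 1 := by
        rw [mul_one]; exact asaDeviation_sq_le hn hδ hδ1
    _ ≤ 125 * asaRate n δ * (12 * asaRate n δ * 4 ^ asaStages n) := by gcongr
    _ = 1500 * (asaRate n δ ^ 2 * 4 ^ asaStages n) := by ring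
    _ ≤ 39 ^ 2 * (asaRate n δ ^ 2 * 4 ^ asaStages n) := by gcongr; norm_num
    _ = (39 * asaRate n δ * 2 ^ asaStages n) ^ 2 := by rw [mul_pow, mul_pow, hfour]; ring

lemma max_asaDeviation_le (hn : 100 ≤ n) (hδ : 0 < δ) (hδ1 : δ ≤ 1) {α Γ R₀ : ℝ} (hα : 0 ≤ α)
    (hΓ : 0 ≤ Γ) (hR₀ : 0 ≤ R₀) {m : ℕ} (hm : asaStages n = m + 1) :
    max (Γ * asaDeviation n δ * (R₀ / 2 ^ m)) (8 * α * (Γ * asaDeviation n δ) ^ 2)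
      ≤ 1000 * (max (α * Γ ^ 2) (R₀ * Γ) * asaRate n δ) := by
  have hr := asaRate_nonneg hn hδ hδ1
  refine max_le ?_ ?_
  · calc Γ * asaDeviation n δ * (R₀ / 2 ^ m)
        = 2 * (R₀ * Γ * (asaDeviation n δ / 2 ^ asaStages n)) := by
          rw [hm, pow_succ]; field_simp
      _ ≤ 2 * (R₀ * Γ * (39 * asaRate n δ)) := by
          gcongr
          exact asaDeviation_div_two_pow_le hn hδ hδ1
      _ = 78 * (R₀ * Γ * asaRate n δ) := by ring
      _ ≤ 1000 * (max (α * Γ ^ 2) (R₀ * Γ) * asaRate n δ) := by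
          gcongr
          · norm_num
          · exact le_max_right _ _
  · calc 8 * α * (Γ * asaDeviation n δ) ^ 2 = 8 * (α * Γ ^ 2 * asaDeviation n δ ^ 2) := by ring
      _ ≤ 8 * (α * Γ ^ 2 * (125 * asaRate n δ)) := by
          gcongr
          exact asaDeviation_sq_le hn hδ hδ1
      _ = 1000 * (α * Γ ^ 2 * asaRate n δ) := by ring
      _ ≤ 1000 * (max (α * Γ ^ 2) (R₀ * Γ) * asaRate n δ) := by
          gcongr
          exact le_max_left _ _

variable {d : ℕ} {Z Ω : Type*} [MeasurableSpace Z] [MeasurableSpace Ω] {K : Set (Vec d)}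
  {μ : Measure Z} [IsProbabilityMeasure μ] {P : Vec d → ℝ} {g : Vec d → Z → Vec d} {Γ α R₀ : ℝ}
  {w₁ : Vec d} {ν : Measure Ω} [IsProbabilityMeasure ν] {ζ : ℕ → Ω → Z}

theorem IsStochasticSubgradient.measure_asa_excess_gt_le (hg : IsStochasticSubgradient K μ P g Γ)
    (hP : ConvexOn ℝ K P) (hcl : IsClosed K) (hΓ : 0 < Γ) (hα : 0 ≤ α) (hE : EBC K P 1 α)
    (hw₁ : w₁ ∈ K) (hdist : ∃ v ∈ minimizers K P, ‖w₁ - v‖ ≤ R₀) (hζ : IsIIDSample ν μ ζ)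
    (hn : 100 ≤ n) (hδ : 0 < δ) (hδ1 : δ ≤ 1) :
    ν {ω | 1000 * (max (α * Γ ^ 2) (R₀ * Γ) * asaRate n δ)
        < P (asa g K Γ R₀ w₁ n fun i => ζ i ω) - optimalValue K P} ≤ ENNReal.ofReal δ := by
  obtain ⟨v, hv, hwv⟩ := hdist
  rw [optimalValue_eq hv]
  rcases ((norm_nonneg _).trans hwv).eq_or_lt with rfl | hR₀
  · have hr := asaRate_nonneg hn hδ hδ1
    obtain rfl : w₁ = v := sub_eq_zero.1 (norm_le_zero_iff.1 hwv)
    have hbound : 0 ≤ 1000 * (max (α * Γ ^ 2) (0 * Γ) * asaRate n δ) := by positivity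
    simp only [asa, asaIter_eq_self hP.1 hcl hw₁, sub_self, hbound.not_gt, Set.ofPred_false,
      measure_empty, zero_le]
  · obtain ⟨m, hm⟩ := Nat.exists_eq_succ_of_ne_zero (asaStages_pos hn).ne'
    have hlog := log_asaStages_div_nonneg hn hδ hδ1
    have hm0 : (0 : ℝ) < asaStages n := by exact_mod_cast asaStages_pos hn
    calc _ ≤ ν {ω | max (Γ * asaDeviation n δ * (R₀ / 2 ^ m)) (8 * α * (Γ * asaDeviation n δ) ^ 2)
            < P (asaIter g K Γ R₀ w₁ (asaStageLength n) (fun i => ζ i ω) (m + 1)) - P v} := by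
          refine measure_mono fun ω hω => ?_
          rw [Set.mem_ofPred_eq, asa, hm] at hω
          exact (max_asaDeviation_le hn hδ hδ1 hα hΓ.le hR₀.le hm).trans_lt hω
      _ ≤ ENNReal.ofReal ((m + 1) * Real.exp (-(√(32 * Real.log (asaStages n / δ)) ^ 2 / 32))) :=
          hg.measure_asaIter_excess_gt_le hP hcl hΓ hα hE hR₀ hw₁ hv hwv hζ m (Real.sqrt_nonneg _)
            rfl
      _ = ENNReal.ofReal δ := by
          rw [Real.sq_sqrt (by positivity), mul_div_cancel_left₀ _ (by norm_num), ← Real.log_inv,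
            Real.exp_log (by positivity), inv_div, ← Nat.cast_succ, ← hm,
            mul_div_cancel₀ _ hm0.ne']

end ASARate

end L1Risk

theorem corollary4_general :
    ∃ (C₁ : ℝ → ℝ → ℝ → ℝ) (C₂ : ℝ) (C₃ : ℝ → ℝ → ℝ → ℝ → ℝ → ℝ),
    ∀ (d : ℕ) (Z : Type u) [MeasurableSpace Z] (μ : Measure Z) [IsProbabilityMeasure μ]
      (f : Vec d → Z → ℝ) (lam : ℝ) (K : Set (Vec d)),
      (IsPolyhedron K → K.Nonempty → Bornology.IsBounded K → ConvexOn ℝ K (risk μ f lam) →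
        IsPiecewiseQuadraticOn K (expectedLoss μ f) →
        ∃ α : ℝ, 0 < α ∧ EBC K (risk μ f lam) 1 α) ∧
      ∀ α : ℝ, 0 < α → EBC K (risk μ f lam) 1 α →
      ∀ (Ω : Type v) [MeasurableSpace Ω] (ν : Measure Ω) [IsProbabilityMeasure ν]
        (ζ : ℕ → Ω → Z), IsIIDSample ν μ ζ →
      (∀ B G : ℝ, 0 < B → K ⊆ Metric.closedBall 0 B → (∀ w ∈ K, Integrable (f w) μ) →
        0 < G → IsLipschitzLoss K f G → ∀ (n : ℕ) (δ : ℝ), 2 ≤ n → 0 < δ → δ < 1 →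
        (ν {ω | ∃ w ∈ minimizers K (empiricalRisk f lam n (fun i => ζ i ω)),
            C₁ α B G * (((d : ℝ) * Real.log n + Real.log (1 / δ)) / n)
              < risk μ f lam w - optimalValue K (risk μ f lam)} ≤ ENNReal.ofReal δ) ∧
        ∀ L ρ : ℝ, 0 ≤ lam → 0 ≤ L → 0 < ρ →
          IsNonnegSmoothConvexLoss (Metric.thickening ρ K) f L →
          ν {ω | ∃ w ∈ minimizers K (empiricalRisk f lam n (fun i => ζ i ω)),
            C₃ α B G L ρ * ((((d : ℝ) * Real.log n + Real.log (1 / δ)) / n) ^ 2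
                + ((d : ℝ) * Real.log n + Real.log (1 / δ)) * optimalValue K (risk μ f lam) / n)
              < risk μ f lam w - optimalValue K (risk μ f lam)} ≤ ENNReal.ofReal δ) ∧
      (IsClosed K → ConvexOn ℝ K (risk μ f lam) →
        ∀ (g : Vec d → Z → Vec d) (Γ R₀ : ℝ) (w₁ : Vec d), 0 < Γ →
        IsStochasticSubgradient K μ (risk μ f lam) g Γ → w₁ ∈ K →
        (∃ v ∈ minimizers K (risk μ f lam), ‖w₁ - v‖ ≤ R₀) →
        ∀ (n : ℕ) (δ : ℝ), 100 ≤ n → 0 < δ → δ < 1 →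
        ν {ω | C₂ * (max (α * Γ ^ 2) (R₀ * Γ) * (Real.log n * Real.log (Real.log n / δ)) / n)
              < risk μ f lam (asa g K Γ R₀ w₁ n (fun i => ζ i ω))
                - optimalValue K (risk μ f lam)} ≤ ENNReal.ofReal δ) := by
  refine ⟨fun α B G => 88 * (G * B + α * G ^ 2), 1000,
    fun α B G L ρ => smoothConst B G L (selfBound B G L ρ) (1 / (12 * α)),
    fun d Z _ μ _ f lam K => ⟨fun hK hne hbdd hconv hF => ?_, fun α hα hE Ω _ ν _ ζ hζ =>
      ⟨fun B G hB hKB hint hG hlip n δ hn hδ hδ1 => ⟨?_, fun L ρ hlam hL hρ hf => ?_⟩,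
        fun hcl hconv g Γ R₀ w₁ hΓ hg hw₁ hdist n δ hn hδ hδ1 => ?_⟩⟩⟩
  · exact (hF.add ((isPiecewiseQuadraticOn_l1Norm K).const_mul lam)).exists_EBC_one hK hne hbdd
      hconv
  · exact hlip.measure_erm_excess_gt_le hB hKB hG hα.le hint hE hζ hn hδ hδ1.le
  · simp only [mul_div_right_comm _ (optimalValue K _)]
    exact hf.measure_erm_excess_gt_le hB hKB hG hα hlam hL hρ hlip hint hE hζ hn hδ hδ1.le
  · simp only [mul_div_assoc (max _ _)]
    exact hg.measure_asa_excess_gt_le hconv hcl hΓ hα.le hE hw₁ hdist hζ hn hδ hδ1.le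

theorem corollary4 :
    ∃ (C₁ : ℝ → ℝ → ℝ → ℝ) (C₂ : ℝ) (κ C₃ : ℝ → ℝ → ℝ → ℝ → ℝ → ℝ),
    ∀ (d : ℕ) (Z : Type u) [MeasurableSpace Z] (μ : Measure Z) [IsProbabilityMeasure μ]
      (f : Vec d → Z → ℝ) (B lam : ℝ),
      0 < B → 0 ≤ lam →
      (∀ w ∈ l1Ball d B, Integrable (f w) μ) →
      ConvexOn ℝ (l1Ball d B) (risk μ f lam) →
      (IsQuadraticOn (l1Ball d B) (expectedLoss μ f) ∨
        IsPiecewiseLinearOn (l1Ball d B) (expectedLoss μ f)) →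
      -- the error bound condition holds with exponent one
      (∃ α : ℝ, 0 < α ∧ EBC (l1Ball d B) (risk μ f lam) 1 α) ∧
      -- rates, for every `α` for which it holds
      ∀ α : ℝ, 0 < α → EBC (l1Ball d B) (risk μ f lam) 1 α →
      ∀ G : ℝ, 0 < G → IsLipschitzLoss (l1Ball d B) f G →
      ∀ (Ω : Type v) [MeasurableSpace Ω] (ν : Measure Ω) [IsProbabilityMeasure ν]
        (ζ : ℕ → Ω → Z), IsIIDSample ν μ ζ →
      -- empirical risk minimization
      (∀ (n : ℕ) (δ : ℝ), 2 ≤ n → 0 < δ → δ < 1 →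
        ν {ω | ∃ w ∈ minimizers (l1Ball d B)
              (empiricalRisk f lam n (fun i => ζ i ω)),
            C₁ α B G * (((d : ℝ) * Real.log n + Real.log (1 / δ)) / n)
              < risk μ f lam w
                - optimalValue (l1Ball d B) (risk μ f lam)}
          ≤ ENNReal.ofReal δ) ∧
      -- adaptive stochastic approximation
      (∀ (g : Vec d → Z → Vec d) (Γ R₀ : ℝ) (w₁ : Vec d), 0 < Γ →
        IsStochasticSubgradient (l1Ball d B) μ (risk μ f lam) g Γ →
        w₁ ∈ l1Ball d B →
        (∃ v ∈ minimizers (l1Ball d B) (risk μ f lam), ‖w₁ - v‖ ≤ R₀) →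
        ∀ (n : ℕ) (δ : ℝ), 100 ≤ n → 0 < δ → δ < 1 →
        ν {ω | C₂ * (max (α * Γ ^ 2) (R₀ * Γ)
                * (Real.log n * Real.log (Real.log n / δ)) / n)
              < risk μ f lam
                  (asa g (l1Ball d B) Γ R₀ w₁ n (fun i => ζ i ω))
                - optimalValue (l1Ball d B) (risk μ f lam)}
          ≤ ENNReal.ofReal δ) ∧
      -- empirical risk minimization with non-negative smooth convex losses
      (∀ L ρ : ℝ, 0 ≤ L → 0 < ρ →
        IsNonnegSmoothConvexLoss (Metric.thickening ρ (l1Ball d B)) f L →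
        ∀ (n : ℕ) (δ : ℝ), 2 ≤ n → 0 < δ → δ < 1 →
        κ α B G L ρ * ((d : ℝ) * Real.log n) ≤ n →
        ν {ω | ∃ w ∈ minimizers (l1Ball d B)
              (empiricalRisk f lam n (fun i => ζ i ω)),
            C₃ α B G L ρ * ((((d : ℝ) * Real.log n + Real.log (1 / δ)) / n) ^ 2
                + ((d : ℝ) * Real.log n + Real.log (1 / δ))
                  * optimalValue (l1Ball d B) (risk μ f lam) / n)
              < risk μ f lam w
                - optimalValue (l1Ball d B) (risk μ f lam)}
          ≤ ENNReal.ofReal δ) := by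
  obtain ⟨C₁, C₂, C₃, h⟩ := corollary4_general.{u, v}
  refine ⟨C₁, C₂, fun _ _ _ _ _ => 0, C₃, fun d Z _ μ _ f B lam hB hlam hint hconv hF => ?_⟩
  have hpoly := isPolyhedron_l1Ball (d := d) B
  have hball := l1Ball_subset_closedBall (d := d) B
  obtain ⟨hEBC, hrates⟩ := h d Z μ f lam (l1Ball d B)
  refine ⟨hEBC hpoly ⟨0, zero_mem_l1Ball hB.le⟩ (Metric.isBounded_closedBall.subset hball) hconv
    (hF.elim (·.isPiecewiseQuadraticOn) (·.isPiecewiseQuadraticOn)),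
    fun α hα hE G hG hlip Ω _ ν _ ζ hζ => ?_⟩
  obtain ⟨herm, hasa⟩ := hrates α hα hE Ω ν ζ hζ
  exact ⟨fun n δ hn hδ hδ1 => (herm B G hB hball hint hG hlip n δ hn hδ hδ1).1,
    hasa hpoly.isClosed hconv, fun L ρ hL hρ hf n δ hn hδ hδ1 _ =>
      (herm B G hB hball hint hG hlip n δ hn hδ hδ1).2 L ρ hlam hL hρ hf⟩
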